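/- Let $k\ge 1$ and let $P\in\mathbb C[z]$ be a polynomial of degree $k+1$ all of whose zeros (the equilibria of $\dot z=P(z)$) are simple. Notation. For a zero $a$ of $P$ let $\nu_a=2\pi i/P'(a)$ be its period. A separatrix of a vector field is an orbit that reaches $\infty$ in finite (positive or negative) time; the separatrix graph consists of the singular points and the separatrices. The point $a$ is a center of $\dot z=e^{i\arg\nu_a}P(z)$; its periodic domain is the connected component of the complement of the separatrix graph of this field that surrounds $a$, with $a$ added. A cut $D$ from $a$ to $\infty$ is the point $a$ together with a separatrix of $\dot z=e^{i(\arg\nu_a-\pi/2)}P(z)$ contained in the periodic domain of $a$. Choose one cut for each equilibrium and label the equilibria $z_0,\dots,z_k$, the cuts $D_0,\dots,D_k$ and the periods $\nu_0,\dots,\nu_k$ in the anti-clockwise order in which the cuts arrive at $\infty$. Let $X$ be the Riemann surface of the multivalued function $t(z)=\int_\infty^z \frac{d\zeta}{P(\zeta)}$ on $\mathbb{CP}^1\smallsetminus\{z_0,\dots,z_k\}$: its points are the pairs (point, value of $t$ there), its sheets are the graphs of local branches of $t$. A branch of $t$ on the cut plane $U=\mathbb C\smallsetminus\bigcup_j D_j$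 defines a map $z\mapsto t(z)$ from $U$ to $X$; the star domain is the closure in $X$ of its image. The period curve is the closed curve in $X$ obtained by lifting, through this branch, the curve that follows successively the boundaries of the periodic domains of $z_k,z_{k-1},\dots,z_0$; its part over the boundary of the periodic domain of $z_j$, called the side $\nu_j$, starts and ends at points over $\infty$, and $t$ maps it onto an oriented segment $[a_j,a_j+\nu_j]$. The (closed) periodgon is the period curve together with the part of $X$ that it encloses, i.e. the relatively compact connected components of its complement. Proposition. The function $t$ has a branch on $U$. For each such branch: (1) $U$ is open, and $z\mapsto t(z)$ is a biholomorphism from $U$ onto the interior of the star domain. (2) The period curve exists. The star domain is obtained by gluing to each side $\nu_j$ of the periodgon a perpendicular infinite half-strip of width $|\nu_j|$ on the left of $\nu_j$ (the exterior of the periodgon). That is, the star domain is the union of the periodgon and of closed sets $H_0,\dots,H_k\subset X$ such that $t$ maps $H_j$ homeomorphically onto $\{a_j+s\nu_j+ri\nu_j : 0\le s\le 1,\ r\ge 0\}$, with the side $\nu_j$ corresponding to $r=0$; the set $H_j$ meets the periodgon exactly in the side $\nu_j$, and $H_i\cap H_j$ is contained in the intersection of the sides $\nu_i$ and $\nu_j$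 for $i\ne j$. (3) Each cut $D_j$ is mapped to the pair of rays bounding $H_j$: the points of the star domain over $D_j$ are those of $H_j$ lying over the two rays $a_j+ri\nu_j$ and $a_j+\nu_j+ri\nu_j$, $r>0$; each of these two rays corresponds bijectively to $D_j\smallsetminus\{z_j\}$, and points of the two rays that differ by the period shift $\nu_j$ lie over the same point of $D_j$. -/

import Mathlib

open Set Filter Topology

/-- The vector field `ż = e^{iβ} P(z)` on `ℂ`. -/
noncomputable def rotatedField (P : Polynomial ℂ) (β : ℝ) (z : ℂ) : ℂ :=
  Complex.exp (β * Complex.I) * P.eval z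

/-- The real trajectory of `ż = F(z)` starting at `z` reaches `∞` in finite positive time. -/
def EscapesForward (F : ℂ → ℂ) (z : ℂ) : Prop :=
  ∃ T : ℝ, 0 < T ∧ ∃ γ : ℝ → ℂ, γ 0 = z ∧
    (∀ s ∈ Ico (0 : ℝ) T, HasDerivAt γ (F (γ s)) s) ∧
    Tendsto γ (𝓝[<] T) (Bornology.cobounded ℂ)

/-- The point `z` lies on a separatrix of `∞`: its trajectory reaches `∞` in finite positive
or negative time. -/
def OnSeparatrix (F : ℂ → ℂ) (z : ℂ) : Prop :=
  EscapesForward F z ∨ EscapesForward (fun w => -F w) z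

/-- The maximal real orbit of `ż = F(z)` through `z`. -/
def realOrbit (F : ℂ → ℂ) (z : ℂ) : Set ℂ :=
  {w | ∃ (γ : ℝ → ℂ) (T : ℝ), γ 0 = z ∧ γ T = w ∧ ∀ s ∈ uIcc 0 T, HasDerivAt γ (F (γ s)) s}

/-- `S` is a separatrix of `∞` for `ż = F(z)` (a full orbit, as a subset of `ℂ`). -/
def IsSeparatrix (F : ℂ → ℂ) (S : Set ℂ) : Prop :=
  ∃ z, OnSeparatrix F z ∧ S = realOrbit F z

/-- The separatrix graph: the singular points together with the separatrices of `∞`. -/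
def separatrixGraph (F : ℂ → ℂ) : Set ℂ :=
  {z | F z = 0 ∨ OnSeparatrix F z}

/-- The period `ν = 2πi / P'(a)` of a simple equilibrium `a`. -/
noncomputable def period (P : Polynomial ℂ) (a : ℂ) : ℂ :=
  2 * Real.pi * Complex.I / P.derivative.eval a

/-- The periodic domain of a simple equilibrium `a`: the zone (connected component of the
complement of the separatrix graph) of `ż = e^{i arg ν} P(z)` that surrounds the center `a`,
with the center itself filled in. -/
def periodicDomain (P : Polynomial ℂ) (a : ℂ) : Set ℂ :=
  insert a {z | z ∈ (separatrixGraph (rotatedField P (period P a).arg))ᶜ ∧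
    insert a (connectedComponentIn (separatrixGraph (rotatedField P (period P a).arg))ᶜ z) ∈ 𝓝 a}

/-- `D` is a cut from the simple equilibrium `a` to `∞`: the point `a` together with a separatrix
of `ż = e^{i (arg ν - π/2)} P(z)` contained in the periodic domain of `a`. -/
def IsCut (P : Polynomial ℂ) (a : ℂ) (D : Set ℂ) : Prop :=
  ∃ S, IsSeparatrix (rotatedField P ((period P a).arg - Real.pi / 2)) S ∧
    S ⊆ periodicDomain P a ∧ D = insert a S

/-- `z` lists the equilibria of `P` without repetition, `D j` is a cut from `z j`, and the
labelling follows the anti-clockwise order in which the cuts arrive at `∞`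
(`θ j` is the asymptotic argument of `D j` at `∞`). -/
def IsCutSystem {k : ℕ} (P : Polynomial ℂ) (z : Fin (k + 1) → ℂ) (D : Fin (k + 1) → Set ℂ) :
    Prop :=
  Function.Injective z ∧ (∀ a, P.IsRoot a ↔ a ∈ range z) ∧ (∀ j, IsCut P (z j) (D j)) ∧
  ∃ θ : Fin (k + 1) → ℝ, StrictMono θ ∧ θ (Fin.last k) < θ 0 + 2 * Real.pi ∧
    ∀ j, Tendsto (fun w : ℂ => w / (‖w‖ : ℂ)) (Bornology.cobounded ℂ ⊓ 𝓟 (D j))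
      (𝓝 (Complex.exp (θ j * Complex.I)))

/-- The cut plane. -/
def cutPlane {k : ℕ} (D : Fin (k + 1) → Set ℂ) : Set ℂ := (⋃ j, D j)ᶜ

/-- `τ` is one of the values of the multivalued function `t(w) = ∫_∞^w dz / P(z)`, for `w` in the
Riemann sphere minus the zeros of `P`: it is the (improper) integral along some `C¹` path from `∞`
to `w` that avoids the zeros of `P`. -/
def IsTimeValue (P : Polynomial ℂ) (w : OnePoint ℂ) (τ : ℂ) : Prop :=
  (∀ a : ℂ, P.IsRoot a → w ≠ (a : OnePoint ℂ)) ∧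
  ∃ γ : ℝ → ℂ, ContDiffOn ℝ 1 γ (Ioo 0 1) ∧ (∀ s ∈ Ioo (0 : ℝ) 1, P.eval (γ s) ≠ 0) ∧
    Tendsto (fun s => (γ s : OnePoint ℂ)) (𝓝[>] 0) (𝓝 OnePoint.infty) ∧
    Tendsto (fun s => (γ s : OnePoint ℂ)) (𝓝[<] 1) (𝓝 w) ∧
    Tendsto (fun q : ℝ × ℝ => ∫ s in q.1..q.2, deriv γ s / P.eval (γ s))
      (𝓝[>] 0 ×ˢ 𝓝[<] 1) (𝓝 τ)

/-- The Riemann surface of the multivalued function `t(z)`: its points are the pairs of a point of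
the sphere minus the zeros of `P` and a value of `t` there. -/
structure TimeSurface (P : Polynomial ℂ) where
  pt : OnePoint ℂ
  time : ℂ
  isTimeValue : IsTimeValue P pt time

/-- `f` is a local primitive of `dz / P(z)` on the open subset `V` of the sphere minus the zeros of
`P` (continuous at `∞` if `∞ ∈ V`). -/
def IsLocalPrimitive (P : Polynomial ℂ) (V : Set (OnePoint ℂ)) (f : OnePoint ℂ → ℂ) : Prop :=
  IsOpen V ∧ ContinuousOn f V ∧
    ∀ z : ℂ, (z : OnePoint ℂ) ∈ V → P.eval z ≠ 0 ∧
      HasDerivAt (fun w : ℂ => f (w : OnePoint ℂ)) (1 / P.eval z) z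

/-- The topology of the Riemann surface: the sheets, i.e. the graphs of local branches of `t`,
form a basis. The projection `pt` to the sphere is then a local homeomorphism, and it
carries the complex structure; away from the points over `∞`, the function `time`, whose derivative
with respect to `z` is `1 / P(z) ≠ 0`, is a local holomorphic coordinate as well. -/
instance (P : Polynomial ℂ) : TopologicalSpace (TimeSurface P) :=
  TopologicalSpace.generateFrom
    {W | ∃ (V : Set (OnePoint ℂ)) (f : OnePoint ℂ → ℂ), IsLocalPrimitive P V f ∧
      W = {p | p.pt ∈ V ∧ p.time = f p.pt}}

/-- `τ` is a single-valued holomorphic branch of `t(z)` on `U`. -/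
def IsTimeBranch (P : Polynomial ℂ) (U : Set ℂ) (τ : ℂ → ℂ) : Prop :=
  ∀ z ∈ U, IsTimeValue P (z : OnePoint ℂ) (τ z) ∧ HasDerivAt τ (1 / P.eval z) z

/-- The map `z ↦ t(z)` from `U` to the Riemann surface of `t`, for a branch of `t` on `U`. -/
def branchMap {P : Polynomial ℂ} {U : Set ℂ} {τ : ℂ → ℂ} (h : IsTimeBranch P U τ) (u : U) :
    TimeSurface P :=
  ⟨((u : ℂ) : OnePoint ℂ), τ u, (h u u.2).1⟩

/-- The star domain: the closure, on the Riemann surface of `t`, of the image of the cut plane. -/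
def starDomain {P : Polynomial ℂ} {U : Set ℂ} {τ : ℂ → ℂ} (h : IsTimeBranch P U τ) :
    Set (TimeSurface P) :=
  closure (range (branchMap h))

/-- The period curve, parametrized by `[0, k+1]`: the closed lift, through the branch of `t` on the
cut plane, of the curve that follows successively the homoclinic loops bounding the
periodic domains of `z_k, z_{k-1}, …, z_0`. On `[k-j, k-j+1]` it starts and ends over `∞`, stays
over the boundary of the periodic domain of `z_j`, and the time moves uniformly by `ν_j`. -/
def IsPeriodCurve {k : ℕ} {P : Polynomial ℂ} (z : Fin (k + 1) → ℂ) {U : Set ℂ} {τ : ℂ → ℂ}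
    (h : IsTimeBranch P U τ) (c : ℝ → TimeSurface P) : Prop :=
  ContinuousOn c (Icc 0 ((k : ℝ) + 1)) ∧ c ((k : ℝ) + 1) = c 0 ∧
  ∀ j : Fin (k + 1),
    (c ((k : ℝ) - (j : ℕ))).pt = OnePoint.infty ∧
    (c ((k : ℝ) - (j : ℕ) + 1)).pt = OnePoint.infty ∧
    ∀ s ∈ Icc (0 : ℝ) 1,
      (c ((k : ℝ) - (j : ℕ) + s)).time = (c ((k : ℝ) - (j : ℕ))).time + s * period P (z j) ∧
      ((c ((k : ℝ) - (j : ℕ) + s)).pt = OnePoint.infty ∨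
        ∃ u : U, (u : ℂ) ∈ frontier (periodicDomain P (z j)) ∧
          c ((k : ℝ) - (j : ℕ) + s) = branchMap h u)

/-- A set together with everything it encloses: the set and the relatively compact components of its
complement. -/
def fillIn {X : Type*} [TopologicalSpace X] (K : Set X) : Set X :=
  K ∪ {p | p ∈ Kᶜ ∧ IsCompact (closure (connectedComponentIn Kᶜ p))}

/-- The (closed) periodgon bounded by the period curve `c`. -/
def periodgon {P : Polynomial ℂ} (k : ℕ) (c : ℝ → TimeSurface P) : Set (TimeSurface P) :=
  fillIn (c '' Icc 0 ((k : ℝ) + 1))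

/-- The closed half-strip in `ℂ` perpendicular to the side from `a` to `a + ν`, on its left. -/
def halfStrip (a ν : ℂ) : Set ℂ :=
  {w | ∃ s ∈ Icc (0 : ℝ) 1, ∃ r ∈ Ici (0 : ℝ), w = a + s * ν + r * (Complex.I * ν)}

/-- The open ray in `ℂ` starting at `a`, perpendicular to `ν`, on the left of `ν`. -/
def perpRay (a ν : ℂ) : Set ℂ :=
  {w | ∃ r ∈ Ioi (0 : ℝ), w = a + r * (Complex.I * ν)}

/-- The map `z ↦ t(z)` is a biholomorphism from `U` onto the interior of the star domain: it is a
homeomorphism onto it, and near every point of the interior `time` is a local coordinate in which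
the map (given by `τ`) and its inverse (given by `ψ`) are holomorphic. -/
def IsBiholomorphicOntoInterior {P : Polynomial ℂ} {U : Set ℂ} {τ : ℂ → ℂ}
    (h : IsTimeBranch P U τ) : Prop :=
  IsOpen U ∧ IsOpenEmbedding (branchMap h) ∧ range (branchMap h) = interior (starDomain h) ∧
  DifferentiableOn ℂ τ U ∧
  ∀ p ∈ interior (starDomain h), ∃ (e : OpenPartialHomeomorph (TimeSurface P) ℂ) (ψ : ℂ → ℂ),
    p ∈ e.source ∧ e.source ⊆ interior (starDomain h) ∧ EqOn e TimeSurface.time e.source ∧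
    DifferentiableOn ℂ ψ e.target ∧
    ∀ w ∈ e.target, ∃ hw : ψ w ∈ U, e.symm w = branchMap h ⟨ψ w, hw⟩

/-- The star domain is obtained from the periodgon by gluing to each side `ν_j` the perpendicular
half-strip of width `|ν_j|` on its left, by means of the maps `g j` from the planar half-strips to
the Riemann surface; these are right inverses of `time`, hence homeomorphisms onto their
images. The half-strips meet the periodgon exactly in its sides, and meet each other in sides only. -/
def IsGluedFromHalfStrips {k : ℕ} {P : Polynomial ℂ} (z : Fin (k + 1) → ℂ) {U : Set ℂ} {τ : ℂ → ℂ}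
    (h : IsTimeBranch P U τ) (c : ℝ → TimeSurface P) (g : Fin (k + 1) → ℂ → TimeSurface P) : Prop :=
  let a : Fin (k + 1) → ℂ := fun j => (c ((k : ℝ) - (j : ℕ))).time
  let ν : Fin (k + 1) → ℂ := fun j => period P (z j)
  let H : Fin (k + 1) → Set ℂ := fun j => halfStrip (a j) (ν j)
  let side : Fin (k + 1) → Set ℂ := fun j => segment ℝ (a j) (a j + ν j)
  (∀ j, ContinuousOn (g j) (H j) ∧ IsClosed (g j '' H j) ∧ (∀ w ∈ H j, (g j w).time = w) ∧
    (∀ s ∈ Icc (0 : ℝ) 1, g j (a j + s * ν j) = c ((k : ℝ) - (j : ℕ) + s)) ∧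
    (g j '' H j) ∩ periodgon k c = g j '' side j) ∧
  (∀ i j, i ≠ j → (g i '' H i) ∩ (g j '' H j) ⊆ (g i '' side i) ∩ (g j '' side j)) ∧
  starDomain h = periodgon k c ∪ ⋃ j, g j '' H j

/-- Each cut `D j` corresponds to the two rays that bound the half-strip glued to the side `ν_j`:
they are the points of the star domain over `D j`, each of them projects bijectively
onto the cut (without its end point `z j`), and they are identified by the shift by `ν_j`. -/
def CutsMapToRays {k : ℕ} {P : Polynomial ℂ} (z : Fin (k + 1) → ℂ) (D : Fin (k + 1) → Set ℂ)
    {U : Set ℂ} {τ : ℂ → ℂ} (h : IsTimeBranch P U τ) (c : ℝ → TimeSurface P)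
    (g : Fin (k + 1) → ℂ → TimeSurface P) : Prop :=
  ∀ j : Fin (k + 1),
    let a : ℂ := (c ((k : ℝ) - (j : ℕ))).time
    let ν : ℂ := period P (z j)
    {p | p ∈ starDomain h ∧ p.pt ∈ ((↑) : ℂ → OnePoint ℂ) '' D j} =
        g j '' perpRay a ν ∪ g j '' perpRay (a + ν) ν ∧
    BijOn (fun w => (g j w).pt) (perpRay a ν) (((↑) : ℂ → OnePoint ℂ) '' (D j \ {z j})) ∧
    BijOn (fun w => (g j w).pt) (perpRay (a + ν) ν) (((↑) : ℂ → OnePoint ℂ) '' (D j \ {z j})) ∧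
    ∀ w ∈ perpRay a ν, (g j (w + ν)).pt = (g j w).pt

/-! Everything is read in the time coordinate `w = t / ν` of each periodic domain. Near a simple
zero `a` the field is linearizable, so `φ' = ν P(φ)` has the solution `ψ (exp (2πi w))` near `i∞`,
of period one. It continues to a maximal half plane, which exists because `ż = P(z)` has no
nonconstant entire solution (`eval_eq_zero_of_entire`: Liouville, plus the maximum principle and the
fact that `∞` is at finite time). Normalized to `Im w > 0` this is a `PeriodicChart`: injective
modulo `ℤ`, continuous up to the real line with values in the sphere, and equal to `∞` somewhere on
that line, since otherwise it would continue further (`exists_periodicChart`).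

In this chart trajectories are straight lines. Horizontal lines are the periodic orbits, the real
line consists of separatrices and blow-up points, and vertical lines over blow-up points are the
possible cuts (`periodicDomain_eq`, `exists_of_isCut`). After a real translation the cut is the
positive imaginary axis, so the domain minus its cut is the image of `0 < Re w < 1`, `Im w > 0`, and
its two edges are identified by `w ↦ w + 1`. Such a strip, multiplied by `ν`, is the half-strip
attached to the side `ν`. Domains of different equilibria are disjoint (`disjoint_image`).

A branch of `t` off the cuts comes from partial fractions and a logarithm of `z - z j` off each cut.
Near `∞` the order of the cuts enters: on the sector from `D j` anti-clockwise to the next cut, time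
is a constant plus the primitive vanishing at `∞`. Computing this constant from both bounding charts
gives `base j = base (j+1) + ν (j+1)` (`branch_near_infty`), so the sides close up into the period
curve.

Let the core be the complement of the closed periodic domains. Its lift together with the boundary
curve is compact (`isCompact_core_union`), and the lifted closed strips are closed. Hence the star
domain is exactly their union (`starDomain_eq`). The compact part is the periodgon: a component of
the complement of the curve that misses the core cannot be relatively compact, because its image
under the open map `time` would be open and compact in `ℂ`, or else it would contain an unbounded
strip (`not_isCompact_closure_component`, `fillIn_boundaryCurve`). Finally a period curve is unique
(`eq_lift_of_side`), so the statements proved for the constructed curve hold for every one. -/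

/-! ### The time coordinate near infinity -/

/-- A primitive of `dz / P(z)` near `∞` in the coordinate `v = 1 / z`, together with a coordinate
`ζ` in which it is a monomial. -/
structure InfinityChart (k : ℕ) (P : Polynomial ℂ) where
  F : ℂ → ℂ
  ζ : ℂ → ℂ
  κ : ℂ
  r : ℝ
  r_pos : 0 < r
  κ_ne : κ ≠ 0
  F_zero : F 0 = 0
  ζ_zero : ζ 0 = 0
  analyticAt_F : ∀ v ∈ Metric.ball (0 : ℂ) r, AnalyticAt ℂ F v
  analyticAt_ζ : ∀ v ∈ Metric.ball (0 : ℂ) r, AnalyticAt ℂ ζ v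
  hasDerivAt_ζ : HasDerivAt ζ 1 0
  injOn_ζ : InjOn ζ (Metric.ball (0 : ℂ) r)
  F_eq : ∀ v ∈ Metric.ball (0 : ℂ) r, F v = κ * ζ v ^ k
  eval_ne : ∀ v ∈ Metric.ball (0 : ℂ) r, v ≠ 0 → P.eval v⁻¹ ≠ 0
  hasDerivAt_F : ∀ v ∈ Metric.ball (0 : ℂ) r, v ≠ 0 →
    HasDerivAt F (-(v ^ 2)⁻¹ / P.eval v⁻¹) v

lemma eval_inv_eq_reverse (P : Polynomial ℂ) {v : ℂ} (hv : v ≠ 0) :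
    P.eval v⁻¹ = P.reverse.eval v / v ^ P.natDegree := by
  have : Invertible (v⁻¹) := invertibleOfNonzero (inv_ne_zero hv)
  have h := Polynomial.eval₂_reverse_mul_pow (RingHom.id ℂ) v⁻¹ P
  rw [invOf_eq_inv, inv_inv] at h
  rw [Polynomial.eval, ← h, Polynomial.eval, inv_pow, div_eq_mul_inv]

/-- The quotient `g / g 0` is near `1`, inside the slit plane, so its principal `k`-th root is
analytic and can be absorbed into `v`. -/
lemma AnalyticAt.exists_pow_root {g : ℂ → ℂ} (hg : AnalyticAt ℂ g 0) (hg0 : g 0 ≠ 0) {k : ℕ}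
    (hk : 1 ≤ k) : ∃ ζ : ℂ → ℂ, AnalyticAt ℂ ζ 0 ∧ ζ 0 = 0 ∧ HasDerivAt ζ 1 0 ∧
      ∀ᶠ v in 𝓝 0, v ^ k * g v = g 0 * ζ v ^ k := by
  have hk0 : k ≠ 0 := by omega
  have hdiv : AnalyticAt ℂ (fun v => g v / g 0) 0 := hg.div analyticAt_const hg0
  have hslit : g 0 / g 0 ∈ Complex.slitPlane := by
    rw [div_self hg0]; exact Complex.one_mem_slitPlane
  have hroot : AnalyticAt ℂ (fun v => (g v / g 0) ^ ((k : ℂ)⁻¹)) 0 :=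
    hdiv.cpow analyticAt_const hslit
  refine ⟨fun v => v * (g v / g 0) ^ ((k : ℂ)⁻¹), analyticAt_id.mul hroot, by simp, ?_, ?_⟩
  · have := (hasDerivAt_id (0 : ℂ)).mul hroot.differentiableAt.hasDerivAt
    exact this.congr_deriv (by simp [hg0])
  · refine Eventually.of_forall fun v => ?_
    rw [mul_pow, Complex.cpow_nat_inv_pow _ hk0]
    field_simp

/-- In `v = 1 / z` the form `dz / P` becomes `-v ^ (k - 1) / P.reverse(v) dv`. It has a zero of
order `k - 1` at `∞`, so the primitive vanishing there has order exactly `k` and is a constant times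
the `k`-th power of a coordinate. -/
theorem exists_infinityChart (k : ℕ) (hk : 1 ≤ k) (P : Polynomial ℂ) (hdeg : P.natDegree = k + 1) :
    Nonempty (InfinityChart k P) := by
  have hP : P ≠ 0 := by rintro rfl; simp at hdeg
  have hrev0 : P.reverse.eval 0 ≠ 0 := by
    rw [← Polynomial.coeff_zero_eq_eval_zero, Polynomial.coeff_zero_reverse]
    exact Polynomial.leadingCoeff_ne_zero.2 hP
  obtain ⟨r, hr, hrev⟩ : ∃ r > 0, ∀ v ∈ Metric.ball (0 : ℂ) r, P.reverse.eval v ≠ 0 :=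
    Metric.eventually_nhds_iff_ball.1
      (P.reverse.continuous.continuousAt.eventually_ne hrev0)
  have hanal : ∀ v ∈ Metric.ball (0 : ℂ) r,
      AnalyticAt ℂ (fun v : ℂ => -v ^ (k - 1) / P.reverse.eval v) v := fun v hv =>
    (analyticAt_id.pow _).neg.div (AnalyticOnNhd.eval_polynomial P.reverse v (mem_univ v))
      (hrev v hv)
  have hexact : Complex.IsExactOn (fun v : ℂ => -v ^ (k - 1) / P.reverse.eval v)
      (Metric.ball 0 r) := DifferentiableOn.isExactOn_ball
    fun v hv => (hanal v hv).differentiableAt.differentiableWithinAt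
  obtain ⟨F, hF0, hF⟩ := hexact.with_val_at 0 0
  have hFan : ∀ v ∈ Metric.ball (0 : ℂ) r, AnalyticAt ℂ F v := fun v hv =>
    DifferentiableOn.analyticAt (fun w hw => (hF w hw).differentiableAt.differentiableWithinAt)
      (Metric.isOpen_ball.mem_nhds hv)
  have h0 : (0 : ℂ) ∈ Metric.ball (0 : ℂ) r := Metric.mem_ball_self hr
  have hderiv : deriv F =ᶠ[𝓝 0] fun v : ℂ => v ^ (k - 1) * (-1 / P.reverse.eval v) := by
    filter_upwards [Metric.isOpen_ball.mem_nhds h0] with v hv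
    rw [(hF v hv).deriv]; ring
  have hordd : analyticOrderAt (deriv F) 0 = ((k - 1 : ℕ) : ℕ∞) := by
    rw [(hFan 0 h0).deriv.analyticOrderAt_eq_natCast]
    refine ⟨fun v => -1 / P.reverse.eval v, analyticAt_const.div
      (AnalyticOnNhd.eval_polynomial P.reverse 0 (mem_univ 0)) (hrev 0 h0), ?_, ?_⟩
    · exact div_ne_zero (by norm_num) (hrev 0 h0)
    · filter_upwards [hderiv] with v hv
      rw [hv, sub_zero, smul_eq_mul]
  have hord : analyticOrderAt F 0 = (k : ℕ∞) := by
    have := (hFan 0 h0).analyticOrderAt_deriv_add_one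
    simp only [hF0, sub_zero] at this
    rw [← this, hordd]
    exact_mod_cast Nat.sub_add_cancel hk
  obtain ⟨g, hg, hg0, hFg⟩ := (hFan 0 h0).analyticOrderAt_eq_natCast.1 hord
  obtain ⟨ζ, hζ, hζ0, hζd, hζk⟩ := hg.exists_pow_root hg0 hk
  have hstrict : HasStrictDerivAt ζ 1 0 := by
    have := hζ.hasStrictDerivAt; rwa [hζd.deriv] at this
  have hinj : ∃ u ∈ 𝓝 (0 : ℂ), InjOn ζ u := by
    let e := (hstrict.hasStrictFDerivAt_equiv one_ne_zero).toOpenPartialHomeomorph ζ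
    exact ⟨e.source, e.open_source.mem_nhds
      (hstrict.hasStrictFDerivAt_equiv one_ne_zero).mem_toOpenPartialHomeomorph_source, e.injOn⟩
  obtain ⟨u, hu, hinj⟩ := hinj
  obtain ⟨s, hs, hsall⟩ := Metric.eventually_nhds_iff_ball.1
    ((hFg.and hζk).and ((hζ.eventually_analyticAt).and (hu : ∀ᶠ v in 𝓝 0, v ∈ u)))
  have hrs : Metric.ball (0 : ℂ) (min r s) ⊆ Metric.ball 0 r ∩ Metric.ball 0 s :=
    subset_inter (Metric.ball_subset_ball (min_le_left _ _))
      (Metric.ball_subset_ball (min_le_right _ _))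
  refine ⟨⟨F, ζ, g 0, min r s, lt_min hr hs, hg0, hF0, hζ0, fun v hv => hFan v (hrs hv).1,
    fun v hv => (hsall v (hrs hv).2).2.1, hζd,
    hinj.mono fun v hv => (hsall v (hrs hv).2).2.2, fun v hv => ?_, fun v hv hv0 => ?_,
    fun v hv hv0 => ?_⟩⟩
  · obtain ⟨⟨h1, h2⟩, -⟩ := hsall v (hrs hv).2
    rw [h1, ← h2, sub_zero, smul_eq_mul]
  · rw [eval_inv_eq_reverse P hv0]
    exact div_ne_zero (hrev v (hrs hv).1) (pow_ne_zero _ hv0)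
  · refine (hF v (hrs hv).1).congr_deriv ?_
    have := hrev v (hrs hv).1
    obtain ⟨n, rfl⟩ : ∃ n, k = n + 1 := ⟨k - 1, by omega⟩
    rw [eval_inv_eq_reverse P hv0, hdeg]
    simp only [Nat.add_sub_cancel]
    field_simp
    ring

namespace InfinityChart
variable {k : ℕ} {P : Polynomial ℂ} (C : InfinityChart k P)

/-- The primitive of `dz / P(z)` near `∞` that vanishes at `∞`. -/
noncomputable def f (z : ℂ) : ℂ := C.F z⁻¹

lemma inv_mem {z : ℂ} (hz : C.r⁻¹ < ‖z‖) : z⁻¹ ∈ Metric.ball (0 : ℂ) C.r := by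
  rw [mem_ball_zero_iff, norm_inv]
  exact inv_lt_of_inv_lt₀ C.r_pos hz

lemma ne_zero {z : ℂ} (hz : C.r⁻¹ < ‖z‖) : z ≠ 0 := by
  rintro rfl
  rw [norm_zero] at hz
  exact (inv_pos.2 C.r_pos).not_gt hz

lemma eval_ne' {z : ℂ} (hz : C.r⁻¹ < ‖z‖) : P.eval z ≠ 0 := by
  simpa using C.eval_ne _ (C.inv_mem hz) (inv_ne_zero (C.ne_zero hz))

lemma hasDerivAt_f {z : ℂ} (hz : C.r⁻¹ < ‖z‖) : HasDerivAt C.f (1 / P.eval z) z := by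
  have hz0 := C.ne_zero hz
  have h := (C.hasDerivAt_F _ (C.inv_mem hz) (inv_ne_zero hz0)).comp z (hasDerivAt_inv hz0)
  exact h.congr_deriv (by rw [inv_inv]; field_simp)

lemma f_eq {z : ℂ} (hz : C.r⁻¹ < ‖z‖) : C.f z = C.κ * C.ζ z⁻¹ ^ k := C.F_eq _ (C.inv_mem hz)

lemma tendsto_f : Tendsto C.f (Bornology.cobounded ℂ) (𝓝 0) := by
  have h : ContinuousAt C.F 0 := (C.analyticAt_F 0 (Metric.mem_ball_self C.r_pos)).continuousAt
  have := h.tendsto.comp (tendsto_inv₀_cobounded (α := ℂ))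
  rwa [C.F_zero] at this

lemma ζ_ne_zero {v : ℂ} (hv : v ∈ Metric.ball (0 : ℂ) C.r) (h0 : v ≠ 0) : C.ζ v ≠ 0 := fun h =>
  h0 (C.injOn_ζ hv (Metric.mem_ball_self C.r_pos) (h.trans C.ζ_zero.symm))

lemma tendsto_ζ_div : Tendsto (fun v => C.ζ v / v) (𝓝[≠] 0) (𝓝 1) := by
  have := C.hasDerivAt_ζ.tendsto_slope
  refine this.congr' ?_
  filter_upwards with v
  simp [slope_def_field, C.ζ_zero]

/-- The primitive at `∞` takes all values near `0`. -/
lemma eventually_exists_f_eq (R : ℝ) :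
    ∀ᶠ t in 𝓝[≠] (0 : ℂ), ∃ z : ℂ, R < ‖z‖ ∧ C.r⁻¹ < ‖z‖ ∧ C.f z = t := by
  have h0 := Metric.mem_ball_self (x := (0 : ℂ)) C.r_pos
  -- Open mapping theorem; `F` is not locally constant because `ζ` vanishes only at `0`.
  have hopen : 𝓝 (0 : ℂ) ≤ map C.F (𝓝 0) := by
    have h := (C.analyticAt_F 0 h0).eventually_constant_or_nhds_le_map_nhds
    rw [C.F_zero] at h
    refine h.resolve_left fun hc => ?_
    have : ∀ᶠ v in 𝓝[≠] (0 : ℂ), False := by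
      filter_upwards [nhdsWithin_le_nhds hc, nhdsWithin_le_nhds (Metric.isOpen_ball.mem_nhds h0),
        self_mem_nhdsWithin] with v h1 h2 h3
      rw [C.F_eq v h2] at h1
      exact mul_ne_zero C.κ_ne (pow_ne_zero _ (C.ζ_ne_zero h2 h3)) h1
    simpa using this.exists
  have hs : {v : ℂ | R < ‖v‖⁻¹ ∨ v = 0} ∩ Metric.ball 0 C.r ∈ 𝓝 (0 : ℂ) := by
    refine inter_mem ?_ (Metric.isOpen_ball.mem_nhds h0)
    refine Metric.mem_nhds_iff.2 ⟨(|R| + 1)⁻¹, by positivity, fun v hv => ?_⟩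
    rcases eq_or_ne v 0 with rfl | hv0
    · simp
    left
    rw [mem_ball_zero_iff] at hv
    have := lt_inv_of_lt_inv₀ (norm_pos_iff.2 hv0) hv
    have := le_abs_self R
    linarith
  have := hopen (image_mem_map hs)
  filter_upwards [nhdsWithin_le_nhds this, self_mem_nhdsWithin] with t ht ht0
  obtain ⟨v, ⟨hv1, hv2⟩, rfl⟩ := ht
  have hv0 : v ≠ 0 := fun h => ht0 (by rw [h, C.F_zero]; rfl)
  refine ⟨v⁻¹, by simpa [norm_inv, hv0] using hv1, ?_, by simp [f]⟩
  rw [norm_inv]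
  rw [mem_ball_zero_iff] at hv2
  exact (inv_lt_inv₀ C.r_pos (norm_pos_iff.2 hv0)).2 hv2

end InfinityChart

/-! ### Uniqueness of primitives and neighbourhoods of infinity on the sphere -/

section General

lemma sub_eq_sub_of_hasDerivAt {𝕜 : Type*} [RCLike 𝕜] {S : Set 𝕜} (hS : IsOpen S)
    (hc : IsPreconnected S) {f g f' : 𝕜 → ℂ} [NormedSpace 𝕜 ℂ]
    (hf : ∀ x ∈ S, HasDerivAt f (f' x) x) (hg : ∀ x ∈ S, HasDerivAt g (f' x) x)
    {x y : 𝕜} (hx : x ∈ S) (hy : y ∈ S) : f x - g x = f y - g y := by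
  have h : ∀ x ∈ S, HasDerivAt (fun x => f x - g x) 0 x := fun x hx =>
    ((hf x hx).fun_sub (hg x hx)).congr_deriv (sub_self _)
  exact hS.is_const_of_deriv_eq_zero hc
    (fun x hx => (h x hx).differentiableAt.differentiableWithinAt) (fun x hx => (h x hx).deriv) hx hy

lemma isPreconnected_norm_gt (R : ℝ) : IsPreconnected {z : ℂ | R < ‖z‖} := by
  rcases lt_or_ge R 0 with hR | hR
  · have : {z : ℂ | R < ‖z‖} = univ := eq_univ_of_forall fun z => hR.trans_le (norm_nonneg z)
    rw [this]; exact isPreconnected_univ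
  have : {z : ℂ | R < ‖z‖} =
      (fun q : ℝ × ℝ => (q.1 : ℂ) * Complex.exp (q.2 * Complex.I)) '' (Ioi R ×ˢ univ) := by
    ext z
    constructor
    · intro hz
      exact ⟨(‖z‖, z.arg), ⟨hz, mem_univ _⟩, Complex.norm_mul_exp_arg_mul_I z⟩
    · rintro ⟨⟨a, b⟩, ⟨ha, -⟩, rfl⟩
      have ha : R < a := ha
      simp only [mem_ofPred_eq, norm_mul, Complex.norm_exp_ofReal_mul_I, mul_one, Complex.norm_real]
      exact ha.trans_le (le_abs_self a)
  rw [this]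
  refine (isPreconnected_Ioi.prod isPreconnected_univ).image _ (Continuous.continuousOn ?_)
  fun_prop

lemma isOpen_norm_gt (R : ℝ) : IsOpen {z : ℂ | R < ‖z‖} := isOpen_lt continuous_const continuous_norm

lemma eventually_norm_gt (R : ℝ) : ∀ᶠ z in Bornology.cobounded ℂ, R < ‖z‖ :=
  tendsto_norm_cobounded_atTop.eventually_gt_atTop R

lemma cobounded_norm_gt_iff {p : ℂ → Prop} :
    (∀ᶠ z in Bornology.cobounded ℂ, p z) ↔ ∃ R : ℝ, 0 < R ∧ ∀ z, R < ‖z‖ → p z := by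
  constructor
  · intro h
    rw [← comap_norm_atTop, eventually_comap] at h
    obtain ⟨R, hR⟩ := eventually_atTop.1 h
    exact ⟨max R 1, by positivity, fun z hz => hR ‖z‖ ((le_max_left _ _).trans hz.le) z rfl⟩
  · rintro ⟨R, -, hR⟩
    exact (eventually_norm_gt R).mono hR

lemma nhds_infty_onePoint :
    𝓝 (OnePoint.infty : OnePoint ℂ) = map (↑) (Bornology.cobounded ℂ) ⊔ pure OnePoint.infty := by
  rw [OnePoint.nhds_infty_eq, Filter.coclosedCompact_eq_cocompact, Metric.cobounded_eq_cocompact]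

lemma comap_coe_nhds_infty_onePoint :
    comap ((↑) : ℂ → OnePoint ℂ) (𝓝 OnePoint.infty) = Bornology.cobounded ℂ := by
  rw [OnePoint.comap_coe_nhds_infty, Filter.coclosedCompact_eq_cocompact,
    Metric.cobounded_eq_cocompact]

lemma tendsto_coe_infty_iff {α : Type*} {l : Filter α} {g : α → ℂ} :
    Tendsto (fun x => (g x : OnePoint ℂ)) l (𝓝 OnePoint.infty) ↔
      Tendsto g l (Bornology.cobounded ℂ) := by
  rw [← comap_coe_nhds_infty_onePoint, tendsto_comap_iff]; rfl

lemma tendsto_coe_coe_iff {α : Type*} {l : Filter α} {g : α → ℂ} {z : ℂ} :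
    Tendsto (fun x => (g x : OnePoint ℂ)) l (𝓝 (z : OnePoint ℂ)) ↔ Tendsto g l (𝓝 z) :=
  OnePoint.isOpenEmbedding_coe.tendsto_nhds_iff.symm

/-- The exterior of the closed disc of radius `R`, as a neighbourhood of `∞`. -/
def exterior (R : ℝ) : Set (OnePoint ℂ) := ((↑) '' Metric.closedBall (0 : ℂ) R)ᶜ

lemma isOpen_exterior (R : ℝ) : IsOpen (exterior R) :=
  OnePoint.isOpen_compl_image_coe.2 ⟨Metric.isClosed_closedBall, isCompact_closedBall _ _⟩

lemma infty_mem_exterior (R : ℝ) : OnePoint.infty ∈ exterior R := OnePoint.infty_notMem_image_coe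

lemma coe_mem_exterior {R : ℝ} {z : ℂ} : (z : OnePoint ℂ) ∈ exterior R ↔ R < ‖z‖ := by
  simp [exterior]

end General

/-! ### Local branches of time and the topology of the surface -/

section Primitives
variable {k : ℕ} {P : Polynomial ℂ}

lemma isLocalPrimitive_coe {V : Set ℂ} (hV : IsOpen V) {g : ℂ → ℂ} {c : ℂ}
    (h0 : ∀ z ∈ V, P.eval z ≠ 0) (hg : ∀ z ∈ V, HasDerivAt g (1 / P.eval z) z) :
    IsLocalPrimitive P ((↑) '' V) (fun y => y.elim c g) := by
  refine ⟨OnePoint.isOpen_image_coe.2 hV, ?_, fun z hz => ?_⟩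
  · rintro _ ⟨z, hz, rfl⟩
    refine (OnePoint.continuousAt_coe.2 ?_).continuousWithinAt
    exact (hg z hz).continuousAt
  · obtain ⟨z', hz', h⟩ := hz
    rw [OnePoint.coe_eq_coe] at h
    subst h
    exact ⟨h0 _ hz', hg _ hz'⟩

lemma InfinityChart.isLocalPrimitive (C : InfinityChart k P) {R : ℝ} (hR : C.r⁻¹ ≤ R) (c : ℂ) :
    IsLocalPrimitive P (exterior R) (fun y => y.elim c (fun z => C.f z + c)) := by
  have hlim : Tendsto (fun z => C.f z + c) (Bornology.cobounded ℂ) (𝓝 c) := by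
    simpa using C.tendsto_f.add_const c
  have hder : ∀ z : ℂ, (z : OnePoint ℂ) ∈ exterior R →
      HasDerivAt (fun z => C.f z + c) (1 / P.eval z) z := fun z hz =>
    (C.hasDerivAt_f (hR.trans_lt (coe_mem_exterior.1 hz))).add_const c
  refine ⟨isOpen_exterior R, ?_, fun z hz =>
    ⟨C.eval_ne' (hR.trans_lt (coe_mem_exterior.1 hz)), hder z hz⟩⟩
  intro y hy
  refine ContinuousAt.continuousWithinAt ?_
  induction y using OnePoint.rec with
  | infty =>
    rw [ContinuousAt, nhds_infty_onePoint, tendsto_sup, tendsto_map'_iff]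
    exact ⟨hlim, tendsto_pure_nhds _ _⟩
  | coe z => exact OnePoint.continuousAt_coe.2 (hder z hy).continuousAt

lemma IsLocalPrimitive.mono {V W : Set (OnePoint ℂ)} {f : OnePoint ℂ → ℂ}
    (h : IsLocalPrimitive P V f) (hW : IsOpen W) (hWV : W ⊆ V) : IsLocalPrimitive P W f :=
  ⟨hW, h.2.1.mono hWV, fun z hz => h.2.2 z (hWV hz)⟩

lemma IsLocalPrimitive.tendsto_infty {V : Set (OnePoint ℂ)} {f : OnePoint ℂ → ℂ}
    (h : IsLocalPrimitive P V f) (hV : OnePoint.infty ∈ V) :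
    Tendsto (fun z : ℂ => f z) (Bornology.cobounded ℂ) (𝓝 (f OnePoint.infty)) := by
  have h1 := (h.2.1.continuousAt (h.1.mem_nhds hV)).tendsto
  rw [nhds_infty_onePoint, tendsto_sup, tendsto_map'_iff] at h1
  exact h1.1

lemma IsLocalPrimitive.eventually_mem {V : Set (OnePoint ℂ)} {f : OnePoint ℂ → ℂ}
    (h : IsLocalPrimitive P V f) (hV : OnePoint.infty ∈ V) :
    ∀ᶠ z : ℂ in Bornology.cobounded ℂ, (z : OnePoint ℂ) ∈ V := by
  have := h.1.mem_nhds hV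
  rw [nhds_infty_onePoint] at this
  exact this.1

/-- Two primitives differ by a locally constant function. At `∞` the difference is constant on a
connected exterior `|z| > R`, and continuity at `∞` makes it zero. Thus two sheets through one point
agree near it. -/
lemma IsLocalPrimitive.eventuallyEq {V W : Set (OnePoint ℂ)} {f g : OnePoint ℂ → ℂ}
    (hf : IsLocalPrimitive P V f) (hg : IsLocalPrimitive P W g) {y : OnePoint ℂ} (hV : y ∈ V)
    (hW : y ∈ W) (hfg : f y = g y) : ∀ᶠ x in 𝓝 y, f x = g x := by
  induction y using OnePoint.rec with
  | infty =>
    obtain ⟨R, hR, hRm⟩ := cobounded_norm_gt_iff.1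
      ((hf.eventually_mem hV).and (hg.eventually_mem hW))
    have hconst : ∀ z : ℂ, R < ‖z‖ → f z = g z := fun z hz => by
      have h1 : Tendsto (fun z : ℂ => f z - g z) (Bornology.cobounded ℂ) (𝓝 0) := by
        have := (hf.tendsto_infty hV).sub (hg.tendsto_infty hW)
        rwa [hfg, sub_self] at this
      have h2 : Tendsto (fun z : ℂ => f z - g z) (Bornology.cobounded ℂ) (𝓝 (f z - g z)) := by
        refine tendsto_const_nhds.congr' ?_
        filter_upwards [eventually_norm_gt R] with w hw
        exact sub_eq_sub_of_hasDerivAt (f := fun z : ℂ => f z) (g := fun z : ℂ => g z)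
          (isOpen_norm_gt R) (isPreconnected_norm_gt R)
          (fun x hx => (hf.2.2 x (hRm x hx).1).2) (fun x hx => (hg.2.2 x (hRm x hx).2).2) hz hw
      exact sub_eq_zero.1 (tendsto_nhds_unique h2 h1)
    rw [nhds_infty_onePoint, eventually_sup, eventually_map, eventually_pure]
    exact ⟨(eventually_norm_gt R).mono hconst, hfg⟩
  | coe z =>
    have hopen : IsOpen ((↑) ⁻¹' (V ∩ W) : Set ℂ) :=
      (hf.1.inter hg.1).preimage OnePoint.continuous_coe
    obtain ⟨r, hr, hball⟩ := Metric.isOpen_iff.1 hopen z ⟨hV, hW⟩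
    rw [OnePoint.nhds_coe_eq, eventually_map]
    filter_upwards [Metric.ball_mem_nhds z hr] with w hw
    have := sub_eq_sub_of_hasDerivAt (f := fun z : ℂ => f z) (g := fun z : ℂ => g z)
      Metric.isOpen_ball (convex_ball z r).isPreconnected
      (fun x hx => (hf.2.2 x (hball hx).1).2) (fun x hx => (hg.2.2 x (hball hx).2).2)
      hw (Metric.mem_ball_self hr)
    rw [hfg, sub_self] at this
    exact sub_eq_zero.1 this

lemma exists_primitive_ball {z : ℂ} (hz : P.eval z ≠ 0) (τ : ℂ) :
    ∃ (g : ℂ → ℂ) (r : ℝ), 0 < r ∧ g z = τ ∧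
      ∀ w ∈ Metric.ball z r, P.eval w ≠ 0 ∧ HasDerivAt g (1 / P.eval w) w := by
  obtain ⟨r, hr, h0⟩ := Metric.eventually_nhds_iff_ball.1 (P.continuous.continuousAt.eventually_ne hz)
  have hd : DifferentiableOn ℂ (fun w => 1 / P.eval w) (Metric.ball z r) := fun w hw =>
    (((differentiableAt_const _).div P.differentiable.differentiableAt
      (h0 w hw))).differentiableWithinAt
  obtain ⟨g, hg, hg'⟩ := hd.isExactOn_ball.with_val_at z τ
  exact ⟨g, r, hr, hg, fun w hw => ⟨h0 w hw, hg' w hw⟩⟩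

lemma exists_isLocalPrimitive (C : InfinityChart k P) {y : OnePoint ℂ}
    (hy : ∀ a : ℂ, P.IsRoot a → y ≠ (a : OnePoint ℂ)) (τ : ℂ) :
    ∃ (V : Set (OnePoint ℂ)) (f : OnePoint ℂ → ℂ), IsLocalPrimitive P V f ∧ y ∈ V ∧ f y = τ := by
  induction y using OnePoint.rec with
  | infty => exact ⟨_, _, C.isLocalPrimitive le_rfl τ, infty_mem_exterior _, rfl⟩
  | coe z =>
    obtain ⟨g, r, hr, hg, h⟩ := exists_primitive_ball (P := P) (z := z) (fun h => hy z h rfl) τ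
    exact ⟨_, _, isLocalPrimitive_coe (c := 0) Metric.isOpen_ball (fun w hw => (h w hw).1)
      (fun w hw => (h w hw).2), mem_image_of_mem _ (Metric.mem_ball_self hr), hg⟩

/-- The sheet of the Riemann surface over `V` given by the local branch `f`. -/
def sheet (P : Polynomial ℂ) (V : Set (OnePoint ℂ)) (f : OnePoint ℂ → ℂ) : Set (TimeSurface P) :=
  {p | p.pt ∈ V ∧ p.time = f p.pt}

lemma IsLocalPrimitive.isOpen_sheet {V : Set (OnePoint ℂ)} {f : OnePoint ℂ → ℂ}
    (h : IsLocalPrimitive P V f) : IsOpen (sheet P V f) :=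
  TopologicalSpace.isOpen_generateFrom_of_mem ⟨V, f, h, rfl⟩

lemma TimeSurface.ext' {p q : TimeSurface P} (h1 : p.pt = q.pt) (h2 : p.time = q.time) : p = q := by
  cases p; cases q; simp_all

lemma TimeSurface.exists_isLocalPrimitive (C : InfinityChart k P) (p : TimeSurface P) :
    ∃ (V : Set (OnePoint ℂ)) (f : OnePoint ℂ → ℂ), IsLocalPrimitive P V f ∧ p ∈ sheet P V f := by
  obtain ⟨V, f, hf, h1, h2⟩ := _root_.exists_isLocalPrimitive C p.isTimeValue.1 p.time
  exact ⟨V, f, hf, h1, h2.symm⟩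

/-- All sheets through `p` coincide near `p`, so convergence can be tested on a single one: the
projections converge and the points eventually lie on the sheet. -/
lemma tendsto_timeSurface {α : Type*} {l : Filter α} {G : α → TimeSurface P} {p : TimeSurface P}
    {V : Set (OnePoint ℂ)} {f : OnePoint ℂ → ℂ} (hf : IsLocalPrimitive P V f)
    (hp : p ∈ sheet P V f) (h1 : Tendsto (fun x => (G x).pt) l (𝓝 p.pt))
    (h2 : ∀ᶠ x in l, (G x).time = f (G x).pt) : Tendsto G l (𝓝 p) := by
  refine TopologicalSpace.tendsto_nhds_generateFrom_iff.2 ?_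
  rintro _ ⟨W, g, hg, rfl⟩ ⟨hpW, hpg⟩
  filter_upwards [h1.eventually (hg.1.mem_nhds hpW), h2,
    h1.eventually (hf.eventuallyEq hg hp.1 hpW (hp.2.symm.trans hpg))] with x hx1 hx2 hx3
  exact ⟨hx1, hx2.trans hx3⟩

lemma TimeSurface.continuous_pt (C : InfinityChart k P) :
    Continuous (TimeSurface.pt : TimeSurface P → OnePoint ℂ) := by
  refine continuous_iff_continuousAt.2 fun p => ?_
  obtain ⟨V, f, hf, hp⟩ := p.exists_isLocalPrimitive C
  intro W hW
  obtain ⟨W', hW'W, hW', hpW'⟩ := mem_nhds_iff.1 hW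
  have := (hf.mono (hf.1.inter hW') inter_subset_left).isOpen_sheet.mem_nhds
    (x := p) ⟨⟨hp.1, hpW'⟩, hp.2⟩
  exact mem_map.2 (mem_of_superset this fun q hq => hW'W hq.1.2)

lemma IsLocalPrimitive.sheet_mem_nhds {V : Set (OnePoint ℂ)} {f : OnePoint ℂ → ℂ}
    (h : IsLocalPrimitive P V f) {p : TimeSurface P} (hp : p ∈ sheet P V f) :
    sheet P V f ∈ 𝓝 p := h.isOpen_sheet.mem_nhds hp

lemma TimeSurface.continuous_time (C : InfinityChart k P) :
    Continuous (TimeSurface.time : TimeSurface P → ℂ) := by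
  refine continuous_iff_continuousAt.2 fun p => ?_
  obtain ⟨V, f, hf, hp⟩ := p.exists_isLocalPrimitive C
  have h1 : ContinuousAt (fun q : TimeSurface P => f q.pt) p :=
    ContinuousAt.comp (f := TimeSurface.pt) (hf.2.1.continuousAt (hf.1.mem_nhds hp.1))
      (TimeSurface.continuous_pt C).continuousAt
  refine h1.congr ?_
  filter_upwards [hf.sheet_mem_nhds hp] with q hq using hq.2.symm

lemma TimeSurface.t2Space (C : InfinityChart k P) : T2Space (TimeSurface P) := by
  refine T2Space.of_injective_continuous (f := fun p : TimeSurface P => (p.pt, p.time)) ?_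
    ((continuous_pt C).prodMk (continuous_time C))
  intro p q h
  exact TimeSurface.ext' (congrArg Prod.fst h) (congrArg Prod.snd h)

end Primitives

/-! ### Time values and paths from infinity -/

section Reach
variable {k : ℕ} {P : Polynomial ℂ}

/-- `τ` is the integral of `dz / P(z)` along a `C¹` path from `∞` that stops at the finite
point `z`. -/
def Reach (P : Polynomial ℂ) (z τ : ℂ) : Prop :=
  ∃ (γ γ' T : ℝ → ℂ) (L : ℝ), 0 < L ∧ (∀ s > 0, HasDerivAt γ (γ' s) s) ∧
    ContinuousOn γ' (Ioi 0) ∧ (∀ s > 0, P.eval (γ s) ≠ 0) ∧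
    (∀ s > 0, HasDerivAt T (γ' s / P.eval (γ s)) s) ∧
    Tendsto γ (𝓝[>] 0) (Bornology.cobounded ℂ) ∧ Tendsto T (𝓝[>] 0) (𝓝 0) ∧
    ∀ s ≥ L, γ s = z ∧ T s = τ

lemma Reach.eval_ne {z τ : ℂ} (h : Reach P z τ) : P.eval z ≠ 0 := by
  obtain ⟨γ, γ', T, L, hL, -, -, h0, -, -, -, hend⟩ := h
  exact (hend L le_rfl).1 ▸ h0 L hL

/-- A primitive `T` along the path turns the improper integral into a difference of end limits. The
path is rescaled from `(0, L)` to `(0, 1)`. -/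
lemma isTimeValue_of_primitive {γ γ' T : ℝ → ℂ} {L : ℝ} (hL : 0 < L)
    (h1 : ∀ s ∈ Ioo 0 L, HasDerivAt γ (γ' s) s) (h2 : ContinuousOn γ' (Ioo 0 L))
    (h3 : ∀ s ∈ Ioo 0 L, P.eval (γ s) ≠ 0)
    (h4 : ∀ s ∈ Ioo 0 L, HasDerivAt T (γ' s / P.eval (γ s)) s)
    (h5 : Tendsto γ (𝓝[>] 0) (Bornology.cobounded ℂ)) (h6 : Tendsto T (𝓝[>] 0) (𝓝 0))
    {w : OnePoint ℂ} {τ : ℂ} (hw : ∀ a : ℂ, P.IsRoot a → w ≠ (a : OnePoint ℂ))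
    (h7 : Tendsto (fun s => (γ s : OnePoint ℂ)) (𝓝[<] L) (𝓝 w)) (h8 : Tendsto T (𝓝[<] L) (𝓝 τ)) :
    IsTimeValue P w τ := by
  have hmem : ∀ s ∈ Ioo (0 : ℝ) 1, L * s ∈ Ioo 0 L := fun s hs =>
    ⟨mul_pos hL hs.1, by nlinarith [hs.2]⟩
  have hd : ∀ s ∈ Ioo (0 : ℝ) 1, HasDerivAt (fun s => γ (L * s)) (L * γ' (L * s)) s := fun s hs => by
    have := (h1 _ (hmem s hs)).scomp s ((hasDerivAt_id s).const_mul L)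
    exact this.congr_deriv (by simp)
  have hT : ∀ s ∈ Ioo (0 : ℝ) 1, HasDerivAt (fun s => T (L * s))
      (deriv (fun s => γ (L * s)) s / P.eval (γ (L * s))) s := fun s hs => by
    have := (h4 _ (hmem s hs)).scomp s ((hasDerivAt_id s).const_mul L)
    exact this.congr_deriv (by rw [(hd s hs).deriv]; simp [mul_div_assoc])
  have hL0 : Tendsto (fun s : ℝ => L * s) (𝓝[>] 0) (𝓝[>] 0) := by
    refine tendsto_nhdsWithin_iff.2 ⟨?_, ?_⟩
    · have : ContinuousAt (fun s : ℝ => L * s) 0 := by fun_prop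
      have := this.tendsto
      rw [mul_zero] at this
      exact this.mono_left nhdsWithin_le_nhds
    · filter_upwards [self_mem_nhdsWithin] with s hs using mul_pos hL hs
  have hL1 : Tendsto (fun s : ℝ => L * s) (𝓝[<] 1) (𝓝[<] L) := by
    refine tendsto_nhdsWithin_iff.2 ⟨?_, ?_⟩
    · have : ContinuousAt (fun s : ℝ => L * s) 1 := by fun_prop
      have := this.tendsto
      rw [mul_one] at this
      exact this.mono_left nhdsWithin_le_nhds
    · filter_upwards [self_mem_nhdsWithin] with s hs
      have : s < 1 := hs
      show L * s < L
      nlinarith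
  have hcd : ContinuousOn (deriv fun s => γ (L * s)) (Ioo 0 1) := by
    have : ContinuousOn (fun s => (L : ℂ) * γ' (L * s)) (Ioo 0 1) :=
      continuousOn_const.mul (h2.comp (by fun_prop) hmem)
    exact this.congr fun s hs => (hd s hs).deriv
  refine ⟨hw, fun s => γ (L * s), ?_, fun s hs => h3 _ (hmem s hs), ?_, h7.comp hL1, ?_⟩
  · rw [show (1 : WithTop ℕ∞) = 0 + 1 by simp, contDiffOn_succ_iff_deriv_of_isOpen isOpen_Ioo]
    refine ⟨fun s hs => (hd s hs).differentiableAt.differentiableWithinAt, by simp, ?_⟩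
    exact contDiffOn_zero.2 hcd
  · exact tendsto_coe_infty_iff.2 (h5.comp hL0)
  · have hlim : Tendsto (fun q : ℝ × ℝ => T (L * q.2) - T (L * q.1)) (𝓝[>] 0 ×ˢ 𝓝[<] 1) (𝓝 τ) := by
      have h9 : Tendsto (fun q : ℝ × ℝ => T (L * q.2)) (𝓝[>] 0 ×ˢ 𝓝[<] 1) (𝓝 τ) :=
        (h8.comp hL1).comp tendsto_snd
      have h10 : Tendsto (fun q : ℝ × ℝ => T (L * q.1)) (𝓝[>] 0 ×ˢ 𝓝[<] 1) (𝓝 0) :=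
        (h6.comp hL0).comp tendsto_fst
      simpa using h9.sub h10
    refine hlim.congr' ?_
    have e1 : ∀ᶠ s : ℝ in 𝓝[>] 0, s ∈ Ioo (0 : ℝ) 1 := Ioo_mem_nhdsGT one_pos
    have e2 : ∀ᶠ s : ℝ in 𝓝[<] 1, s ∈ Ioo (0 : ℝ) 1 := Ioo_mem_nhdsLT one_pos
    filter_upwards [e1.prod_mk e2] with q hq
    have hsub : uIcc q.1 q.2 ⊆ Ioo (0 : ℝ) 1 := ordConnected_Ioo.uIcc_subset hq.1 hq.2
    refine (intervalIntegral.integral_eq_sub_of_hasDerivAt (fun s hs => hT s (hsub hs)) ?_).symm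
    refine ContinuousOn.intervalIntegrable (ContinuousOn.div (hcd.mono hsub) ?_ ?_)
    · exact P.continuous.comp_continuousOn
        (fun s hs => (hd s (hsub hs)).continuousAt.continuousWithinAt)
    · exact fun s hs => h3 _ (hmem s (hsub hs))

lemma Reach.isTimeValue {z τ : ℂ} (h : Reach P z τ) : IsTimeValue P z τ := by
  have h0 := h.eval_ne
  obtain ⟨γ, γ', T, L, hL, h1, h2, h3, h4, h5, h6, hend⟩ := h
  refine isTimeValue_of_primitive hL (fun s hs => h1 s hs.1) (h2.mono fun s hs => hs.1)
    (fun s hs => h3 s hs.1) (fun s hs => h4 s hs.1) h5 h6 (fun a ha hza => ?_) ?_ ?_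
  · rw [OnePoint.coe_eq_coe] at hza
    exact h0 (hza ▸ ha)
  · refine tendsto_coe_coe_iff.2 ?_
    have := (h1 L hL).continuousAt.tendsto
    rw [(hend L le_rfl).1] at this
    exact this.mono_left nhdsWithin_le_nhds
  · have := (h4 L hL).continuousAt.tendsto
    rw [(hend L le_rfl).2] at this
    exact this.mono_left nhdsWithin_le_nhds

/-- A smooth step that is `0` for `s ≤ L` and `1` for `L + 1 ≤ s`. -/
noncomputable def smoothStep (L s : ℝ) : ℂ := (Real.smoothTransition (s - L) : ℝ)

lemma hasDerivAt_smoothStep (L s : ℝ) :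
    HasDerivAt (smoothStep L) (deriv (smoothStep L) s) s := by
  have h : Differentiable ℝ Real.smoothTransition :=
    (Real.smoothTransition.contDiff (n := 1)).differentiable (by simp)
  have h1 := (h (s - L)).hasDerivAt.comp_sub_const s L
  exact h1.ofReal_comp.differentiableAt.hasDerivAt

lemma continuous_deriv_smoothStep (L : ℝ) : Continuous (deriv (smoothStep L)) := by
  have : ContDiff ℝ 1 (smoothStep L) := by
    refine Complex.ofRealCLM.contDiff.comp ?_
    exact (Real.smoothTransition.contDiff (n := 1)).comp (contDiff_id.sub contDiff_const)
  exact this.continuous_deriv le_rfl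

lemma smoothStep_of_le {L s : ℝ} (h : s ≤ L) : smoothStep L s = 0 := by
  simp [smoothStep, Real.smoothTransition.zero_of_nonpos (sub_nonpos.2 h)]

lemma smoothStep_of_ge {L s : ℝ} (h : L + 1 ≤ s) : smoothStep L s = 1 := by
  simp [smoothStep, Real.smoothTransition.one_of_one_le (show 1 ≤ s - L by linarith)]

/-- Where the nonnegative step vanishes it has a minimum; this covers the corner `s = L` as well. -/
lemma deriv_smoothStep_of_le {L s : ℝ} (h : s ≤ L) : deriv (smoothStep L) s = 0 := by
  have h1 : IsLocalMin (fun s => Real.smoothTransition (s - L)) s := by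
    refine Eventually.of_forall fun t => ?_
    show Real.smoothTransition (s - L) ≤ Real.smoothTransition (t - L)
    rw [Real.smoothTransition.zero_of_nonpos (sub_nonpos.2 h)]
    exact Real.smoothTransition.nonneg _
  have hd : Differentiable ℝ Real.smoothTransition :=
    (Real.smoothTransition.contDiff (n := 1)).differentiable (by simp)
  have h2 : HasDerivAt (fun s => Real.smoothTransition (s - L)) 0 s := by
    have := ((hd (s - L)).hasDerivAt.comp s ((hasDerivAt_id s).sub_const L))
    have h3 := this.differentiableAt.hasDerivAt
    exact h3.congr_deriv h1.deriv_eq_zero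
  exact h2.ofReal_comp.deriv

/-- The path rests at `z` from `s = L` on, so the smooth motion towards `z'` can simply be added to
it: before `L` the new term vanishes, afterwards the old path is constant, and both velocities
vanish at `L`, which keeps the concatenation `C¹`. -/
lemma Reach.segment {z τ : ℂ} (h : Reach P z τ) {S : Set ℂ} (hS : Convex ℝ S) {g : ℂ → ℂ}
    (h0 : ∀ w ∈ S, P.eval w ≠ 0) (hg : ∀ w ∈ S, HasDerivAt g (1 / P.eval w) w)
    (hz : z ∈ S) {z' : ℂ} (hz' : z' ∈ S) : Reach P z' (τ + (g z' - g z)) := by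
  obtain ⟨γ, γ', T, L, hL, h1, h2, h3, h4, h5, h6, hend⟩ := h
  have hmem : ∀ s, z + smoothStep L s * (z' - z) ∈ S := fun s => by
    have := hS.add_smul_sub_mem hz hz'
      ⟨Real.smoothTransition.nonneg (s - L), Real.smoothTransition.le_one _⟩
    simpa [smoothStep] using this
  -- At `s = L` the path is known to be constant only to the right, whence the one-sided derivative.
  have hγ' : ∀ s ≥ L, γ' s = 0 := fun s hs => by
    have hd := h1 s (hL.trans_le hs)
    have h2 : HasDerivWithinAt γ 0 (Ici s) s :=
      (hasDerivWithinAt_const s (Ici s) z).congr (fun t ht => (hend t (hs.trans ht)).1)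
        (hend s hs).1
    exact (uniqueDiffWithinAt_Ici s).eq_deriv _ hd.hasDerivWithinAt h2
  have hder : ∀ s > 0, HasDerivAt (fun s => γ s + smoothStep L s * (z' - z))
      (γ' s + deriv (smoothStep L) s * (z' - z)) s := fun s hs =>
    (h1 s hs).add ((hasDerivAt_smoothStep L s).mul_const _)
  have hval : ∀ s ≥ L, γ s + smoothStep L s * (z' - z) = z + smoothStep L s * (z' - z) :=
    fun s hs => by rw [(hend s hs).1]
  refine ⟨fun s => γ s + smoothStep L s * (z' - z),
    fun s => γ' s + deriv (smoothStep L) s * (z' - z),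
    fun s => T s + (g (z + smoothStep L s * (z' - z)) - g z), L + 1, by linarith, hder, ?_, ?_, ?_,
    ?_, ?_, ?_⟩
  · exact h2.add ((continuous_deriv_smoothStep L).mul continuous_const).continuousOn
  · intro s hs
    rcases le_total s L with hsL | hsL
    · simpa [smoothStep_of_le hsL] using h3 s hs
    · simpa only [hval s hsL] using h0 _ (hmem s)
  · intro s hs
    have hz1 : HasDerivAt (fun s => z + smoothStep L s * (z' - z))
        (deriv (smoothStep L) s * (z' - z)) s :=
      ((hasDerivAt_smoothStep L s).mul_const _).const_add z
    have hg1 := (hg _ (hmem s)).comp_of_eq s hz1 rfl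
    refine ((h4 s hs).add (hg1.sub_const (g z))).congr_deriv ?_
    rcases le_total s L with hsL | hsL
    · simp [deriv_smoothStep_of_le hsL, smoothStep_of_le hsL]
    · simp only [hval s hsL, hγ' s hsL]; ring
  · refine h5.congr' ?_
    filter_upwards [Ioo_mem_nhdsGT hL] with s hs
    simp [smoothStep_of_le hs.2.le]
  · refine h6.congr' ?_
    filter_upwards [Ioo_mem_nhdsGT hL] with s hs
    simp [smoothStep_of_le hs.2.le]
  · intro s hs
    have : L ≤ s := by linarith
    simp [smoothStep_of_ge hs, (hend s this).1, (hend s this).2]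

lemma norm_one_sub_smoothStep {L s : ℝ} (hs : s < L + 1) :
    0 < ‖1 - smoothStep L s‖ ∧ ‖1 - smoothStep L s‖ ≤ 1 := by
  have h1 : Real.smoothTransition (s - L) < 1 :=
    Real.smoothTransition.lt_one_of_lt_one (by linarith)
  have h2 := Real.smoothTransition.nonneg (s - L)
  rw [smoothStep, ← Complex.ofReal_one, ← Complex.ofReal_sub, Complex.norm_real, Real.norm_eq_abs,
    abs_of_pos (by linarith)]
  constructor <;> linarith

lemma tendsto_smoothStep (L s : ℝ) : Tendsto (smoothStep L) (𝓝 s) (𝓝 (smoothStep L s)) :=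
  (hasDerivAt_smoothStep L s).continuousAt.tendsto

/-- The path is continued from `z` radially outwards as `z / (1 - smoothStep L s)`. The norm never
drops below that of `z`, so the chart at `∞` computes the remaining time as `-C.f z`. -/
lemma Reach.isTimeValue_infty (C : InfinityChart k P) {z τ : ℂ} (h : Reach P z τ)
    (hz : C.r⁻¹ < ‖z‖) : IsTimeValue P OnePoint.infty (τ - C.f z) := by
  obtain ⟨γ, γ', T, L, hL, h1, h2, h3, h4, h5, h6, hend⟩ := h
  have hz0 := C.ne_zero hz
  have hne : ∀ s < L + 1, 1 - smoothStep L s ≠ 0 := fun s hs =>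
    norm_pos_iff.1 (norm_one_sub_smoothStep hs).1
  have hmem : ∀ s < L + 1, C.r⁻¹ < ‖z / (1 - smoothStep L s)‖ := fun s hs => by
    obtain ⟨ha, hb⟩ := norm_one_sub_smoothStep hs
    rw [norm_div]
    exact hz.trans_le (le_div_self (norm_nonneg z) ha hb)
  have hγ' : ∀ s ≥ L, γ' s = 0 := fun s hs => by
    have hd := h1 s (hL.trans_le hs)
    have h2 : HasDerivWithinAt γ 0 (Ici s) s :=
      (hasDerivWithinAt_const s (Ici s) z).congr (fun t ht => (hend t (hs.trans ht)).1)
        (hend s hs).1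
    exact (uniqueDiffWithinAt_Ici s).eq_deriv _ hd.hasDerivWithinAt h2
  have hstep : ∀ s, HasDerivAt (fun s => 1 - smoothStep L s) (-deriv (smoothStep L) s) s :=
    fun s => ((hasDerivAt_smoothStep L s).const_sub 1)
  have hlim1 : Tendsto (fun s => 1 - smoothStep L s) (𝓝[<] (L + 1)) (𝓝[≠] 0) := by
    refine tendsto_nhdsWithin_iff.2 ⟨?_, ?_⟩
    · have := (hstep (L + 1)).continuousAt.tendsto
      simp only [smoothStep_of_ge le_rfl, sub_self] at this
      exact this.mono_left nhdsWithin_le_nhds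
    · filter_upwards [self_mem_nhdsWithin] with s hs using hne s hs
  have hlim : Tendsto (fun s => z / (1 - smoothStep L s)) (𝓝[<] (L + 1))
      (Bornology.cobounded ℂ) := by
    have h := (tendsto_inv₀_nhdsNE_zero (α := ℂ)).comp hlim1
    rw [← tendsto_norm_atTop_iff_cobounded] at h ⊢
    have := h.const_mul_atTop (norm_pos_iff.2 hz0)
    refine this.congr fun s => ?_
    simp [div_eq_mul_inv]
  have heqL : ∀ s ∈ Ioo L (L + 1), z / (1 - smoothStep L s) = γ s / (1 - smoothStep L s) :=
    fun s hs => by rw [(hend s hs.1.le).1]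
  have hIoo : Ioo L (L + 1) ∈ 𝓝[<] (L + 1) := Ioo_mem_nhdsLT (by linarith)
  refine isTimeValue_of_primitive (L := L + 1) (γ := fun s => γ s / (1 - smoothStep L s))
    (γ' := fun s => (γ' s * (1 - smoothStep L s) - γ s * (-deriv (smoothStep L) s)) /
      (1 - smoothStep L s) ^ 2)
    (T := fun s => T s + (C.f (z / (1 - smoothStep L s)) - C.f z)) (by linarith)
    (fun s hs => (h1 s hs.1).div (hstep s) (hne s hs.2)) ?_ ?_ ?_ ?_ ?_ ?_ ?_ ?_
  · have hc : ContinuousOn (fun s => 1 - smoothStep L s) (Ioo 0 (L + 1)) :=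
      fun s _ => (hstep s).continuousAt.continuousWithinAt
    have hcγ : ContinuousOn γ (Ioo 0 (L + 1)) :=
      fun s hs => (h1 s hs.1).continuousAt.continuousWithinAt
    exact (((h2.mono fun s hs => hs.1).mul hc).sub
      (hcγ.mul (continuous_deriv_smoothStep L).neg.continuousOn)).div (hc.pow 2)
      fun s hs => pow_ne_zero _ (hne s hs.2)
  · intro s hs
    rcases le_total s L with hsL | hsL
    · simpa [smoothStep_of_le hsL] using h3 s hs.1
    · simp only [(hend s hsL).1]
      exact C.eval_ne' (hmem s hs.2)
  · intro s hs
    have hq := (hasDerivAt_const s z).div (hstep s) (hne s hs.2)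
    have hf := (C.hasDerivAt_f (hmem s hs.2)).comp_of_eq s hq rfl
    refine ((h4 s hs.1).add (hf.sub_const (C.f z))).congr_deriv ?_
    rcases le_total s L with hsL | hsL
    · simp [deriv_smoothStep_of_le hsL, smoothStep_of_le hsL]
    · simp only [(hend s hsL).1, hγ' s hsL]
      ring
  · refine h5.congr' ?_
    filter_upwards [Ioo_mem_nhdsGT hL] with s hs
    simp [smoothStep_of_le hs.2.le]
  · refine h6.congr' ?_
    filter_upwards [Ioo_mem_nhdsGT hL] with s hs
    simp [smoothStep_of_le hs.2.le]
  · exact fun a _ => OnePoint.infty_ne_coe a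
  · refine tendsto_coe_infty_iff.2 (hlim.congr' ?_)
    filter_upwards [hIoo] with s hs using heqL s hs
  · have : Tendsto (fun s => τ + (C.f (z / (1 - smoothStep L s)) - C.f z)) (𝓝[<] (L + 1))
        (𝓝 (τ + (0 - C.f z))) := ((C.tendsto_f.comp hlim).sub_const _).const_add _
    rw [zero_sub, ← sub_eq_add_neg] at this
    refine this.congr' ?_
    filter_upwards [hIoo] with s hs
    rw [(hend s hs.1.le).2]

/-- The path comes in from `∞` along the ray through `z`, as `z / smoothStep 0 s`, where `C.f` is
the primitive vanishing at `∞`. -/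
lemma InfinityChart.reach (C : InfinityChart k P) {z : ℂ} (hz : C.r⁻¹ < ‖z‖) :
    Reach P z (C.f z) := by
  have hz0 := C.ne_zero hz
  have hpos : ∀ s > 0, 0 < Real.smoothTransition (s - 0) := fun s hs =>
    Real.smoothTransition.pos_of_pos (by simpa using hs)
  have hne : ∀ s > 0, smoothStep 0 s ≠ 0 := fun s hs => by
    simpa [smoothStep] using (hpos s hs).ne'
  have hnorm : ∀ s > 0, C.r⁻¹ < ‖z / smoothStep 0 s‖ := fun s hs => by
    rw [norm_div]
    refine hz.trans_le (le_div_self (norm_nonneg z) (norm_pos_iff.2 (hne s hs)) ?_)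
    rw [smoothStep, Complex.norm_real, Real.norm_eq_abs, abs_of_pos (hpos s hs)]
    exact Real.smoothTransition.le_one _
  have hder : ∀ s > 0, HasDerivAt (fun s => z / smoothStep 0 s)
      ((0 * smoothStep 0 s - z * deriv (smoothStep 0) s) / smoothStep 0 s ^ 2) s := fun s hs =>
    (hasDerivAt_const s z).div (hasDerivAt_smoothStep 0 s) (hne s hs)
  have hlim : Tendsto (fun s => z / smoothStep 0 s) (𝓝[>] 0) (Bornology.cobounded ℂ) := by
    have h1 : Tendsto (smoothStep 0) (𝓝[>] 0) (𝓝[≠] 0) := by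
      refine tendsto_nhdsWithin_iff.2 ⟨?_, ?_⟩
      · have := tendsto_smoothStep 0 0
        rw [smoothStep_of_le le_rfl] at this
        exact this.mono_left nhdsWithin_le_nhds
      · filter_upwards [self_mem_nhdsWithin] with s hs using hne s hs
    have h := (tendsto_inv₀_nhdsNE_zero (α := ℂ)).comp h1
    rw [← tendsto_norm_atTop_iff_cobounded] at h ⊢
    have := h.const_mul_atTop (norm_pos_iff.2 hz0)
    refine this.congr fun s => ?_
    simp [div_eq_mul_inv]
  refine ⟨fun s => z / smoothStep 0 s, _, fun s => C.f (z / smoothStep 0 s), 1, one_pos, hder, ?_,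
    fun s hs => C.eval_ne' (hnorm s hs), fun s hs => ?_, hlim, C.tendsto_f.comp hlim, fun s hs => ?_⟩
  · have hc : ContinuousOn (smoothStep 0) (Ioi 0) :=
      fun s _ => (hasDerivAt_smoothStep 0 s).continuousAt.continuousWithinAt
    exact ((continuousOn_const.mul hc).sub
      (continuousOn_const.mul (continuous_deriv_smoothStep 0).continuousOn)).div (hc.pow 2)
      fun s hs => pow_ne_zero _ (hne s hs)
  · refine ((C.hasDerivAt_f (hnorm s hs)).comp_of_eq s (hder s hs) rfl).congr_deriv ?_
    ring
  · have : smoothStep 0 s = 1 := smoothStep_of_ge (by simpa using hs)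
    simp [this]

/-- Propagation of time values along a connected open set on which `dz / P(z)` has a primitive. -/
lemma Reach.propagate {V : Set ℂ} (hV : IsOpen V) (hc : IsPreconnected V) {g : ℂ → ℂ}
    (h0 : ∀ w ∈ V, P.eval w ≠ 0) (hg : ∀ w ∈ V, HasDerivAt g (1 / P.eval w) w) {z : ℂ} (hz : z ∈ V)
    (h : Reach P z (g z)) {z' : ℂ} (hz' : z' ∈ V) : Reach P z' (g z') := by
  have key : ∀ x ∈ V, ∃ r > 0, Metric.ball x r ⊆ V ∧ ∀ w ∈ Metric.ball x r, ∀ w' ∈ Metric.ball x r,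
      Reach P w (g w) → Reach P w' (g w') := fun x hx => by
    obtain ⟨r, hr, hball⟩ := Metric.isOpen_iff.1 hV x hx
    refine ⟨r, hr, hball, fun w hw w' hw' hR => ?_⟩
    have := hR.segment (convex_ball x r) (fun y hy => h0 y (hball hy)) (fun y hy => hg y (hball hy))
      hw hw'
    simpa using this
  have hsub : V ⊆ {x | x ∈ V ∧ Reach P x (g x)} := by
    refine hc.subset_of_closure_inter_subset ?_ ⟨z, hz, hz, h⟩ ?_
    · refine Metric.isOpen_iff.2 fun x hx => ?_
      obtain ⟨r, hr, hball, hR⟩ := key x hx.1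
      exact ⟨r, hr, fun w hw => ⟨hball hw, hR x (Metric.mem_ball_self hr) w hw hx.2⟩⟩
    · rintro x ⟨hx, hxV⟩
      obtain ⟨r, hr, hball, hR⟩ := key x hxV
      obtain ⟨w, hw, hxw⟩ := Metric.mem_closure_iff.1 hx r hr
      exact ⟨hxV, hR w (by rwa [Metric.mem_ball, dist_comm]) x (Metric.mem_ball_self hr) hw.2⟩
  exact (hsub hz').2

/-- Every path that defines a time value can be stopped before its end, on a given sheet. -/
lemma IsTimeValue.exists_reach (C : InfinityChart k P) {w : OnePoint ℂ} {τ : ℂ}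
    (h : IsTimeValue P w τ) {V : Set (OnePoint ℂ)} {f : OnePoint ℂ → ℂ}
    (hf : IsLocalPrimitive P V f) (hw : w ∈ V) (hfw : f w = τ) :
    ∃ z : ℂ, (z : OnePoint ℂ) ∈ V ∧ Reach P z (f z) := by
  obtain ⟨-, γ, hγ, h0, hinf, hlim, hint⟩ := h
  rw [tendsto_coe_infty_iff] at hinf
  have hd : ∀ s ∈ Ioo (0 : ℝ) 1, HasDerivAt γ (deriv γ s) s := fun s hs =>
    ((hγ.differentiableOn one_ne_zero s hs).differentiableAt (Ioo_mem_nhds hs.1 hs.2)).hasDerivAt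
  have hdc : ContinuousOn (deriv γ) (Ioo 0 1) := hγ.continuousOn_deriv_of_isOpen isOpen_Ioo le_rfl
  have hPc : ContinuousOn (fun s => P.eval (γ s)) (Ioo 0 1) :=
    P.continuous.comp_continuousOn hγ.continuousOn
  have hq : ContinuousOn (fun s => deriv γ s / P.eval (γ s)) (Ioo 0 1) := hdc.div hPc h0
  have hii : ∀ a ∈ Ioo (0 : ℝ) 1, ∀ b ∈ Ioo (0 : ℝ) 1,
      IntervalIntegrable (fun s => deriv γ s / P.eval (γ s)) MeasureTheory.volume a b :=
    fun a ha b hb => (hq.mono (ordConnected_Ioo.uIcc_subset ha hb)).intervalIntegrable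
  have hhalf : (1 / 2 : ℝ) ∈ Ioo (0 : ℝ) 1 := by norm_num
  obtain ⟨T, hT⟩ : ∃ T : ℝ → ℂ, ∀ s ∈ Ioo (0 : ℝ) 1,
      HasDerivAt T (deriv γ s / P.eval (γ s)) s :=
    ⟨fun s => ∫ x in (1 / 2 : ℝ)..s, deriv γ x / P.eval (γ x), fun s hs =>
      intervalIntegral.integral_hasDerivAt_right (hii _ hhalf s hs)
        (hq.stronglyMeasurableAtFilter isOpen_Ioo s hs)
        (hq.continuousAt (Ioo_mem_nhds hs.1 hs.2))⟩
  -- the primitive near the start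
  have hstart : ∃ δ ∈ Ioo (0 : ℝ) 1, ∀ s ∈ Ioo 0 δ, C.r⁻¹ < ‖γ s‖ := by
    have h1 := hinf.eventually (eventually_norm_gt C.r⁻¹)
    obtain ⟨δ, hδ, h2⟩ := (mem_nhdsGT_iff_exists_Ioo_subset' (one_pos)).1 h1
    refine ⟨min δ (1 / 2), ⟨lt_min hδ (by norm_num), (min_le_right _ _).trans_lt (by norm_num)⟩,
      fun s hs => h2 ⟨hs.1, hs.2.trans_le (min_le_left _ _)⟩⟩
  obtain ⟨δ, hδ, hγδ⟩ := hstart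
  have hδ2 : δ / 2 ∈ Ioo 0 δ := ⟨half_pos hδ.1, half_lt_self hδ.1⟩
  obtain ⟨c, hc⟩ : ∃ c, ∀ s ∈ Ioo 0 δ, T s = C.f (γ s) + c := by
    refine ⟨T (δ / 2) - C.f (γ (δ / 2)), fun s hs => ?_⟩
    have := sub_eq_sub_of_hasDerivAt isOpen_Ioo isPreconnected_Ioo (f := T)
      (g := fun s => C.f (γ s)) (fun s hs => hT s ⟨hs.1, hs.2.trans hδ.2⟩)
      (fun s hs => ((C.hasDerivAt_f (hγδ s hs)).comp_of_eq s (hd s ⟨hs.1, hs.2.trans hδ.2⟩)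
        rfl).congr_deriv (by ring)) hs hδ2
    linear_combination this
  have hT0 : Tendsto (fun s => T s - c) (𝓝[>] 0) (𝓝 0) := by
    refine (C.tendsto_f.comp hinf).congr' ?_
    filter_upwards [Ioo_mem_nhdsGT hδ.1] with s hs
    simp [hc s hs]
  -- the primitive near the end
  obtain ⟨ε, hε, hγε⟩ : ∃ ε ∈ Ioo (0 : ℝ) 1, ∀ s ∈ Ioo ε 1, (γ s : OnePoint ℂ) ∈ V := by
    have h1 := hlim.eventually (hf.1.mem_nhds hw)
    obtain ⟨ε, hε, h2⟩ := (mem_nhdsLT_iff_exists_Ioo_subset' (one_pos)).1 h1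
    exact ⟨max ε (1 / 2), ⟨lt_max_of_lt_right (by norm_num), max_lt hε (by norm_num)⟩,
      fun s hs => h2 ⟨(le_max_left _ _).trans_lt hs.1, hs.2⟩⟩
  obtain ⟨s₀, hs₀⟩ := exists_between hε.2
  have hs₀' : s₀ ∈ Ioo ε 1 := hs₀
  have hs01 : s₀ ∈ Ioo (0 : ℝ) 1 := ⟨hε.1.trans hs₀.1, hs₀.2⟩
  -- Here `c'` is the discrepancy between the integral from `∞` and the sheet `f`; it is shown to
  -- vanish because the same improper integral tends both to `τ` and to `τ + c'`.
  obtain ⟨c', hc'⟩ : ∃ c', ∀ s ∈ Ioo ε 1, T s - c = f (γ s) + c' := by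
    refine ⟨T s₀ - c - f (γ s₀), fun s hs => ?_⟩
    have := sub_eq_sub_of_hasDerivAt isOpen_Ioo isPreconnected_Ioo (f := T)
      (g := fun s => f (γ s)) (fun s hs => hT s ⟨hε.1.trans hs.1, hs.2⟩)
      (fun s hs => ((hf.2.2 _ (hγε s hs)).2.comp_of_eq s (hd s ⟨hε.1.trans hs.1, hs.2⟩)
        rfl).congr_deriv (by ring)) hs hs₀'
    linear_combination this
  have hT1 : Tendsto (fun s => T s - c) (𝓝[<] 1) (𝓝 (τ + c')) := by
    have h1 := ((hf.2.1.continuousAt (hf.1.mem_nhds hw)).tendsto.comp hlim).add_const c'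
    rw [hfw] at h1
    refine h1.congr' ?_
    filter_upwards [Ioo_mem_nhdsLT hε.2] with s hs
    simp [hc' s hs]
  have hlimq : Tendsto (fun q : ℝ × ℝ => ∫ s in q.1..q.2, deriv γ s / P.eval (γ s))
      (𝓝[>] 0 ×ˢ 𝓝[<] 1) (𝓝 (τ + c')) := by
    have h9 : Tendsto (fun q : ℝ × ℝ => T q.2 - c) (𝓝[>] 0 ×ˢ 𝓝[<] 1) (𝓝 (τ + c')) :=
      hT1.comp tendsto_snd
    have h10 : Tendsto (fun q : ℝ × ℝ => T q.1 - c) (𝓝[>] 0 ×ˢ 𝓝[<] 1) (𝓝 0) :=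
      hT0.comp tendsto_fst
    have h11 := h9.sub h10
    rw [sub_zero] at h11
    refine h11.congr' ?_
    have e1 : ∀ᶠ s : ℝ in 𝓝[>] 0, s ∈ Ioo (0 : ℝ) 1 := Ioo_mem_nhdsGT one_pos
    have e2 : ∀ᶠ s : ℝ in 𝓝[<] 1, s ∈ Ioo (0 : ℝ) 1 := Ioo_mem_nhdsLT one_pos
    filter_upwards [e1.prod_mk e2] with q hq
    rw [intervalIntegral.integral_eq_sub_of_hasDerivAt
      (fun s hs => hT s (ordConnected_Ioo.uIcc_subset hq.1 hq.2 hs)) (hii _ hq.1 _ hq.2)]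
    ring
  have hc0 : c' = 0 := by
    have := tendsto_nhds_unique hlimq hint
    simpa using this
  -- the stopped path
  have hst : ∀ s > 0, s₀ * Real.smoothTransition s ∈ Ioo (0 : ℝ) 1 := fun s hs =>
    ⟨mul_pos hs01.1 (Real.smoothTransition.pos_of_pos hs),
      (mul_le_of_le_one_right hs01.1.le (Real.smoothTransition.le_one s)).trans_lt hs01.2⟩
  have hsd : Differentiable ℝ Real.smoothTransition :=
    (Real.smoothTransition.contDiff (n := 1)).differentiable (by simp)
  have hh : ∀ s, HasDerivAt (fun s => s₀ * Real.smoothTransition s)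
      (s₀ * deriv Real.smoothTransition s) s := fun s => (hsd s).hasDerivAt.const_mul s₀
  have hlim0 : Tendsto (fun s => s₀ * Real.smoothTransition s) (𝓝[>] 0) (𝓝[>] 0) := by
    refine tendsto_nhdsWithin_iff.2 ⟨?_, ?_⟩
    · have := (hh 0).continuousAt.tendsto
      rw [Real.smoothTransition.zero, mul_zero] at this
      exact this.mono_left nhdsWithin_le_nhds
    · filter_upwards [self_mem_nhdsWithin] with s hs using (hst s hs).1
  refine ⟨γ s₀, hγε s₀ hs₀', fun s => γ (s₀ * Real.smoothTransition s),
    fun s => ((s₀ * deriv Real.smoothTransition s : ℝ) : ℂ) *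
      deriv γ (s₀ * Real.smoothTransition s),
    fun s => T (s₀ * Real.smoothTransition s) - c, 1, one_pos, fun s hs => ?_, ?_,
    fun s hs => h0 _ (hst s hs), fun s hs => ?_, hinf.comp hlim0, hT0.comp hlim0, fun s hs => ?_⟩
  · exact ((hd _ (hst s hs)).scomp s (hh s)).congr_deriv (by simp)
  · refine ContinuousOn.mul (Complex.continuous_ofReal.comp_continuousOn
      (continuousOn_const.mul ?_)) (hdc.comp ?_ fun s hs => hst s hs)
    · exact ((Real.smoothTransition.contDiff (n := 1)).continuous_deriv le_rfl).continuousOn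
    · exact fun s _ => (hh s).continuousAt.continuousWithinAt
  · refine (((hT _ (hst s hs)).scomp s (hh s)).sub_const c).congr_deriv ?_
    simp [mul_div_assoc]
  · simp only [Real.smoothTransition.one_of_one_le hs, mul_one, hc' s₀ hs₀', hc0, add_zero,
      and_self]

/-- If one point of a connected sheet is a time value, then so is every other point. -/
lemma IsLocalPrimitive.isTimeValue (C : InfinityChart k P) {V : Set (OnePoint ℂ)}
    {f : OnePoint ℂ → ℂ} (hf : IsLocalPrimitive P V f)
    (hc : IsPreconnected ((↑) ⁻¹' V : Set ℂ)) {z : ℂ} (hz : (z : OnePoint ℂ) ∈ V)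
    (h : Reach P z (f z)) {y : OnePoint ℂ} (hy : y ∈ V) : IsTimeValue P y (f y) := by
  have hfin : ∀ x : ℂ, (x : OnePoint ℂ) ∈ V → Reach P x (f x) := fun x hx =>
    h.propagate (g := fun x : ℂ => f x) (hf.1.preimage OnePoint.continuous_coe) hc
      (fun w hw => (hf.2.2 w hw).1) (fun w hw => (hf.2.2 w hw).2) hz hx
  induction y using OnePoint.rec with
  | coe x => exact (hfin x hy).isTimeValue
  | infty =>
    have hg := C.isLocalPrimitive le_rfl (f OnePoint.infty)
    have he := hf.eventuallyEq hg hy (infty_mem_exterior _) rfl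
    rw [nhds_infty_onePoint, eventually_sup, eventually_map] at he
    obtain ⟨x, ⟨hx1, hx2⟩, hx3⟩ := ((he.1.and (hf.eventually_mem hy)).and
      (eventually_norm_gt C.r⁻¹)).exists
    have := (hfin x hx2).isTimeValue_infty C hx3
    rwa [hx1, OnePoint.elim_some, add_sub_cancel_left] at this

/-- Stopping the defining path inside the sheet yields a finite reachable point, from which the
connected sheet is exhausted. -/
lemma IsTimeValue.of_sheet (C : InfinityChart k P) {V : Set (OnePoint ℂ)}
    {f : OnePoint ℂ → ℂ} (hf : IsLocalPrimitive P V f)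
    (hc : IsPreconnected ((↑) ⁻¹' V : Set ℂ)) {w : OnePoint ℂ} (hw : w ∈ V)
    (h : IsTimeValue P w (f w)) {y : OnePoint ℂ} (hy : y ∈ V) : IsTimeValue P y (f y) := by
  obtain ⟨z, hz, hR⟩ := h.exists_reach C hf hw rfl
  exact hf.isTimeValue C hc hz hR hy

end Reach

/-! ### Small connected sheets, local connectedness, openness of time -/

section Sheets
variable {k : ℕ} {P : Polynomial ℂ}

/-- On one sheet the topology of the surface is induced from the sphere by `pt`. -/
lemma TimeSurface.exists_sheet_subset {V : Set (OnePoint ℂ)}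
    {f : OnePoint ℂ → ℂ} (hf : IsLocalPrimitive P V f) {p : TimeSurface P} (hp : p ∈ sheet P V f)
    {W : Set (TimeSurface P)} (hW : W ∈ 𝓝 p) : ∃ N ∈ 𝓝 p.pt, sheet P (V ∩ N) f ⊆ W := by
  have h : Tendsto id (comap TimeSurface.pt (𝓝 p.pt) ⊓ 𝓟 (sheet P V f)) (𝓝 p) := by
    refine tendsto_timeSurface hf hp (tendsto_comap.mono_left inf_le_left) ?_
    exact mem_inf_of_right fun q hq => hq.2
  have hW' := h hW
  rw [map_id, mem_inf_principal, mem_comap] at hW'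
  obtain ⟨N, hN, hNW⟩ := hW'
  exact ⟨N, hN, fun q hq => hNW hq.1.2 ⟨hq.1.1, hq.2⟩⟩

lemma isPreconnected_coe_preimage_exterior (R : ℝ) :
    IsPreconnected ((↑) ⁻¹' exterior R : Set ℂ) := by
  have : ((↑) ⁻¹' exterior R : Set ℂ) = {z | R < ‖z‖} := by
    ext z; exact coe_mem_exterior
  rw [this]; exact isPreconnected_norm_gt R

lemma isPreconnected_exterior (R : ℝ) : IsPreconnected (exterior R) := by
  refine ((isPreconnected_norm_gt R).image ((↑) : ℂ → OnePoint ℂ)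
    OnePoint.continuous_coe.continuousOn).subset_closure ?_ ?_
  · rintro _ ⟨z, hz, rfl⟩
    exact coe_mem_exterior.2 hz
  · intro y hy
    induction y using OnePoint.rec with
    | coe z => exact subset_closure ⟨z, coe_mem_exterior.1 hy, rfl⟩
    | infty =>
      exact mem_closure_of_tendsto (b := Bornology.cobounded ℂ)
        (tendsto_coe_infty_iff.2 tendsto_id)
        ((eventually_norm_gt R).mono fun z hz => mem_image_of_mem _ hz)

lemma exterior_subset_of_mem_nhds {N : Set (OnePoint ℂ)} (hN : N ∈ 𝓝 OnePoint.infty) (R₀ : ℝ) :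
    ∃ R, R₀ ≤ R ∧ exterior R ⊆ N := by
  rw [nhds_infty_onePoint] at hN
  obtain ⟨R, hR, h⟩ := cobounded_norm_gt_iff.1 hN.1
  refine ⟨max R₀ R, le_max_left _ _, fun y hy => ?_⟩
  induction y using OnePoint.rec with
  | infty => exact hN.2
  | coe z => exact h z ((le_max_right _ _).trans_lt (coe_mem_exterior.1 hy))

/-- Small connected sheets form a neighbourhood basis at every point. -/
lemma TimeSurface.exists_connected_sheet (C : InfinityChart k P) (p : TimeSurface P)
    {W : Set (TimeSurface P)} (hW : W ∈ 𝓝 p) :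
    ∃ (V : Set (OnePoint ℂ)) (f : OnePoint ℂ → ℂ), IsLocalPrimitive P V f ∧ p ∈ sheet P V f ∧
      sheet P V f ⊆ W ∧ IsPreconnected V ∧ IsPreconnected ((↑) ⁻¹' V : Set ℂ) ∧
      ∀ y ∈ V, IsTimeValue P y (f y) := by
  obtain ⟨V, f, hf, hp⟩ := p.exists_isLocalPrimitive C
  obtain ⟨N, hN, hNW⟩ := exists_sheet_subset hf hp hW
  suffices h : ∃ V' ⊆ V ∩ N, IsOpen V' ∧ p.pt ∈ V' ∧ IsPreconnected V' ∧
      IsPreconnected ((↑) ⁻¹' V' : Set ℂ) by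
    obtain ⟨V', hsub, hV', hp', hc, hc'⟩ := h
    have hf' := hf.mono hV' (hsub.trans inter_subset_left)
    refine ⟨V', f, hf', ⟨hp', hp.2⟩, fun q hq => hNW ⟨hsub hq.1, hq.2⟩, hc, hc',
      fun y hy => IsTimeValue.of_sheet C hf' hc' hp' ?_ hy⟩
    rw [← hp.2]; exact p.isTimeValue
  have hVN : V ∩ N ∈ 𝓝 p.pt := inter_mem (hf.1.mem_nhds hp.1) hN
  rcases p with ⟨y, τ, hτ⟩
  induction y using OnePoint.rec with
  | infty =>
    obtain ⟨R, -, hR⟩ := exterior_subset_of_mem_nhds hVN 0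
    exact ⟨_, hR, isOpen_exterior R, infty_mem_exterior R, isPreconnected_exterior R,
      isPreconnected_coe_preimage_exterior R⟩
  | coe z =>
    rw [OnePoint.nhds_coe_eq, mem_map] at hVN
    obtain ⟨r, hr, hball⟩ := Metric.mem_nhds_iff.1 hVN
    refine ⟨(↑) '' Metric.ball z r, image_subset_iff.2 hball,
      OnePoint.isOpen_image_coe.2 Metric.isOpen_ball, mem_image_of_mem _ (Metric.mem_ball_self hr),
      ((convex_ball z r).isPreconnected).image _ OnePoint.continuous_coe.continuousOn, ?_⟩
    rw [preimage_image_eq _ OnePoint.coe_injective]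
    exact (convex_ball z r).isPreconnected

/-- The inverse of the projection `pt` on a sheet. -/
def sheetLift {V : Set (OnePoint ℂ)} {f : OnePoint ℂ → ℂ} (h : ∀ y ∈ V, IsTimeValue P y (f y))
    (y : V) : TimeSurface P := ⟨y, f y, h y y.2⟩

lemma continuous_sheetLift {V : Set (OnePoint ℂ)} {f : OnePoint ℂ → ℂ}
    (hf : IsLocalPrimitive P V f) (h : ∀ y ∈ V, IsTimeValue P y (f y)) :
    Continuous (sheetLift h) :=
  continuous_iff_continuousAt.2 fun y => tendsto_timeSurface hf (p := sheetLift h y) ⟨y.2, rfl⟩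
    continuous_subtype_val.continuousAt (Eventually.of_forall fun _ => rfl)

lemma isPreconnected_sheet {V : Set (OnePoint ℂ)} {f : OnePoint ℂ → ℂ}
    (hf : IsLocalPrimitive P V f) (h : ∀ y ∈ V, IsTimeValue P y (f y)) {W : Set (OnePoint ℂ)}
    (hWV : W ⊆ V) (hW : IsPreconnected W) : IsPreconnected (sheet P W f) := by
  have : sheet P W f = sheetLift h '' ((↑) ⁻¹' W) := by
    ext p
    constructor
    · rintro ⟨h1, h2⟩
      exact ⟨⟨p.pt, hWV h1⟩, h1, TimeSurface.ext' rfl h2.symm⟩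
    · rintro ⟨y, hy, rfl⟩
      exact ⟨hy, rfl⟩
  rw [this]
  refine IsPreconnected.image ?_ _ (continuous_sheetLift hf h).continuousOn
  exact (Topology.IsInducing.subtypeVal.isPreconnected_image).1
    (by rwa [Subtype.image_preimage_coe, inter_eq_self_of_subset_right hWV])

/-- Needed so that the components of the complement of the period curve are open. -/
lemma TimeSurface.locallyConnectedSpace (C : InfinityChart k P) :
    LocallyConnectedSpace (TimeSurface P) := by
  refine locallyConnectedSpace_iff_connected_subsets.2 fun p W hW => ?_
  obtain ⟨V, f, hf, hp, hVW, hc, -, hv⟩ := p.exists_connected_sheet C hW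
  exact ⟨_, hf.sheet_mem_nhds hp, isPreconnected_sheet hf hv subset_rfl hc, hVW⟩

/-- At finite points `time` has a nonzero derivative. Over `∞` it may be branched of order `k`, but
`eventually_exists_f_eq` still yields all nearby values. -/
lemma TimeSurface.isOpenMap_time (C : InfinityChart k P) :
    IsOpenMap (TimeSurface.time : TimeSurface P → ℂ) := by
  refine IsOpenMap.of_nhds_le fun p W hW => ?_
  obtain ⟨V, f, hf, hp, hVW, -, -, hv⟩ := p.exists_connected_sheet C (mem_map.1 hW)
  have hsub : ∀ y ∈ V, f y ∈ W := fun y hy => hVW (a := ⟨y, f y, hv y hy⟩) ⟨hy, rfl⟩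
  rcases p with ⟨y, τ, hτ⟩
  induction y using OnePoint.rec with
  | infty =>
    have hpV : OnePoint.infty ∈ V := hp.1
    have hpf : τ = f OnePoint.infty := hp.2
    have hg := C.isLocalPrimitive le_rfl τ
    have he := hf.eventuallyEq hg hpV (infty_mem_exterior _) hpf.symm
    rw [nhds_infty_onePoint, eventually_sup, eventually_map] at he
    obtain ⟨R, -, hR⟩ := cobounded_norm_gt_iff.1 (he.1.and (hf.eventually_mem hpV))
    have h0 := C.eventually_exists_f_eq R
    rw [eventually_nhdsWithin_iff] at h0
    have h1 : Tendsto (fun t => t - τ) (𝓝 τ) (𝓝 0) := by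
      have : ContinuousAt (fun t => t - τ) τ := by fun_prop
      simpa using this.tendsto
    filter_upwards [h1.eventually h0] with t ht
    rcases eq_or_ne t τ with rfl | hne
    · rw [hpf]; exact hsub _ hpV
    · obtain ⟨z, hz1, -, hz2⟩ := ht (sub_ne_zero.2 hne)
      have := hsub _ (hR z hz1).2
      rwa [(hR z hz1).1, OnePoint.elim_some, hz2, sub_add_cancel] at this
  | coe z =>
    have hpV : (z : OnePoint ℂ) ∈ V := hp.1
    have hpf : τ = f z := hp.2
    obtain ⟨h0, hd⟩ := hf.2.2 z hpV
    have hopen : IsOpen ((↑) ⁻¹' V : Set ℂ) := hf.1.preimage OnePoint.continuous_coe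
    have han : AnalyticAt ℂ (fun w : ℂ => f w) z :=
      DifferentiableOn.analyticAt (fun w hw => (hf.2.2 w hw).2.differentiableAt.differentiableWithinAt)
        (hopen.mem_nhds hpV)
    have hs := han.hasStrictDerivAt
    rw [hd.deriv] at hs
    have hm := hs.map_nhds_eq (one_div_ne_zero h0)
    show W ∈ 𝓝 τ
    rw [hpf, ← hm, mem_map]
    filter_upwards [hopen.mem_nhds hpV] with w hw using hsub _ hw

end Sheets

/-! ### Uniqueness, linearization and uniform lifetimes for `ż = c P(z)` -/

section ODE
variable {P : Polynomial ℂ}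

/-- Uniqueness for the real time trajectories of `ż = c P(z)`. -/
lemma eqOn_of_hasDerivAt_real {c : ℂ} {γ₁ γ₂ : ℝ → ℂ} {T : ℝ}
    (h₁ : ∀ s ∈ Icc 0 T, HasDerivAt γ₁ (c * P.eval (γ₁ s)) s)
    (h₂ : ∀ s ∈ Icc 0 T, HasDerivAt γ₂ (c * P.eval (γ₂ s)) s) (h0 : γ₁ 0 = γ₂ 0) :
    EqOn γ₁ γ₂ (Icc 0 T) := by
  have c₁ : ContinuousOn γ₁ (Icc 0 T) := fun s hs => (h₁ s hs).continuousAt.continuousWithinAt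
  have c₂ : ContinuousOn γ₂ (Icc 0 T) := fun s hs => (h₂ s hs).continuousAt.continuousWithinAt
  -- Both trajectories stay in a compact set, on which the field is Lipschitz.
  have hcomp : IsCompact (γ₁ '' Icc 0 T ∪ γ₂ '' Icc 0 T) :=
    (isCompact_Icc.image_of_continuousOn c₁).union (isCompact_Icc.image_of_continuousOn c₂)
  have hlip : LocallyLipschitz (fun z => c * P.eval z) := by
    have : ContDiff ℂ 1 (fun z => c * P.eval z) := contDiff_const.mul P.differentiable.contDiff
    exact (this.restrict_scalars ℝ).locallyLipschitz
  obtain ⟨K, hK⟩ := (hlip.locallyLipschitzOn (s := γ₁ '' Icc 0 T ∪ γ₂ '' Icc 0 T)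
    ).exists_lipschitzOnWith_of_compact hcomp
  exact ODE_solution_unique_of_mem_Icc_right (v := fun _ z => c * P.eval z)
    (s := fun _ => γ₁ '' Icc 0 T ∪ γ₂ '' Icc 0 T) (K := K) (fun _ _ => hK) c₁
    (fun s hs => (h₁ s (Ico_subset_Icc_self hs)).hasDerivWithinAt)
    (fun s hs => Or.inl (mem_image_of_mem _ (Ico_subset_Icc_self hs))) c₂
    (fun s hs => (h₂ s (Ico_subset_Icc_self hs)).hasDerivWithinAt)
    (fun s hs => Or.inr (mem_image_of_mem _ (Ico_subset_Icc_self hs))) h0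

/-- Uniqueness for the complex time trajectories of `ż = c P(z)`. -/
lemma eqOn_of_hasDerivAt_complex {c : ℂ} {y₁ y₂ : ℂ → ℂ} {S : Set ℂ} (hS : Convex ℝ S)
    (h₁ : ∀ t ∈ S, HasDerivAt y₁ (c * P.eval (y₁ t)) t)
    (h₂ : ∀ t ∈ S, HasDerivAt y₂ (c * P.eval (y₂ t)) t) {t₀ : ℂ} (ht₀ : t₀ ∈ S)
    (h0 : y₁ t₀ = y₂ t₀) : EqOn y₁ y₂ S := by
  intro t ht
  have hmem : ∀ s ∈ Icc (0 : ℝ) 1, t₀ + s * (t - t₀) ∈ S := fun s hs => by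
    simpa using hS.add_smul_sub_mem ht₀ ht hs
  have hline : ∀ s : ℝ, HasDerivAt (fun s : ℝ => t₀ + s * (t - t₀)) (t - t₀) s := fun s => by
    have := ((Complex.ofRealCLM.hasDerivAt (x := s)).mul_const (t - t₀)).const_add t₀
    exact this.congr_deriv (by simp)
  -- Along the segment from `t₀` to `t` the equation is a real-time one with constant `c * (t -
  -- t₀)`.
  have key := eqOn_of_hasDerivAt_real (P := P) (c := c * (t - t₀)) (T := 1)
    (γ₁ := fun s => y₁ (t₀ + s * (t - t₀))) (γ₂ := fun s => y₂ (t₀ + s * (t - t₀)))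
    (fun s hs => ((h₁ _ (hmem s hs)).comp_of_eq s (hline s) rfl).congr_deriv (by ring))
    (fun s hs => ((h₂ _ (hmem s hs)).comp_of_eq s (hline s) rfl).congr_deriv (by ring))
    (by simpa using h0)
  simpa using key (right_mem_Icc.2 zero_le_one)

/-- Linearizing coordinate at a simple zero. -/
lemma exists_linearization {a : ℂ} (ha : P.IsRoot a) (hs : P.derivative.eval a ≠ 0) :
    ∃ (ψ : ℂ → ℂ) (R : ℝ), 0 < R ∧ ψ 0 = a ∧ InjOn ψ (Metric.ball 0 R) ∧
      ContinuousOn ψ (Metric.ball 0 R) ∧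
      (∀ q ∈ Metric.ball (0 : ℂ) R, q ≠ 0 →
        HasDerivAt ψ (P.eval (ψ q) / (P.derivative.eval a * q)) q) ∧
      ∀ s ≤ R, IsOpen (ψ '' Metric.ball 0 s) := by
  obtain ⟨Q, hQ⟩ := Polynomial.dvd_iff_isRoot.2 ha
  have hQa : Q.eval a = P.derivative.eval a := by
    rw [hQ]; simp [Polynomial.derivative_mul]
  set l := P.derivative.eval a with hl
  obtain ⟨Q₁, hQ₁⟩ := Polynomial.dvd_iff_isRoot (p := Q - Polynomial.C l) (a := a) |>.2
    (by simp [Polynomial.IsRoot, hQa])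
  have hQe : ∀ z, Q.eval z = l + (z - a) * Q₁.eval z := fun z => by
    have := congrArg (Polynomial.eval z) hQ₁
    simp at this
    linear_combination this
  have hPe : ∀ z, P.eval z = (z - a) * Q.eval z := fun z => by
    have := congrArg (Polynomial.eval z) hQ
    simpa using this
  obtain ⟨r, hr, hQ0⟩ := Metric.eventually_nhds_iff_ball.1
    (Q.continuous.continuousAt.eventually_ne (show Q.eval a ≠ 0 by rwa [hQa]))
  have hd : DifferentiableOn ℂ (fun z => -Q₁.eval z / Q.eval z) (Metric.ball a r) := fun w hw =>
    ((Q₁.differentiable.neg.differentiableAt).div Q.differentiable.differentiableAt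
      (hQ0 w hw)).differentiableWithinAt
  obtain ⟨G, hG, hG'⟩ := hd.isExactOn_ball.with_val_at a 0
  -- Since `Q = l + (z - a) Q₁` and `P = (z - a) Q`, one has `1 / (z - a) - Q₁ / Q = l / P`. With
  -- `G' = -Q₁ / Q` this gives `h' = l h / P`: the coordinate `h` turns the field `P` into the
  -- linear field `l q`.
  let h : ℂ → ℂ := fun z => (z - a) * Complex.exp (G z)
  have hh : ∀ z ∈ Metric.ball a r, HasDerivAt h (Complex.exp (G z) * l / Q.eval z) z :=
    fun z hz => by
      have := ((hasDerivAt_id z).sub_const a).mul (hG' z hz).cexp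
      refine this.congr_deriv ?_
      have h1 := hQ0 z hz
      have h2 := hQe z
      simp only [id]
      field_simp
      linear_combination h2
  have ha_mem := Metric.mem_ball_self (x := a) hr
  have han : AnalyticAt ℂ h a := DifferentiableOn.analyticAt
    (fun w hw => (hh w hw).differentiableAt.differentiableWithinAt) (Metric.isOpen_ball.mem_nhds ha_mem)
  have hstr := han.hasStrictDerivAt
  have hne : deriv h a ≠ 0 := by
    rw [(hh a ha_mem).deriv]
    exact div_ne_zero (mul_ne_zero (Complex.exp_ne_zero _) hs) (hQ0 a ha_mem)
  let e := (hstr.hasStrictFDerivAt_equiv hne).toOpenPartialHomeomorph h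
  have hea : a ∈ e.source :=
    (hstr.hasStrictFDerivAt_equiv hne).mem_toOpenPartialHomeomorph_source
  have hecoe : ∀ z, e z = h z := fun z => rfl
  have hha : e a = 0 := by simp [hecoe, h]
  have h0t : (0 : ℂ) ∈ e.target := hha ▸ e.map_source hea
  have hsymm0 : e.symm 0 = a := by rw [← hha]; exact e.left_inv hea
  have hopen := e.isOpen_inter_preimage_symm (Metric.isOpen_ball (x := a) (ε := r))
  obtain ⟨R, hR, hball⟩ := Metric.isOpen_iff.1 hopen 0
    ⟨h0t, by rw [mem_preimage, hsymm0]; exact ha_mem⟩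
  refine ⟨e.symm, R, hR, hsymm0, e.symm.injOn.mono fun q hq => (hball hq).1,
    e.continuousOn_symm.mono fun q hq => (hball hq).1, fun q hq hq0 => ?_, fun s hs => ?_⟩
  · have hq' := hball hq
    have hd := e.hasDerivAt_symm hq'.1 (f' := Complex.exp (G (e.symm q)) * l / Q.eval (e.symm q))
      (div_ne_zero (mul_ne_zero (Complex.exp_ne_zero _) hs) (hQ0 _ hq'.2)) (hh _ hq'.2)
    refine hd.congr_deriv ?_
    have hqe : q = (e.symm q - a) * Complex.exp (G (e.symm q)) := (e.right_inv hq'.1).symm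
    rw [inv_div, hPe, div_eq_div_iff (mul_ne_zero (Complex.exp_ne_zero _) hs) (mul_ne_zero hs hq0)]
    linear_combination Q.eval (e.symm q) * l * hqe
  · exact e.isOpen_image_symm_of_subset_target Metric.isOpen_ball fun q hq =>
      (hball (Metric.ball_subset_ball hs hq)).1

/-- Local solutions in complex time, with a lifetime that is locally uniform in the initial
value. -/
lemma exists_local_flow (hsimple : ∀ a : ℂ, P.IsRoot a → P.derivative.eval a ≠ 0) {c : ℂ}
    (z₀ : ℂ) : ∃ δ > 0, ∃ ε > 0, ∀ z ∈ Metric.ball z₀ δ, ∃ y : ℂ → ℂ, y 0 = z ∧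
      ∀ t ∈ Metric.ball (0 : ℂ) ε, HasDerivAt y (c * P.eval (y t)) t := by
  by_cases hz₀ : P.eval z₀ = 0
  · obtain ⟨ψ, R, hR, hψ0, -, -, hψ, hopen⟩ := exists_linearization hz₀ (hsimple z₀ hz₀)
    obtain ⟨δ, hδ, hδR⟩ := Metric.isOpen_iff.1 (hopen (R / 2) (by linarith)) z₀
      ⟨0, Metric.mem_ball_self (by linarith), hψ0⟩
    -- In the linear coordinate the solution is `q exp (c l t)` with `l = P'(z₀)`. Starting in the
    -- disc of radius `R / 2`, it stays in that of radius `R` while the exponential is below `2`.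
    have hexp : ContinuousAt (fun t => Complex.exp (c * P.derivative.eval z₀ * t)) 0 := by fun_prop
    obtain ⟨ε, hε, hexp2⟩ := Metric.eventually_nhds_iff_ball.1
      (hexp.norm.eventually_lt_const (u := 2) (by simp))
    refine ⟨δ, hδ, ε, hε, fun z hz => ?_⟩
    obtain ⟨q, hq, rfl⟩ := hδR hz
    rcases eq_or_ne q 0 with rfl | hq0
    · exact ⟨fun _ => ψ 0, rfl, fun t _ => by
        have : P.eval (ψ 0) = 0 := by rw [hψ0, hz₀]
        simpa [this] using hasDerivAt_const t (ψ 0)⟩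
    refine ⟨fun t => ψ (q * Complex.exp (c * P.derivative.eval z₀ * t)), by simp, fun t ht => ?_⟩
    have hqt : q * Complex.exp (c * P.derivative.eval z₀ * t) ∈ Metric.ball (0 : ℂ) R := by
      rw [mem_ball_zero_iff] at hq ⊢
      rw [norm_mul]
      have := hexp2 t ht
      nlinarith [norm_nonneg q, norm_nonneg (Complex.exp (c * P.derivative.eval z₀ * t))]
    have hd := hψ _ hqt (mul_ne_zero hq0 (Complex.exp_ne_zero _))
    have hi : HasDerivAt (fun t => q * Complex.exp (c * P.derivative.eval z₀ * t))
        (q * (Complex.exp (c * P.derivative.eval z₀ * t) * (c * P.derivative.eval z₀))) t := by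
      have := (((hasDerivAt_id t).const_mul (c * P.derivative.eval z₀)).cexp).const_mul q
      exact this.congr_deriv (by simp)
    refine (hd.comp_of_eq t hi rfl).congr_deriv ?_
    have h1 := hsimple z₀ hz₀
    have h2 := Complex.exp_ne_zero (c * P.derivative.eval z₀ * t)
    field_simp
  · obtain ⟨g, r, hr, -, hg⟩ := exists_primitive_ball (P := P) hz₀ 0
    have hz_mem := Metric.mem_ball_self (x := z₀) hr
    have han : AnalyticAt ℂ g z₀ := DifferentiableOn.analyticAt
      (fun w hw => (hg w hw).2.differentiableAt.differentiableWithinAt)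
      (Metric.isOpen_ball.mem_nhds hz_mem)
    have hstr := han.hasStrictDerivAt
    have hne : deriv g z₀ ≠ 0 := by
      rw [(hg z₀ hz_mem).2.deriv]
      exact one_div_ne_zero hz₀
    let e := (hstr.hasStrictFDerivAt_equiv hne).toOpenPartialHomeomorph g
    have hez : z₀ ∈ e.source :=
      (hstr.hasStrictFDerivAt_equiv hne).mem_toOpenPartialHomeomorph_source
    have hecoe : ∀ z, e z = g z := fun z => rfl
    have hopen := e.isOpen_inter_preimage_symm (Metric.isOpen_ball (x := z₀) (ε := r))
    obtain ⟨ρ, hρ, hball⟩ := Metric.isOpen_iff.1 hopen (g z₀)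
      ⟨e.map_source hez, by rw [mem_preimage, ← hecoe, e.left_inv hez]; exact hz_mem⟩
    have hcont : ∀ᶠ z in 𝓝 z₀, z ∈ e.source ∧ g z ∈ Metric.ball (g z₀) (ρ / 2) :=
      (e.open_source.eventually_mem hez).and
        (han.continuousAt.eventually_mem (Metric.ball_mem_nhds _ (half_pos hρ)))
    obtain ⟨δ, hδ, hδz⟩ := Metric.eventually_nhds_iff_ball.1 hcont
    -- Away from the zeros the primitive `g` straightens the field: the solution is the inverse of
    -- `g` at `g z + c t`. One half of `ρ` is spent on the initial value, the other half on the
    -- time.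
    refine ⟨δ, hδ, ρ / 2 / (‖c‖ + 1), by positivity, fun z hz => ?_⟩
    obtain ⟨hz1, hz2⟩ := hδz z hz
    refine ⟨fun t => e.symm (g z + c * t), ?_, fun t ht => ?_⟩
    · simp only [mul_zero, add_zero]; rw [← hecoe]; exact e.left_inv hz1
    have hmem : g z + c * t ∈ Metric.ball (g z₀) ρ := by
      rw [mem_ball_zero_iff, lt_div_iff₀ (by positivity)] at ht
      rw [mem_ball_iff_norm] at hz2 ⊢
      calc ‖g z + c * t - g z₀‖ = ‖(g z - g z₀) + c * t‖ := by ring_nf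
        _ ≤ ‖g z - g z₀‖ + ‖c‖ * ‖t‖ := (norm_add_le _ _).trans (by rw [norm_mul])
        _ < ρ := by nlinarith [norm_nonneg t]
    obtain ⟨h1, h2⟩ := hball hmem
    have hd := e.hasDerivAt_symm h1 (one_div_ne_zero (hg _ h2).1) (hg _ h2).2
    have hi : HasDerivAt (fun t => g z + c * t) c t := by
      have := ((hasDerivAt_id t).const_mul c).const_add (g z)
      exact this.congr_deriv (by simp)
    refine (hd.comp_of_eq t hi rfl).congr_deriv ?_
    rw [one_div, inv_inv, mul_comm]

/-- Compactness of the disc makes the local lifetimes uniform, so a solution can fail to continue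
only by leaving every bounded set. -/
lemma exists_uniform_flow (hsimple : ∀ a : ℂ, P.IsRoot a → P.derivative.eval a ≠ 0) (c : ℂ)
    (M : ℝ) : ∃ ε > 0, ∀ z : ℂ, ‖z‖ ≤ M → ∃ y : ℂ → ℂ, y 0 = z ∧
      ∀ t ∈ Metric.ball (0 : ℂ) ε, HasDerivAt y (c * P.eval (y t)) t := by
  have := (isCompact_closedBall (0 : ℂ) M).induction_on (p := fun S => ∃ ε > 0, ∀ z ∈ S,
    ∃ y : ℂ → ℂ, y 0 = z ∧ ∀ t ∈ Metric.ball (0 : ℂ) ε, HasDerivAt y (c * P.eval (y t)) t)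
    ⟨1, one_pos, by simp⟩ (fun S T hST ⟨ε, hε, h⟩ => ⟨ε, hε, fun z hz => h z (hST hz)⟩)
    (fun S T ⟨ε, hε, h⟩ ⟨ε', hε', h'⟩ => ⟨min ε ε', lt_min hε hε', fun z hz => by
      rcases hz with hz | hz
      · obtain ⟨y, h0, hy⟩ := h z hz
        exact ⟨y, h0, fun t ht => hy t (Metric.ball_subset_ball (min_le_left _ _) ht)⟩
      · obtain ⟨y, h0, hy⟩ := h' z hz
        exact ⟨y, h0, fun t ht => hy t (Metric.ball_subset_ball (min_le_right _ _) ht)⟩⟩)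
    (fun z₀ _ => by
      obtain ⟨δ, hδ, ε, hε, h⟩ := exists_local_flow hsimple (c := c) z₀
      exact ⟨_, mem_nhdsWithin_of_mem_nhds (Metric.ball_mem_nhds z₀ hδ), ε, hε, h⟩)
  obtain ⟨ε, hε, h⟩ := this
  exact ⟨ε, hε, fun z hz => h z (mem_closedBall_zero_iff.2 hz)⟩

end ODE

/-! ### Entire solutions -/

section Entire
variable {k : ℕ} {P : Polynomial ℂ}

lemma isOpen_im_gt (h : ℝ) : IsOpen {w : ℂ | h < w.im} := isOpen_lt continuous_const Complex.continuous_im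

lemma convex_im_gt (h : ℝ) : Convex ℝ {w : ℂ | h < w.im} := convex_halfSpace_im_gt h

/-- There are no nonconstant entire solutions of `y' = c P(y)`. -/
lemma eval_eq_zero_of_entire (C : InfinityChart k P) {c : ℂ} (hc : c ≠ 0) {y : ℂ → ℂ}
    (hy : ∀ t, HasDerivAt y (c * P.eval (y t)) t) : P.eval (y 0) = 0 := by
  have hdiff : Differentiable ℂ y := fun t => (hy t).differentiableAt
  obtain ⟨R, hR, hRf⟩ := cobounded_norm_gt_iff.1 ((C.tendsto_f.norm.eventually_lt_const
    (u := 1) (by simp)).and (eventually_norm_gt C.r⁻¹))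
  by_cases hb : ∀ t, ‖y t‖ ≤ R
  · have hconst : ∀ t, y t = y 0 := fun t => by
      refine hdiff.apply_eq_apply_of_bounded ?_ t 0
      exact isBounded_iff_forall_norm_le.2 ⟨R, by rintro _ ⟨t, rfl⟩; exact hb t⟩
    have h0 : HasDerivAt y 0 0 := by
      have : y = fun _ => y 0 := funext hconst
      rw [this]; exact hasDerivAt_const _ _
    exact (mul_eq_zero.1 ((hy 0).unique h0)).resolve_left hc
  · push Not at hb
    obtain ⟨w₀, hw₀⟩ := hb
    exfalso
    have hopen : IsOpen {t | R < ‖y t‖} := isOpen_lt continuous_const hdiff.continuous.norm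
    set U := connectedComponentIn {t | R < ‖y t‖} w₀ with hU
    have hUo : IsOpen U := hopen.connectedComponentIn
    have hUsub : U ⊆ {t | R < ‖y t‖} := connectedComponentIn_subset _ _
    have hw₀U : w₀ ∈ U := mem_connectedComponentIn hw₀
    -- Where `|y| > R` the function `C.f ∘ y` has constant slope `c` but norm below `1`, so the
    -- component is bounded. On its frontier `|y| ≤ R`, and the maximum principle contradicts `|y
    -- w₀| > R`.
    have hbdd : Bornology.IsBounded U := by
      refine (Metric.isBounded_ball (x := w₀) (r := 2 / ‖c‖ + 1)).subset fun t ht => ?_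
      have := sub_eq_sub_of_hasDerivAt hUo isPreconnected_connectedComponentIn
        (f := fun t => C.f (y t)) (g := fun t => c * t) (f' := fun _ => c)
        (fun x hx => ((C.hasDerivAt_f (hRf _ (hUsub hx)).2).comp_of_eq x (hy x) rfl).congr_deriv
          (by have := C.eval_ne' (hRf _ (hUsub hx)).2; field_simp))
        (fun x _ => ((hasDerivAt_id x).const_mul c).congr_deriv (mul_one c)) ht hw₀U
      have h1 : c * (t - w₀) = C.f (y t) - C.f (y w₀) := by linear_combination -this
      have h2 : ‖c‖ * ‖t - w₀‖ < 2 := by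
        rw [← norm_mul, h1]
        linarith [norm_sub_le (C.f (y t)) (C.f (y w₀)), (hRf _ (hUsub ht)).1, (hRf _ hw₀).1]
      rw [mem_ball_iff_norm]
      have : ‖t - w₀‖ < 2 / ‖c‖ := by
        rw [lt_div_iff₀ (norm_pos_iff.2 hc)]; linarith
      linarith
    have hfr : ∀ t ∈ frontier U, ‖y t‖ ≤ R := fun t ht => by
      by_contra hcon
      push Not at hcon
      have hmem : connectedComponentIn {t | R < ‖y t‖} t ∈ 𝓝 t :=
        hopen.connectedComponentIn.mem_nhds (mem_connectedComponentIn hcon)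
      obtain ⟨s, hs1, hs2⟩ := mem_closure_iff_nhds.1 (frontier_subset_closure ht) _ hmem
      have h1 := connectedComponentIn_eq hs1
      have h2 := connectedComponentIn_eq hs2
      have : t ∈ U := by
        rw [hU, h2, ← h1]; exact mem_connectedComponentIn hcon
      exact (hUo.frontier_eq ▸ ht).2 this
    exact (Complex.norm_le_of_forall_mem_frontier_norm_le hbdd hdiff.diffContOnCl hfr
      (subset_closure hw₀U)).not_gt hw₀

end Entire

/-! ### Maximal half-plane solutions -/

section HalfPlane
variable {k : ℕ} {P : Polynomial ℂ}

/-- `φ` solves `φ' = c P(φ)` on the half plane `Im w > h`, with the prescribed values `φ₀` near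
`i∞`. -/
def IsHalfPlaneSolution (P : Polynomial ℂ) (c : ℂ) (M : ℝ) (φ₀ : ℂ → ℂ) (h : ℝ) (φ : ℂ → ℂ) :
    Prop :=
  (∀ w : ℂ, h < w.im → HasDerivAt φ (c * P.eval (φ w)) w) ∧ ∀ w : ℂ, M < w.im → φ w = φ₀ w

lemma IsHalfPlaneSolution.eq {c : ℂ} {M : ℝ} {φ₀ φ₁ φ₂ : ℂ → ℂ} {h₁ h₂ : ℝ}
    (H₁ : IsHalfPlaneSolution P c M φ₀ h₁ φ₁) (H₂ : IsHalfPlaneSolution P c M φ₀ h₂ φ₂) {w : ℂ}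
    (hw₁ : h₁ < w.im) (hw₂ : h₂ < w.im) : φ₁ w = φ₂ w := by
  set t : ℂ := ((max M (max h₁ h₂) + 1 : ℝ) : ℂ) * Complex.I
  have ht : t.im = max M (max h₁ h₂) + 1 := by simp [t]
  have hM : M < t.im := by rw [ht]; linarith [le_max_left M (max h₁ h₂)]
  have hm : max h₁ h₂ < t.im := by rw [ht]; linarith [le_max_right M (max h₁ h₂)]
  exact eqOn_of_hasDerivAt_complex (convex_im_gt (max h₁ h₂))
    (fun s hs => H₁.1 s ((le_max_left _ _).trans_lt hs))
    (fun s hs => H₂.1 s ((le_max_right _ _).trans_lt hs)) hm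
    ((H₁.2 t hM).trans (H₂.2 t hM).symm) (max_lt hw₁ hw₂)

/-- Solutions on different half planes agree where both are defined, as they agree near `i∞`; one
function therefore serves all of them. -/
lemma exists_glued_solution {c : ℂ} {M : ℝ} {φ₀ : ℂ → ℂ} :
    ∃ φ : ℂ → ℂ, ∀ (h : ℝ) (φ' : ℂ → ℂ), IsHalfPlaneSolution P c M φ₀ h φ' →
      ∀ w : ℂ, h < w.im → φ w = φ' w ∧ HasDerivAt φ (c * P.eval (φ w)) w := by
  classical
  let good : ℂ → ℝ × (ℂ → ℂ) → Prop := fun w q => q.1 < w.im ∧ IsHalfPlaneSolution P c M φ₀ q.1 q.2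
  let φ : ℂ → ℂ := fun w => if h : ∃ q, good w q then h.choose.2 w else 0
  have key : ∀ (h : ℝ) (φ' : ℂ → ℂ), IsHalfPlaneSolution P c M φ₀ h φ' →
      ∀ w : ℂ, h < w.im → φ w = φ' w := fun h φ' H w hw => by
    have hex : ∃ q, good w q := ⟨(h, φ'), hw, H⟩
    simp only [φ, dif_pos hex]
    exact hex.choose_spec.2.eq H hex.choose_spec.1 hw
  refine ⟨φ, fun h φ' H w hw => ⟨key h φ' H w hw, ?_⟩⟩
  rw [key h φ' H w hw]
  refine (H.1 w hw).congr_of_eventuallyEq ?_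
  filter_upwards [(isOpen_im_gt h).mem_nhds hw] with s hs using key h φ' H s hs

/-- If the admissible heights were unbounded below, the glued solution would be entire, hence
constant at a zero of `P`, against `hne`. Otherwise their infimum is attained by the glued solution.
-/
lemma exists_maximal_solution (C : InfinityChart k P) {c : ℂ} (hc : c ≠ 0) {M : ℝ} {φ₀ : ℂ → ℂ}
    (hφ₀ : ∀ w : ℂ, M < w.im → HasDerivAt φ₀ (c * P.eval (φ₀ w)) w)
    (hne : ∀ w : ℂ, M < w.im → P.eval (φ₀ w) ≠ 0) :
    ∃ (h : ℝ) (φ : ℂ → ℂ), IsHalfPlaneSolution P c M φ₀ h φ ∧ h ≤ M ∧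
      ∀ h' < h, ∀ φ', ¬ IsHalfPlaneSolution P c M φ₀ h' φ' := by
  obtain ⟨φ, hφ⟩ := exists_glued_solution (P := P) (c := c) (M := M) (φ₀ := φ₀)
  set S := {h : ℝ | ∃ φ', IsHalfPlaneSolution P c M φ₀ h φ'} with hS
  have hMS : M ∈ S := ⟨φ₀, hφ₀, fun _ _ => rfl⟩
  have hlarge : ∀ w : ℂ, M < w.im → φ w = φ₀ w := fun w hw => (hφ M φ₀ ⟨hφ₀, fun _ _ => rfl⟩ w hw).1
  have hbdd : BddBelow S := by
    by_contra hb
    have hentire : ∀ t, HasDerivAt φ (c * P.eval (φ t)) t := fun t => by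
      obtain ⟨h, ⟨φ', hh⟩, hlt⟩ := not_bddBelow_iff.1 hb t.im
      exact (hφ h φ' hh t hlt).2
    have h0 := eval_eq_zero_of_entire C hc hentire
    have hconst := eqOn_of_hasDerivAt_complex (P := P) (c := c) convex_univ
      (y₁ := φ) (y₂ := fun _ => φ 0) (fun t _ => hentire t)
      (fun t _ => by simpa [h0] using hasDerivAt_const t (φ 0)) (mem_univ 0) rfl
    have him : M < (((M + 1 : ℝ) : ℂ) * Complex.I).im := by simp
    refine hne _ him ?_
    rw [← hlarge _ him, hconst (mem_univ _), h0]
  refine ⟨sInf S, φ, ⟨fun w hw => ?_, hlarge⟩, csInf_le hbdd hMS, fun h' hh' φ' H =>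
    (csInf_le hbdd ⟨φ', H⟩).not_gt hh'⟩
  obtain ⟨h, ⟨φ', hh⟩, hlt⟩ := exists_lt_of_csInf_lt ⟨M, hMS⟩ hw
  exact (hφ h φ' hh w hlt).2

end HalfPlane

/-! ### Uniformization of a periodic domain by the upper half plane -/

/-- A uniformization of the periodic domain of the equilibrium `a` by the upper half plane, of
period `1`, with its boundary values. -/
structure PeriodicChart (P : Polynomial ℂ) (a : ℂ) where
  φ : ℂ → ℂ
  Φ : ℂ → OnePoint ℂ
  hasDerivAt : ∀ w : ℂ, 0 < w.im → HasDerivAt φ (period P a * P.eval (φ w)) w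
  eval_ne : ∀ w : ℂ, 0 < w.im → P.eval (φ w) ≠ 0
  Φ_eq : ∀ w : ℂ, 0 < w.im → Φ w = φ w
  continuousOn : ContinuousOn Φ {w | 0 ≤ w.im}
  periodic : ∀ w : ℂ, 0 ≤ w.im → Φ (w + 1) = Φ w
  inj : ∀ w w' : ℂ, 0 < w.im → 0 < w'.im → φ w = φ w' → ∃ n : ℤ, w' = w + n
  tendsto : Tendsto φ (comap Complex.im atTop) (𝓝 a)
  isOpen : IsOpen (insert a (φ '' {w | 0 < w.im}))
  extend : ∀ x : ℝ, Φ x ≠ OnePoint.infty → ∃ Y : ℂ → ℂ, ∃ ε > 0,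
    (∀ t ∈ Metric.ball (x : ℂ) ε, HasDerivAt Y (period P a * P.eval (Y t)) t) ∧
      ∀ t ∈ Metric.ball (x : ℂ) ε, 0 ≤ t.im → Φ t = Y t
  exists_infty : ∃ x : ℝ, Φ x = OnePoint.infty

section Construction
variable {k : ℕ} {P : Polynomial ℂ}

lemma isOpen_image_of_hasDerivAt {S : Set ℂ} (hS : IsOpen S) {φ φ' : ℂ → ℂ}
    (h : ∀ w ∈ S, HasDerivAt φ (φ' w) w) (h0 : ∀ w ∈ S, φ' w ≠ 0) : IsOpen (φ '' S) := by
  refine isOpen_iff_mem_nhds.2 ?_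
  rintro _ ⟨w, hw, rfl⟩
  have han : AnalyticAt ℂ φ w := DifferentiableOn.analyticAt
    (fun w hw => (h w hw).differentiableAt.differentiableWithinAt) (hS.mem_nhds hw)
  have hs := han.hasStrictDerivAt
  rw [(h w hw).deriv] at hs
  rw [← hs.map_nhds_eq (h0 w hw)]
  exact image_mem_map (hS.mem_nhds hw)

lemma period_ne_zero {a : ℂ} (hs : P.derivative.eval a ≠ 0) : period P a ≠ 0 :=
  div_ne_zero Complex.two_pi_I_ne_zero hs

lemma closure_upperHalfPlane : closure {w : ℂ | 0 < w.im} = {w : ℂ | 0 ≤ w.im} :=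
  Complex.closure_setOfPred_lt_im 0

lemma nhdsWithin_upperHalfPlane_neBot {w : ℂ} (hw : 0 ≤ w.im) : (𝓝[{w : ℂ | 0 < w.im}] w).NeBot :=
  mem_closure_iff_nhdsWithin_neBot.1 (closure_upperHalfPlane ▸ hw)

/-- Either a solution on the upper half plane extends across a boundary point, or it tends to
`∞` there. -/
lemma extends_or_tendsto (hsimple : ∀ a : ℂ, P.IsRoot a → P.derivative.eval a ≠ 0) {c : ℂ}
    {φ : ℂ → ℂ} (hφ : ∀ w : ℂ, 0 < w.im → HasDerivAt φ (c * P.eval (φ w)) w) (x : ℝ) :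
    (∃ Y : ℂ → ℂ, ∃ ε > 0, (∀ t ∈ Metric.ball (x : ℂ) ε, HasDerivAt Y (c * P.eval (Y t)) t) ∧
      ∀ t ∈ Metric.ball (x : ℂ) ε, 0 < t.im → φ t = Y t) ∨
    Tendsto φ (𝓝[{w | 0 < w.im}] (x : ℂ)) (Bornology.cobounded ℂ) := by
  refine or_iff_not_imp_right.2 fun hnot => ?_
  rw [← tendsto_norm_atTop_iff_cobounded, tendsto_atTop] at hnot
  push Not at hnot
  obtain ⟨M, hM⟩ := hnot
  obtain ⟨ε, hε, hflow⟩ := exists_uniform_flow hsimple c M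
  -- If `φ` does not tend to `∞`, some point within `ε / 2` of `x` has a value of norm below `M`.
  -- The flow disc of radius `ε` around it covers the disc of radius `ε / 2` around `x`.
  obtain ⟨t₁, ht₁, ht₁H, ht₁x⟩ := (hM.and_eventually (inter_mem self_mem_nhdsWithin
    (mem_nhdsWithin_of_mem_nhds (Metric.ball_mem_nhds (x : ℂ) (half_pos hε))))).exists
  obtain ⟨y, hy0, hy⟩ := hflow (φ t₁) ht₁.le
  have hY : ∀ t ∈ Metric.ball t₁ ε,
      HasDerivAt (fun t => y (t - t₁)) (c * P.eval (y (t - t₁))) t := fun t ht =>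
    (hy (t - t₁) (by simpa [dist_eq_norm] using ht)).comp_sub_const t t₁
  have hsub : Metric.ball (x : ℂ) (ε / 2) ⊆ Metric.ball t₁ ε := by
    refine Metric.ball_subset_ball' ?_
    rw [dist_comm]
    linarith [Metric.mem_ball.1 ht₁x]
  refine ⟨fun t => y (t - t₁), ε / 2, half_pos hε, fun t ht => hY t (hsub ht), fun t ht htH => ?_⟩
  exact eqOn_of_hasDerivAt_complex (P := P) (c := c)
    ((convex_ball t₁ ε).inter (convex_im_gt 0)) (fun s hs => hφ s hs.2) (fun s hs => hY s hs.1)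
    (t₀ := t₁) ⟨Metric.mem_ball_self hε, ht₁H⟩ (by simp [hy0]) ⟨hsub ht, htH⟩

/-- A bounded solution on the upper half plane extends to a larger half plane. -/
lemma exists_extension_of_bounded (hsimple : ∀ a : ℂ, P.IsRoot a → P.derivative.eval a ≠ 0) {c : ℂ}
    {φ : ℂ → ℂ} (hφ : ∀ w : ℂ, 0 < w.im → HasDerivAt φ (c * P.eval (φ w)) w) {B : ℝ}
    (hB : ∀ w : ℂ, 0 < w.im → ‖φ w‖ ≤ B) : ∃ δ > 0, ∃ φ' : ℂ → ℂ,
      (∀ w : ℂ, -δ < w.im → HasDerivAt φ' (c * P.eval (φ' w)) w) ∧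
        ∀ w : ℂ, 0 < w.im → φ' w = φ w := by
  obtain ⟨ε, hε, hflow⟩ := exists_uniform_flow hsimple c B
  choose! y hy0 hy using hflow
  -- The extension at `w` flows back by `-d` from `φ (w + d)`. The length `3ε/4` is less than the
  -- lifetime `ε` and more than `ε/2`, so `w + d` is in the upper half plane as soon as `Im w >
  -- -ε/2`.
  set d : ℂ := ((3 * ε / 4 : ℝ) : ℂ) * Complex.I with hd
  have hdim : d.im = 3 * ε / 4 := by simp [hd]
  have hdn : ‖d‖ < ε := by
    rw [hd, norm_mul, Complex.norm_I, mul_one, Complex.norm_real, Real.norm_eq_abs,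
      abs_of_pos (by linarith)]
    linarith
  have hloc : ∀ t₁ : ℂ, 0 < t₁.im → ∀ t ∈ Metric.ball t₁ ε,
      HasDerivAt (fun t => y (φ t₁) (t - t₁)) (c * P.eval (y (φ t₁) (t - t₁))) t := fun t₁ h t ht =>
    (hy _ (hB t₁ h) (t - t₁) (by simpa [dist_eq_norm] using ht)).comp_sub_const t t₁
  have hagree : ∀ t₁ : ℂ, 0 < t₁.im → ∀ t ∈ Metric.ball t₁ ε, 0 < t.im →
      y (φ t₁) (t - t₁) = φ t := fun t₁ h t ht hH =>
    eqOn_of_hasDerivAt_complex (P := P) (c := c) ((convex_ball t₁ ε).inter (convex_im_gt 0))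
      (fun s hs => hloc t₁ h s hs.1) (fun s hs => hφ s hs.2)
      (t₀ := t₁) ⟨Metric.mem_ball_self hε, h⟩ (by simp [hy0 _ (hB t₁ h)]) ⟨ht, hH⟩
  have hmem : ∀ w : ℂ, w ∈ Metric.ball (w + d) ε := fun w => by
    simpa [dist_eq_norm] using hdn
  refine ⟨ε / 2, half_pos hε, fun w => y (φ (w + d)) (w - (w + d)), fun w hw => ?_, fun w hw => ?_⟩
  · have hwd : 0 < (w + d).im := by rw [Complex.add_im, hdim]; linarith
    refine (hloc (w + d) hwd w (hmem w)).congr_of_eventuallyEq ?_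
    have h1 : ∀ᶠ s in 𝓝 w, s + d ∈ Metric.ball (w + d) ε ∧ s ∈ Metric.ball (w + d) ε ∧
        0 < (s + d).im := by
      have hc : ContinuousAt (fun s => s + d) w := by fun_prop
      refine (hc.eventually_mem (Metric.ball_mem_nhds _ hε)).and
        ((Metric.isOpen_ball.eventually_mem (hmem w)).and ?_)
      exact hc.eventually_mem ((isOpen_im_gt 0).mem_nhds hwd)
    filter_upwards [h1] with s hs
    refine eqOn_of_hasDerivAt_complex (P := P) (c := c) ((convex_ball (s + d) ε).inter
      (convex_ball (w + d) ε)) (y₁ := fun t => y (φ (s + d)) (t - (s + d)))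
      (y₂ := fun t => y (φ (w + d)) (t - (w + d))) (fun t ht => hloc (s + d) hs.2.2 t ht.1)
      (fun t ht => hloc (w + d) hwd t ht.2) (t₀ := s + d) ⟨Metric.mem_ball_self hε, hs.1⟩ ?_
      ⟨hmem s, hs.2.1⟩
    rw [hagree (w + d) hwd _ hs.1 hs.2.2, sub_self, hy0 _ (hB _ hs.2.2)]
  · have hwd : 0 < (w + d).im := by rw [Complex.add_im, hdim]; linarith
    exact hagree (w + d) hwd w (hmem w) hw

lemma norm_exp_two_pi_I (w : ℂ) :
    ‖Complex.exp (2 * Real.pi * Complex.I * w)‖ = Real.exp (-(2 * Real.pi * w.im)) := by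
  rw [Complex.norm_exp]
  congr 1
  simp [Complex.mul_re, Complex.mul_im]

/-- Because `ν P'(a) = 2πi`, the linear solution `exp (2πi w)` becomes a solution of period one near
`i∞` after composition with the inverse linearization `ψ`. The chart is its maximal half-plane
continuation, shifted to `Im w > 0`; periodicity and injectivity modulo `ℤ` descend from `i∞` by
uniqueness of solutions. -/
theorem exists_periodicChart (C : InfinityChart k P)
    (hsimple : ∀ a : ℂ, P.IsRoot a → P.derivative.eval a ≠ 0) {a : ℂ} (ha : P.IsRoot a) :
    Nonempty (PeriodicChart P a) := by
  set ν := period P a with hν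
  have hν0 : ν ≠ 0 := period_ne_zero (hsimple a ha)
  obtain ⟨ψ, R, hR, hψ0, hψinj, hψc, hψ, hψo⟩ := exists_linearization ha (hsimple a ha)
  set E : ℂ → ℂ := fun w => Complex.exp (2 * Real.pi * Complex.I * w) with hE
  have hE0 : ∀ w, E w ≠ 0 := fun w => Complex.exp_ne_zero _
  have hEn : ∀ w, ‖E w‖ = Real.exp (-(2 * Real.pi * w.im)) := norm_exp_two_pi_I
  have hpi := Real.pi_pos
  -- As the norm of `E w` is `exp (-2π Im w)`, the height `M` is where it equals `R`.
  set M : ℝ := -Real.log R / (2 * Real.pi) with hM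
  have hEM : ∀ w : ℂ, M < w.im → E w ∈ Metric.ball (0 : ℂ) R := fun w hw => by
    rw [mem_ball_zero_iff, hEn, ← Real.lt_log_iff_exp_lt hR]
    rw [hM, div_lt_iff₀ (by positivity)] at hw
    linarith
  have hEd : ∀ w, HasDerivAt E (E w * (2 * Real.pi * Complex.I)) w := fun w => by
    have := ((hasDerivAt_id w).const_mul (2 * Real.pi * Complex.I : ℂ)).cexp
    exact this.congr_deriv (by simp [hE])
  have hφ₀ : ∀ w : ℂ, M < w.im → HasDerivAt (fun w => ψ (E w)) (ν * P.eval (ψ (E w))) w :=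
    fun w hw => ((hψ _ (hEM w hw) (hE0 w)).comp_of_eq w (hEd w) rfl).congr_deriv (by
      have h1 := hE0 w
      have h2 := hsimple a ha
      rw [hν, period]
      field_simp)
  have hE1 : ∀ w, E (w + 1) = E w := fun w => by
    simp only [hE]
    rw [mul_add, mul_one, Complex.exp_add, Complex.exp_two_pi_mul_I, mul_one]
  have hEinj : ∀ w w', E w = E w' → ∃ n : ℤ, w' = w + n := fun w w' h => by
    obtain ⟨n, hn⟩ := Complex.exp_eq_exp_iff_exists_int.1 h.symm
    refine ⟨n, ?_⟩
    have h2 : (2 * Real.pi * Complex.I : ℂ) ≠ 0 := Complex.two_pi_I_ne_zero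
    have : (2 * Real.pi * Complex.I : ℂ) * w' = 2 * Real.pi * Complex.I * (w + n) := by
      rw [hn]; ring
    exact mul_left_cancel₀ h2 this
  have hφ₀ne : ∀ w : ℂ, M < w.im → P.eval (ψ (E w)) ≠ 0 := fun w hw h0 => by
    have hconst := eqOn_of_hasDerivAt_complex (P := P) (c := ν) (convex_im_gt M)
      (y₁ := fun w => ψ (E w)) (y₂ := fun _ => ψ (E w)) hφ₀
      (fun t _ => by simpa [h0] using hasDerivAt_const t (ψ (E w))) hw rfl
    have hw' : M < (w + Complex.I).im := by simp; linarith
    have h1 := hψinj (hEM _ hw') (hEM _ hw) (hconst hw')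
    obtain ⟨n, hn⟩ := hEinj _ _ h1
    have := congrArg Complex.im hn
    simp at this
  obtain ⟨h, φ, ⟨hφd, hφe⟩, hhM, hmax⟩ := exists_maximal_solution C hν0 hφ₀ hφ₀ne
  -- shift the half plane
  set f : ℂ → ℂ := fun w => φ (w + h * Complex.I) with hf
  have him : ∀ w : ℂ, (w + h * Complex.I).im = w.im + h := fun w => by simp
  have hfd : ∀ w : ℂ, 0 < w.im → HasDerivAt f (ν * P.eval (f w)) w := fun w hw =>
    (hφd _ (by rw [him]; linarith)).comp_add_const w (h * Complex.I)
  have hfe : ∀ w : ℂ, M - h < w.im → f w = ψ (E (w + h * Complex.I)) := fun w hw =>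
    hφe _ (by rw [him]; linarith)
  have hMh : 0 ≤ M - h := by linarith
  have hf1 : ∀ w : ℂ, 0 < w.im → f (w + 1) = f w := fun w hw => by
    set t : ℂ := ((M - h + 1 : ℝ) : ℂ) * Complex.I
    have ht : t.im = M - h + 1 := by simp [t]
    refine eqOn_of_hasDerivAt_complex (P := P) (c := ν) (convex_im_gt 0)
      (y₁ := fun w => f (w + 1)) (y₂ := f)
      (fun s hs => (hfd (s + 1) (by simpa using hs)).comp_add_const s 1) hfd (t₀ := t)
      (show 0 < t.im by rw [ht]; linarith) ?_ hw
    show f (t + 1) = f t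
    rw [hfe t (by rw [ht]; linarith), hfe (t + 1) (by simp [ht]), ← hE1 (t + h * Complex.I)]
    congr 2; ring
  -- Equal values at `w` and `w'` give equal translated solutions. Carried up to heights where `f`
  -- is `ψ ∘ E`, they reduce the question to the injectivity of `ψ` and that of `E` modulo `ℤ`.
  have hfinj : ∀ w w' : ℂ, 0 < w.im → 0 < w'.im → f w = f w' → ∃ n : ℤ, w' = w + n :=
    fun w w' hw hw' heq => by
      set t : ℂ := ((M - h + 1 : ℝ) : ℂ) * Complex.I
      have ht : t.im = M - h + 1 := by simp [t]
      have hS : Convex ℝ {s : ℂ | -(min w.im w'.im) < s.im} := convex_halfSpace_im_gt _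
      have hm : 0 < min w.im w'.im := lt_min hw hw'
      have key := eqOn_of_hasDerivAt_complex (P := P) (c := ν) hS
        (y₁ := fun s => f (s + w)) (y₂ := fun s => f (s + w'))
        (fun s hs => (hfd (s + w) (by
          have hs : -(min w.im w'.im) < s.im := hs
          rw [Complex.add_im]; linarith [min_le_left w.im w'.im])).comp_add_const s w)
        (fun s hs => (hfd (s + w') (by
          have hs : -(min w.im w'.im) < s.im := hs
          rw [Complex.add_im]; linarith [min_le_right w.im w'.im])).comp_add_const s w')
        (t₀ := 0) (show -(min w.im w'.im) < (0 : ℂ).im by simpa using hm) (by simpa using heq)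
        (show -(min w.im w'.im) < t.im by rw [ht]; linarith)
      have h1 : M - h < (t + w).im := by rw [Complex.add_im, ht]; linarith
      have h2 : M - h < (t + w').im := by rw [Complex.add_im, ht]; linarith
      simp only [hfe _ h1, hfe _ h2] at key
      obtain ⟨n, hn⟩ := hEinj _ _ (hψinj (hEM _ (by rw [him]; linarith))
        (hEM _ (by rw [him]; linarith)) key)
      exact ⟨n, by linear_combination hn⟩
  have hfne : ∀ w : ℂ, 0 < w.im → P.eval (f w) ≠ 0 := fun w hw h0 => by
    have hconst := eqOn_of_hasDerivAt_complex (P := P) (c := ν) (convex_im_gt 0)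
      (y₁ := f) (y₂ := fun _ => f w) hfd
      (fun t _ => by simpa [h0] using hasDerivAt_const t (f w)) hw rfl
    have hw' : 0 < (w + Complex.I).im := by simp; linarith
    obtain ⟨n, hn⟩ := hfinj _ _ hw' hw (hconst hw')
    have := congrArg Complex.im hn
    simp at this
  have htends : Tendsto f (comap Complex.im atTop) (𝓝 a) := by
    have h1 : Tendsto (fun w : ℂ => E (w + h * Complex.I)) (comap Complex.im atTop) (𝓝 0) := by
      rw [tendsto_zero_iff_norm_tendsto_zero]
      have h2 : Tendsto (fun w : ℂ => -(2 * Real.pi * (w.im + h))) (comap Complex.im atTop) atBot := by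
        refine tendsto_neg_atTop_atBot.comp (Tendsto.const_mul_atTop (by positivity) ?_)
        exact tendsto_atTop_add_const_right _ _ tendsto_comap
      refine (Real.tendsto_exp_atBot.comp h2).congr fun w => ?_
      rw [hEn, him]; rfl
    have h3 : ContinuousAt ψ 0 := hψc.continuousAt (Metric.ball_mem_nhds 0 hR)
    have h4 := h3.tendsto.comp h1
    rw [hψ0] at h4
    refine h4.congr' ?_
    filter_upwards [preimage_mem_comap (Ioi_mem_atTop (M - h))] with w hw
    exact (hfe w hw).symm
  -- Near `a` the set is the `ψ`-image of a full disc, as every nonzero `q` there is a value of `E`;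
  -- its radius `exp (-2πM)` is `R`.
  have hopen : IsOpen (insert a (f '' {w | 0 < w.im})) := by
    have h1 : insert a (f '' {w | 0 < w.im}) =
        ψ '' Metric.ball 0 (Real.exp (-(2 * Real.pi * M))) ∪ f '' {w | 0 < w.im} := by
      refine Subset.antisymm (insert_subset (Or.inl ⟨0, Metric.mem_ball_self (Real.exp_pos _), hψ0⟩)
        subset_union_right) (union_subset ?_ (subset_insert _ _))
      rintro _ ⟨q, hq, rfl⟩
      rcases eq_or_ne q 0 with rfl | hq0
      · rw [hψ0]; exact mem_insert _ _
      refine Or.inr ?_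
      set w : ℂ := Complex.log q / (2 * Real.pi * Complex.I) with hw
      have hEw : E w = q := by
        simp only [hE, hw]
        rw [mul_div_cancel₀ _ Complex.two_pi_I_ne_zero, Complex.exp_log hq0]
      have hwM : M < w.im := by
        rw [mem_ball_zero_iff, ← hEw, hEn, Real.exp_lt_exp] at hq
        nlinarith
      refine ⟨w - h * Complex.I, ?_, ?_⟩
      · show 0 < (w - h * Complex.I).im
        simp; linarith
      · rw [hfe _ (by simp; linarith), sub_add_cancel, hEw]
    rw [h1]
    refine (hψo _ ?_).union (isOpen_image_of_hasDerivAt (isOpen_im_gt 0) hfd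
      fun w hw => mul_ne_zero hν0 (hfne w hw))
    rw [hM, mul_div_cancel₀ _ (by positivity), neg_neg, Real.exp_log hR]
  have hdich := extends_or_tendsto hsimple hfd
  -- boundary values
  set H : Set ℂ := {w | 0 < w.im} with hH
  have hlim : ∀ w ∈ {w : ℂ | 0 ≤ w.im}, ∃ y : OnePoint ℂ,
      Tendsto (fun w => (f w : OnePoint ℂ)) (𝓝[H] w) (𝓝 y) := fun w hw => by
    rcases (show 0 ≤ w.im from hw).lt_or_eq with hpos | hzero
    · exact ⟨f w, (tendsto_coe_coe_iff.2 (hfd w hpos).continuousAt.tendsto).mono_left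
        nhdsWithin_le_nhds⟩
    · have hwr : w = (w.re : ℂ) := Complex.ext rfl (by simp [← hzero])
      rw [hwr]
      rcases hdich w.re with ⟨Y, ε, hε, hY, hfY⟩ | hinf
      · refine ⟨Y w.re, tendsto_coe_coe_iff.2 ?_⟩
        refine ((hY _ (Metric.mem_ball_self hε)).continuousAt.tendsto.mono_left
          nhdsWithin_le_nhds).congr' ?_
        filter_upwards [self_mem_nhdsWithin, mem_nhdsWithin_of_mem_nhds (Metric.ball_mem_nhds _ hε)]
          with t ht1 ht2
        exact (hfY t ht2 ht1).symm
      · exact ⟨OnePoint.infty, tendsto_coe_infty_iff.2 hinf⟩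
  set Φ : ℂ → OnePoint ℂ := extendFrom H (fun w => (f w : OnePoint ℂ)) with hΦ
  have hcl : {w : ℂ | 0 ≤ w.im} ⊆ closure H := closure_upperHalfPlane.ge
  have hΦlim : ∀ w : ℂ, 0 ≤ w.im → Tendsto (fun w => (f w : OnePoint ℂ)) (𝓝[H] w) (𝓝 (Φ w)) :=
    fun w hw => tendsto_extendFrom (hlim w hw)
  have hΦeq : ∀ w : ℂ, 0 < w.im → Φ w = f w := fun w hw => extendFrom_eq (hcl hw.le)
    ((tendsto_coe_coe_iff.2 (hfd w hw).continuousAt.tendsto).mono_left nhdsWithin_le_nhds)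
  have hshift : ∀ w : ℂ, Tendsto (fun w => w + 1) (𝓝[H] w) (𝓝[H] (w + 1)) := fun w => by
    refine tendsto_nhdsWithin_iff.2 ⟨?_, ?_⟩
    · have : ContinuousAt (fun w : ℂ => w + 1) w := by fun_prop
      exact this.tendsto.mono_left nhdsWithin_le_nhds
    · filter_upwards [self_mem_nhdsWithin] with t ht
      simpa [hH] using ht
  refine ⟨⟨f, Φ, hfd, hfne, hΦeq, continuousOn_extendFrom hcl hlim, fun w hw => ?_, hfinj, htends,
    hopen, fun x hx => ?_, ?_⟩⟩
  · have h1 : Tendsto (fun w => (f (w + 1) : OnePoint ℂ)) (𝓝[H] w) (𝓝 (Φ (w + 1))) :=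
      (hΦlim (w + 1) (by simpa using hw)).comp (hshift w)
    have h2 := hΦlim w hw
    have := nhdsWithin_upperHalfPlane_neBot hw
    refine tendsto_nhds_unique h1 (h2.congr' ?_)
    filter_upwards [self_mem_nhdsWithin] with t ht
    rw [hf1 t ht]
  · rcases hdich x with ⟨Y, ε, hε, hY, hfY⟩ | hinf
    · refine ⟨Y, ε, hε, hY, fun t ht htH => ?_⟩
      refine extendFrom_eq (hcl htH) (tendsto_coe_coe_iff.2 ?_)
      refine ((hY t ht).continuousAt.tendsto.mono_left nhdsWithin_le_nhds).congr' ?_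
      filter_upwards [self_mem_nhdsWithin, mem_nhdsWithin_of_mem_nhds (Metric.isOpen_ball.mem_nhds ht)]
        with s hs1 hs2
      exact (hfY s hs2 hs1).symm
    · exact absurd (extendFrom_eq (hcl (by simp)) (tendsto_coe_infty_iff.2 hinf)) hx
  · by_contra hno
    push Not at hno
    -- then the solution is bounded
    obtain ⟨M', hM'⟩ : ∃ M' : ℝ, ∀ w : ℂ, M' ≤ w.im → ‖f w‖ ≤ ‖a‖ + 1 := by
      have := htends.norm.eventually_le_const (u := ‖a‖ + 1) (by linarith)
      rw [eventually_comap] at this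
      obtain ⟨M', hM'⟩ := eventually_atTop.1 this
      exact ⟨M', fun w hw => hM' w.im hw w rfl⟩
    have hK : IsCompact (Icc (0 : ℝ) 1 ×ℂ Icc (0 : ℝ) M') := isCompact_Icc.reProdIm isCompact_Icc
    have hKb : ∃ B : ℝ, ∀ w ∈ Icc (0 : ℝ) 1 ×ℂ Icc (0 : ℝ) M', 0 < w.im → ‖f w‖ ≤ B := by
      refine hK.induction_on (p := fun S => ∃ B : ℝ, ∀ w ∈ S, 0 < w.im → ‖f w‖ ≤ B)
        ⟨0, by simp⟩ (fun S T hST ⟨B, hB⟩ => ⟨B, fun w hw => hB w (hST hw)⟩)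
        (fun S T ⟨B, hB⟩ ⟨B', hB'⟩ => ⟨max B B', fun w hw hp => ?_⟩) (fun w hw => ?_)
      · rcases hw with hw | hw
        · exact (hB w hw hp).trans (le_max_left _ _)
        · exact (hB' w hw hp).trans (le_max_right _ _)
      · have hw0 : 0 ≤ w.im := hw.2.1
        have hfin : Φ w ≠ OnePoint.infty := by
          rcases hw0.lt_or_eq with hpos | hzero
          · rw [hΦeq w hpos]; exact OnePoint.coe_ne_infty _
          · have hwr : w = (w.re : ℂ) := Complex.ext rfl (by simp [← hzero])
            rw [hwr]; exact hno _
        obtain ⟨z, hz⟩ := OnePoint.ne_infty_iff_exists.1 hfin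
        have h1 := hΦlim w hw0
        rw [← hz, tendsto_coe_coe_iff] at h1
        have h2 := h1.norm.eventually_le_const (u := ‖z‖ + 1) (by linarith)
        rw [eventually_nhdsWithin_iff] at h2
        exact ⟨_, mem_nhdsWithin_of_mem_nhds h2, ‖z‖ + 1, fun s hs hp => hs hp⟩
    obtain ⟨B, hB⟩ := hKb
    have hfn : ∀ (n : ℤ) (w : ℂ), 0 < w.im → f (w + n) = f w := fun n => by
      induction n using Int.induction_on with
      | zero => simp
      | succ n ih =>
        intro w hw
        rw [← ih w hw, ← hf1 (w + (n : ℤ)) (by simpa using hw)]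
        congr 1; push_cast; ring
      | pred n ih =>
        intro w hw
        rw [← ih w hw, ← hf1 _ (by simpa using hw)]
        congr 1; push_cast; ring
    have hball : ∀ w : ℂ, 0 < w.im → ‖f w‖ ≤ max B (‖a‖ + 1) := fun w hw => by
      rcases le_total M' w.im with h1 | h1
      · exact (hM' w h1).trans (le_max_right _ _)
      · rw [← hfn (-⌊w.re⌋) w hw]
        refine (hB _ ⟨⟨?_, ?_⟩, ?_, ?_⟩ ?_).trans (le_max_left _ _)
        · simpa using Int.floor_le w.re
        · simpa using (by linarith [Int.lt_floor_add_one w.re] : w.re ≤ 1 + (⌊w.re⌋ : ℝ))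
        · simpa using hw.le
        · simpa using h1
        · simpa using hw
    -- A bounded solution would extend below the height `h`, against maximality.
    obtain ⟨δ, hδ, φ', hφ', hφ'e⟩ := exists_extension_of_bounded hsimple hfd hball
    refine hmax (h - δ) (by linarith) (fun w => φ' (w - h * Complex.I)) ⟨fun w hw => ?_,
      fun w hw => ?_⟩
    · exact (hφ' _ (by simp; linarith)).comp_sub_const w (h * Complex.I)
    · have hw' : (w - h * Complex.I).im = w.im - h := by simp
      show φ' (w - h * Complex.I) = ψ (E w)
      rw [hφ'e _ (by rw [hw']; linarith), hfe _ (by rw [hw']; linarith), sub_add_cancel]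

end Construction

/-! ### Trajectories escaping to infinity -/

section Trajectories
variable {P : Polynomial ℂ}

/-- A trajectory that escapes to `∞` outlives every other trajectory from the same point. -/
lemma lifetime_le_of_escape {c : ℂ} {γ y : ℝ → ℂ} {T T₁ : ℝ} (hT : 0 < T)
    (hγ : ∀ s ∈ Ico (0 : ℝ) T, HasDerivAt γ (c * P.eval (γ s)) s)
    (hinf : Tendsto γ (𝓝[<] T) (Bornology.cobounded ℂ))
    (hy : ∀ s ∈ Ico (0 : ℝ) T₁, HasDerivAt y (c * P.eval (y s)) s) (h0 : γ 0 = y 0) :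
    T₁ ≤ T ∧ EqOn γ y (Ico 0 T₁) := by
  have key : ∀ s, 0 ≤ s → s < T → s < T₁ → γ s = y s := fun s h1 h2 h3 =>
    eqOn_of_hasDerivAt_real (P := P) (c := c) (T := s)
      (fun u hu => hγ u ⟨hu.1, hu.2.trans_lt h2⟩) (fun u hu => hy u ⟨hu.1, hu.2.trans_lt h3⟩) h0
      ⟨h1, le_rfl⟩
  have hle : T₁ ≤ T := by
    by_contra hlt
    push Not at hlt
    have hc : Tendsto y (𝓝[<] T) (𝓝 (y T)) :=
      (hy T ⟨hT.le, hlt⟩).continuousAt.tendsto.mono_left nhdsWithin_le_nhds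
    have hc' : Tendsto γ (𝓝[<] T) (𝓝 (y T)) := by
      refine hc.congr' ?_
      filter_upwards [Ioo_mem_nhdsLT hT] with s hs
      exact (key s hs.1.le hs.2 (hs.2.trans hlt)).symm
    exact hc'.not_tendsto (Metric.disjoint_nhds_cobounded (y T)) hinf
  exact ⟨hle, fun s hs => key s hs.1 (hs.2.trans_le hle) hs.2⟩

/-- By `lifetime_le_of_escape` the escape time would exceed the length of every initial piece of the
global trajectory. -/
lemma not_escapesForward {c : ℂ} {y : ℝ → ℂ}
    (hy : ∀ s : ℝ, 0 ≤ s → HasDerivAt y (c * P.eval (y s)) s) :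
    ¬ EscapesForward (fun z => c * P.eval z) (y 0) := by
  rintro ⟨T, hT, γ, h0, hγ, hinf⟩
  have := (lifetime_le_of_escape (T₁ := T + 1) hT hγ hinf (fun s hs => hy s hs.1) h0).1
  linarith

lemma not_onSeparatrix_of_isRoot {c z : ℂ} (hz : P.IsRoot z) :
    ¬ OnSeparatrix (fun z => c * P.eval z) z := by
  have hz : P.eval z = 0 := hz
  rintro (h | h)
  · exact not_escapesForward (P := P) (c := c) (y := fun _ => z)
      (fun s _ => by simpa [hz] using hasDerivAt_const s z) h
  · refine not_escapesForward (P := P) (c := -c) (y := fun _ => z)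
      (fun s _ => by simpa [hz] using hasDerivAt_const s z) ?_
    simpa using h

lemma hasDerivAt_line (w d : ℂ) (s : ℝ) : HasDerivAt (fun s : ℝ => w + s * d) d s := by
  have := ((Complex.ofRealCLM.hasDerivAt (x := s)).mul_const d).const_add w
  exact this.congr_deriv (by simp)

lemma rotatedField_eq (β : ℝ) :
    rotatedField P β = fun z => Complex.exp (β * Complex.I) * P.eval z := rfl

/-- In the chart the field `e^{i arg ν} P` therefore moves to the right with speed `1 / ‖ν‖`. -/
lemma exp_arg_mul_I {ν : ℂ} (hν : ν ≠ 0) :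
    Complex.exp (ν.arg * Complex.I) = ((‖ν‖⁻¹ : ℝ) : ℂ) * ν := by
  have h := Complex.norm_mul_exp_arg_mul_I ν
  have h0 : (‖ν‖ : ℂ) ≠ 0 := by exact_mod_cast norm_ne_zero_iff.2 hν
  rw [Complex.ofReal_inv]
  field_simp
  linear_combination h

/-- In the chart the field that defines the cuts therefore moves straight down with speed `1 / ‖ν‖`.
-/
lemma exp_arg_sub_mul_I {ν : ℂ} (hν : ν ≠ 0) :
    Complex.exp (((ν.arg - Real.pi / 2 : ℝ) : ℂ) * Complex.I) =
      (-((‖ν‖⁻¹ : ℝ) : ℂ) * Complex.I) * ν := by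
  rw [Complex.ofReal_sub, sub_mul, Complex.exp_sub, exp_arg_mul_I hν]
  have : Complex.exp (((Real.pi / 2 : ℝ) : ℂ) * Complex.I) = Complex.I := by
    rw [Complex.ofReal_div, Complex.ofReal_ofNat]; exact Complex.exp_pi_div_two_mul_I
  rw [this, Complex.div_I]
  ring

end Trajectories

/-! ### Periodic domains and cuts in the chart -/

namespace PeriodicChart
variable {P : Polynomial ℂ} {a : ℂ} (K : PeriodicChart P a)

/-- The image of the upper half plane. -/
def image : Set ℂ := K.φ '' {w | 0 < w.im}

/-- The uniformized domain. -/
def domain : Set ℂ := insert a K.image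

lemma periodic_int (n : ℤ) : ∀ w : ℂ, 0 ≤ w.im → K.Φ (w + n) = K.Φ w := by
  induction n using Int.induction_on with
  | zero => simp
  | succ n ih =>
    intro w hw
    rw [← ih w hw, ← K.periodic (w + (n : ℤ)) (by simpa using hw)]
    congr 1; push_cast; ring
  | pred n ih =>
    intro w hw
    rw [← ih w hw, ← K.periodic _ (by simpa using hw)]
    congr 1; push_cast; ring

lemma φ_add_int (n : ℤ) {w : ℂ} (hw : 0 < w.im) : K.φ (w + n) = K.φ w := by
  have h := K.periodic_int n w hw.le
  rw [K.Φ_eq w hw, K.Φ_eq _ (by simpa using hw)] at h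
  exact OnePoint.coe_injective h

/-- The finite values of the boundary function. -/
noncomputable def fin (w : ℂ) : ℂ := (K.Φ w).elim 0 id

lemma coe_fin {w : ℂ} (h : K.Φ w ≠ OnePoint.infty) : (K.fin w : OnePoint ℂ) = K.Φ w := by
  obtain ⟨z, hz⟩ := OnePoint.ne_infty_iff_exists.1 h
  rw [fin, ← hz]; rfl

lemma hasDerivAt_trajectory {w d c : ℂ} {s : ℝ} (h : 0 < (w + s * d).im)
    (hc : d * period P a = c) :
    HasDerivAt (fun s : ℝ => K.φ (w + s * d)) (c * P.eval (K.φ (w + s * d))) s := by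
  refine ((K.hasDerivAt _ h).comp_of_eq s (hasDerivAt_line w d s) rfl).congr_deriv ?_
  rw [← hc]; ring

lemma continuousOn_line {w d : ℂ} {S : Set ℝ} (h : ∀ s ∈ S, 0 ≤ (w + s * d).im) :
    ContinuousOn (fun s : ℝ => K.Φ (w + s * d)) S :=
  K.continuousOn.comp (fun s _ => (hasDerivAt_line w d s).continuousAt.continuousWithinAt) h

variable (hs : P.derivative.eval a ≠ 0)
include hs

/-- The trajectory through `φ w` follows a horizontal line inside the half plane, where `φ` is
defined for all positive and negative times. -/
lemma notMem_separatrixGraph {w : ℂ} (hw : 0 < w.im) :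
    K.φ w ∉ separatrixGraph (rotatedField P (period P a).arg) := by
  have hν := period_ne_zero hs
  have him : ∀ (s r : ℝ), (w + s * (r : ℂ)).im = w.im := fun s r => by simp
  have key : ∀ r : ℝ, ¬ EscapesForward (fun z => (r * period P a) * P.eval z) (K.φ w) := fun r => by
    have := not_escapesForward (P := P) (c := r * period P a) (y := fun s => K.φ (w + s * (r : ℂ)))
      (fun s _ => K.hasDerivAt_trajectory (by rw [him]; exact hw) rfl)
    simpa using this
  rw [rotatedField_eq, exp_arg_mul_I hν]
  rintro (h | h | h)
  · exact (mul_ne_zero (mul_ne_zero (by exact_mod_cast inv_ne_zero (norm_ne_zero_iff.2 hν)) hν)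
      (K.eval_ne w hw)) h
  · exact key _ h
  · refine key (-‖(period P a)‖⁻¹) ?_
    simpa using h

/-- The real line is a trajectory between blow-up points. These form a closed set invariant under
integer translation, so there is a first one `b` to the right of `x`, and it is reached after the
time `(b - x) ‖ν‖`. -/
lemma onSeparatrix_of_boundary {x : ℝ} {z : ℂ} (hx : K.Φ x = z) :
    OnSeparatrix (rotatedField P (period P a).arg) z := by
  have hν := period_ne_zero hs
  have hn : 0 < ‖period P a‖ := norm_pos_iff.2 hν
  -- the first blow-up to the right of `x`
  have hcont : ContinuousOn (fun s : ℝ => K.Φ (0 + s * 1)) univ :=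
    K.continuousOn_line fun s _ => by simp
  simp only [zero_add, mul_one] at hcont
  have hclosed : IsClosed {s : ℝ | K.Φ s = OnePoint.infty} :=
    OnePoint.isClosed_infty.preimage (continuousOn_univ.1 hcont)
  obtain ⟨x₀, hx₀⟩ := K.exists_infty
  have hxn : ∀ n : ℤ, K.Φ ((x₀ + n : ℝ) : ℂ) = OnePoint.infty := fun n => by
    rw [← hx₀, ← K.periodic_int n x₀ (by simp)]; push_cast; rfl
  set S : Set ℝ := {s : ℝ | K.Φ s = OnePoint.infty} ∩ Ici x with hS
  have hSne : S.Nonempty := ⟨x₀ + ⌈x - x₀⌉, hxn _, by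
    have := Int.le_ceil (x - x₀); show x ≤ _; linarith⟩
  have hSbdd : BddBelow S := ⟨x, fun s hs => hs.2⟩
  have hb := (hclosed.inter isClosed_Ici).csInf_mem hSne hSbdd
  set b := sInf S with hbdef
  have hxb : x < b := lt_of_le_of_ne hb.2 fun h => by
    have h1 : K.Φ (b : ℂ) = OnePoint.infty := hb.1
    rw [← h, hx] at h1; exact OnePoint.coe_ne_infty _ h1
  have hfin : ∀ s : ℝ, x ≤ s → s < b → K.Φ s ≠ OnePoint.infty := fun s h1 h2 h3 =>
    (csInf_le hSbdd ⟨h3, h1⟩).not_gt h2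
  have hlt : ∀ s ∈ Ico (0 : ℝ) ((b - x) * ‖period P a‖), x ≤ x + s * ‖period P a‖⁻¹ ∧
      x + s * ‖period P a‖⁻¹ < b := fun s hs => by
    constructor
    · have := mul_nonneg hs.1 (inv_nonneg.2 hn.le); linarith
    · have := (mul_inv_lt_iff₀ hn).2 hs.2; linarith
  left
  rw [rotatedField_eq, exp_arg_mul_I hν]
  refine ⟨(b - x) * ‖period P a‖, mul_pos (sub_pos.2 hxb) hn,
    fun s => K.fin ((x + s * ‖period P a‖⁻¹ : ℝ) : ℂ), ?_, fun s hs => ?_, ?_⟩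
  · simp [fin, hx]
  · obtain ⟨h1, h2⟩ := hlt s hs
    obtain ⟨Y, ε, hε, hY, hYΦ⟩ := K.extend _ (hfin _ h1 h2)
    have hYd := hY _ (Metric.mem_ball_self hε)
    have hfinY : ∀ u : ℝ, (u : ℂ) ∈ Metric.ball ((x + s * ‖period P a‖⁻¹ : ℝ) : ℂ) ε →
        K.fin u = Y u := fun u hu => by
      rw [fin, hYΦ u hu (by simp)]; rfl
    have hl : HasDerivAt (fun s : ℝ => ((x + s * ‖period P a‖⁻¹ : ℝ) : ℂ))
        ((‖period P a‖⁻¹ : ℝ) : ℂ) s := by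
      have := (hasDerivAt_line (x : ℂ) ((‖period P a‖⁻¹ : ℝ) : ℂ) s)
      refine this.congr_of_eventuallyEq (Eventually.of_forall fun u => ?_)
      push_cast; ring
    have hcomp := hYd.comp_of_eq s hl rfl
    beta_reduce
    rw [hfinY _ (Metric.mem_ball_self hε)]
    refine (hcomp.congr_of_eventuallyEq ?_).congr_deriv (by ring)
    filter_upwards [hl.continuousAt.eventually_mem (Metric.ball_mem_nhds _ hε)] with u hu
    exact hfinY _ hu
  · rw [← tendsto_coe_infty_iff]
    have hc : ContinuousAt (fun s : ℝ => K.Φ ((x + s * ‖period P a‖⁻¹ : ℝ) : ℂ))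
        ((b - x) * ‖period P a‖) := by
      refine ContinuousAt.comp (f := fun s : ℝ => x + s * ‖period P a‖⁻¹)
        (g := fun s : ℝ => K.Φ (s : ℂ)) (continuousOn_univ.1 hcont).continuousAt (by fun_prop)
    have hval : x + (b - x) * ‖period P a‖ * ‖period P a‖⁻¹ = b := by
      rw [mul_assoc, mul_inv_cancel₀ hn.ne', mul_one]; ring
    have ht := hc.tendsto
    simp only [hval] at ht
    have hbi : K.Φ (b : ℂ) = OnePoint.infty := hb.1
    rw [hbi] at ht
    refine (ht.mono_left nhdsWithin_le_nhds).congr' ?_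
    filter_upwards [Ioo_mem_nhdsLT (mul_pos (sub_pos.2 hxb) hn)] with s hs
    obtain ⟨h1, h2⟩ := hlt s ⟨hs.1.le, hs.2⟩
    exact (K.coe_fin (hfin _ h1 h2)).symm

lemma boundary_notMem_domain (ha : P.IsRoot a) {x : ℝ} {z : ℂ} (hx : K.Φ x = z) : z ∉ K.domain := by
  have h := K.onSeparatrix_of_boundary hs hx
  rintro (rfl | ⟨w, hw, rfl⟩)
  · exact not_onSeparatrix_of_isRoot ha h
  · exact K.notMem_separatrixGraph hs hw (Or.inr h)

omit hs

lemma mem_closure_of_boundary {x : ℝ} {z : ℂ} (hx : K.Φ x = z) : z ∈ closure K.domain := by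
  have hne := nhdsWithin_upperHalfPlane_neBot (w := (x : ℂ)) (by simp)
  have hc := (K.continuousOn (x : ℂ) (by simp)).tendsto
  rw [hx] at hc
  have hc2 : Tendsto (fun w => (K.φ w : OnePoint ℂ)) (𝓝[{w : ℂ | 0 < w.im}] (x : ℂ)) (𝓝 z) := by
    refine (hc.mono_left (nhdsWithin_mono _ fun w (hw : 0 < w.im) => hw.le)).congr' ?_
    filter_upwards [self_mem_nhdsWithin] with w hw using K.Φ_eq w hw
  rw [tendsto_coe_coe_iff] at hc2
  refine mem_closure_of_tendsto hc2 ?_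
  filter_upwards [self_mem_nhdsWithin] with w hw
  exact Or.inr ⟨w, hw, rfl⟩

lemma exists_fundamental (w : ℂ) (hw : 0 ≤ w.im) : ∃ w' : ℂ, w'.re ∈ Ico (0 : ℝ) 1 ∧ w'.im = w.im ∧
    K.Φ w' = K.Φ w ∧ ∃ n : ℤ, w' = w + n := by
  refine ⟨w + ((-⌊w.re⌋ : ℤ) : ℂ), ⟨?_, ?_⟩, by simp, K.periodic_int _ w hw, _, rfl⟩
  · simpa using Int.floor_le w.re
  · simpa using (by linarith [Int.lt_floor_add_one w.re] : w.re < 1 + (⌊w.re⌋ : ℝ))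

/-- High points of the half plane are sent near `a`, hence away from `z`. By periodicity the others
come from a compact rectangle, whose image under `Φ` is closed. -/
lemma closure_domain_subset : closure K.domain ⊆ K.domain ∪ {z | ∃ x : ℝ, K.Φ x = z} := by
  intro z hz
  by_cases hzB : z ∈ K.domain
  · exact Or.inl hzB
  refine Or.inr ?_
  have hza : z ≠ a := fun h => hzB (Or.inl h)
  have hd : 0 < dist z a := dist_pos.2 hza
  obtain ⟨M, hM⟩ : ∃ M : ℝ, ∀ w : ℂ, M ≤ w.im → dist (K.φ w) a ≤ dist z a / 2 := by
    have := (tendsto_iff_dist_tendsto_zero.1 K.tendsto).eventually_le_const (half_pos hd)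
    rw [eventually_comap] at this
    obtain ⟨M, hM⟩ := eventually_atTop.1 this
    exact ⟨M, fun w hw => hM w.im hw w rfl⟩
  set Q := Icc (0 : ℝ) 1 ×ℂ Icc (0 : ℝ) M with hQ
  have hQc : IsCompact Q := isCompact_Icc.reProdIm isCompact_Icc
  have hcl : IsClosed (K.Φ '' Q) :=
    (hQc.image_of_continuousOn (K.continuousOn.mono fun w hw => hw.2.1)).isClosed
  have hsub : K.domain ⊆ Metric.closedBall a (dist z a / 2) ∪ (↑) ⁻¹' (K.Φ '' Q) := by
    rintro _ (rfl | ⟨w, hw, rfl⟩)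
    · exact Or.inl (Metric.mem_closedBall_self (half_pos hd).le)
    · rcases le_total M w.im with h | h
      · exact Or.inl (hM w h)
      · have hw : 0 < w.im := hw
        obtain ⟨w', h1, h2, h3, -⟩ := K.exists_fundamental w hw.le
        refine Or.inr ⟨w', ⟨⟨h1.1, h1.2.le⟩, ?_, ?_⟩, h3.trans (K.Φ_eq w hw)⟩
        · rw [h2]; exact hw.le
        · rw [h2]; exact h
  have hclu : IsClosed (Metric.closedBall a (dist z a / 2) ∪ ((↑) ⁻¹' (K.Φ '' Q) : Set ℂ)) :=
    Metric.isClosed_closedBall.union (hcl.preimage OnePoint.continuous_coe)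
  rcases closure_minimal hsub hclu hz with h | ⟨w, hw, hwz⟩
  · have := Metric.mem_closedBall.1 h; linarith
  · have hw0 : 0 ≤ w.im := hw.2.1
    rcases hw0.lt_or_eq with h | h
    · rw [K.Φ_eq w h, OnePoint.coe_eq_coe] at hwz
      exact absurd (Or.inr ⟨w, h, hwz⟩) hzB
    · refine ⟨w.re, ?_⟩
      rw [← hwz]; congr 1
      exact Complex.ext (by simp) (by simp [← h])

lemma isOpen_domain : IsOpen K.domain := K.isOpen

lemma isPreconnected_image : IsPreconnected K.image :=
  (convex_im_gt 0).isPreconnected.image _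
    fun w hw => (K.hasDerivAt w hw).continuousAt.continuousWithinAt

include hs

lemma frontier_domain (ha : P.IsRoot a) : frontier K.domain = {z : ℂ | ∃ x : ℝ, K.Φ x = z} := by
  rw [K.isOpen_domain.frontier_eq]
  ext z
  constructor
  · rintro ⟨h1, h2⟩
    exact (K.closure_domain_subset h1).resolve_left h2
  · rintro ⟨x, hx⟩
    exact ⟨K.mem_closure_of_boundary hx, K.boundary_notMem_domain hs ha hx⟩

/-- The image of the half plane is connected and avoids the separatrix graph, while the frontier of
the domain lies on the graph. A component that surrounds `a` meets the image and cannot leave it. -/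
lemma periodicDomain_eq (ha : P.IsRoot a) : periodicDomain P a = K.domain := by
  set G := separatrixGraph (rotatedField P (period P a).arg) with hG
  have himG : K.image ⊆ Gᶜ := by
    rintro _ ⟨w, hw, rfl⟩
    exact K.notMem_separatrixGraph hs hw
  have haG : a ∈ G := Or.inl (by
    show _ * P.eval a = 0
    rw [show P.eval a = 0 from ha, mul_zero])
  have hB : K.domain ∈ 𝓝 a := K.isOpen_domain.mem_nhds (mem_insert _ _)
  refine Subset.antisymm ?_ ?_
  · rintro z (rfl | ⟨hzG, hz⟩)
    · exact mem_insert _ _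
    -- the component meets the image
    have h1 : ((insert a (connectedComponentIn Gᶜ z) ∩ K.domain) ∩ {a}ᶜ).Nonempty := by
      have : insert a (connectedComponentIn Gᶜ z) ∩ K.domain ∈ 𝓝[≠] a :=
        mem_nhdsWithin_of_mem_nhds (inter_mem hz hB)
      exact (nonempty_of_mem (inter_mem this self_mem_nhdsWithin))
    obtain ⟨u, ⟨hu1, hu2⟩, hu3⟩ := h1
    have hu1 := hu1.resolve_left hu3
    have hu2 := hu2.resolve_left hu3
    have hsub : connectedComponentIn Gᶜ z ⊆ K.domain := by
      refine isPreconnected_connectedComponentIn.subset_of_closure_inter_subset K.isOpen_domain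
        ⟨u, hu1, Or.inr hu2⟩ ?_
      rintro v ⟨hv1, hv2⟩
      rcases K.closure_domain_subset hv1 with h | ⟨x, hx⟩
      · exact h
      · exact absurd (Or.inr (K.onSeparatrix_of_boundary hs hx)) (connectedComponentIn_subset _ _ hv2)
    exact hsub (mem_connectedComponentIn hzG)
  · rintro z (rfl | hz)
    · exact mem_insert _ _
    refine Or.inr ⟨himG hz, mem_of_superset hB (insert_subset_insert ?_)⟩
    exact K.isPreconnected_image.subset_connectedComponentIn hz himG

/-- Cuts are the images of vertical rays over the blow-up points of the boundary. -/
lemma exists_of_isCut (ha : P.IsRoot a) {D : Set ℂ} (hD : IsCut P a D) :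
    ∃ x : ℝ, K.Φ x = OnePoint.infty ∧
      D = insert a ((fun r : ℝ => K.φ (x + r * Complex.I)) '' Ioi 0) := by
  obtain ⟨S, ⟨z, hz, rfl⟩, hSB, rfl⟩ := hD
  have hν := period_ne_zero hs
  have hn : 0 < ‖period P a‖ := norm_pos_iff.2 hν
  set n := ‖period P a‖ with hndef
  rw [K.periodicDomain_eq hs ha] at hSB
  rw [rotatedField_eq, exp_arg_sub_mul_I hν] at hz hSB ⊢
  set d : ℂ := -((n⁻¹ : ℝ) : ℂ) * Complex.I with hd
  have hzS : z ∈ realOrbit (fun z => d * period P a * P.eval z) z := by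
    rcases hz with ⟨T, hT, γ, h0, hγ, -⟩ | ⟨T, hT, γ, h0, hγ, -⟩
    · refine ⟨γ, 0, h0, h0, fun s hs => ?_⟩
      simp only [uIcc_self, mem_singleton_iff] at hs
      subst hs; exact hγ 0 ⟨le_rfl, hT⟩
    · refine ⟨fun s => γ (-s), 0, by simpa using h0, by simpa using h0, fun s hs => ?_⟩
      simp only [uIcc_self, mem_singleton_iff] at hs
      subst hs
      have h1 : HasDerivAt γ (-(d * period P a * P.eval (γ 0))) (-0) := by
        rw [neg_zero]; exact hγ 0 ⟨le_rfl, hT⟩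
      have := h1.scomp (0 : ℝ) (hasDerivAt_neg (0 : ℝ))
      exact this.congr_deriv (by simp)
  have hza : z ≠ a := by
    rintro rfl; exact not_onSeparatrix_of_isRoot ha hz
  obtain ⟨w₀, hw₀, hw₀z⟩ := (hSB hzS).resolve_left hza
  have hw₀ : 0 < w₀.im := hw₀
  have him : ∀ (s : ℝ), (w₀ + s * d).im = w₀.im - s * n⁻¹ := fun s => by
    simp [hd]; ring
  have him' : ∀ (s : ℝ), (w₀ + s * -d).im = w₀.im + s * n⁻¹ := fun s => by
    simp [hd]
  -- Backwards the vertical line rises for ever inside the half plane, so the escape must be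
  -- forwards.
  have hback : ¬ EscapesForward (fun z => -(d * period P a) * P.eval z) z := by
    have := not_escapesForward (P := P) (c := -(d * period P a)) (y := fun s => K.φ (w₀ + s * -d))
      (fun s hs0 => K.hasDerivAt_trajectory
        (by rw [him']; have := mul_nonneg hs0 (inv_nonneg.2 hn.le); linarith) (by ring))
    simpa [hw₀z] using this
  have hesc : EscapesForward (fun z => d * period P a * P.eval z) z := by
    refine hz.resolve_right fun h => hback ?_
    simpa only [neg_mul] using h
  obtain ⟨T, hT, γ, h0, hγ, hinf⟩ := hesc
  -- the trajectory in the half plane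
  set T₁ := w₀.im * n with hT₁
  have hT₁pos : 0 < T₁ := mul_pos hw₀ hn
  have hpos : ∀ s < T₁, 0 < (w₀ + s * d).im := fun s hs => by
    rw [him]; have := (mul_inv_lt_iff₀ hn).2 hs; linarith
  have hyd : ∀ s < T₁, HasDerivAt (fun s : ℝ => K.φ (w₀ + s * d))
      (d * period P a * P.eval (K.φ (w₀ + s * d))) s := fun s hs =>
    K.hasDerivAt_trajectory (hpos s hs) rfl
  obtain ⟨hTle, heq⟩ := lifetime_le_of_escape (T₁ := T₁) hT hγ hinf (fun s hs => hyd s hs.2)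
    (by simp [h0, hw₀z])
  have hend : w₀ + (T₁ : ℂ) * d = (w₀.re : ℂ) := by
    have h1 : (n : ℂ) ≠ 0 := by exact_mod_cast hn.ne'
    rw [hd, hT₁]
    push_cast
    field_simp
    linear_combination -(Complex.re_add_im w₀)
  have hlimΦ : Tendsto (fun s : ℝ => (K.φ (w₀ + s * d) : OnePoint ℂ)) (𝓝[<] T₁) (𝓝 (K.Φ w₀.re)) := by
    have hc := K.continuousOn_line (w := w₀) (d := d) (S := Iic T₁) (fun s hs => by
      rw [him]; have := (mul_inv_le_iff₀ hn).2 (show s ≤ w₀.im * n from hs); linarith)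
    have hc2 := (hc T₁ self_mem_Iic).tendsto
    rw [hend] at hc2
    refine (hc2.mono_left (nhdsWithin_mono _ Iio_subset_Iic_self)).congr' ?_
    filter_upwards [self_mem_nhdsWithin] with s hs using K.Φ_eq _ (hpos s hs)
  -- At the time `T₁` the real line is reached. If the separatrix were still finite there, it would
  -- contain a boundary point, although it lies in the open domain.
  have hblow : K.Φ w₀.re = OnePoint.infty := by
    rcases hTle.lt_or_eq with hlt | heqT
    · exfalso
      have hγT := hγ T₁ ⟨hT₁pos.le, hlt⟩
      have hval : K.Φ w₀.re = (γ T₁ : OnePoint ℂ) := by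
        refine tendsto_nhds_unique hlimΦ ?_
        rw [tendsto_coe_coe_iff]
        refine (hγT.continuousAt.tendsto.mono_left nhdsWithin_le_nhds).congr' ?_
        filter_upwards [Ioo_mem_nhdsLT hT₁pos] with s hs using heq ⟨hs.1.le, hs.2⟩
      refine K.boundary_notMem_domain hs ha hval (hSB ⟨γ, T₁, h0, rfl, fun s hs => ?_⟩)
      rw [uIcc_of_le hT₁pos.le] at hs
      exact hγ s ⟨hs.1, hs.2.trans_lt hlt⟩
    · refine tendsto_nhds_unique hlimΦ (tendsto_coe_infty_iff.2 ?_)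
      rw [heqT]
      refine hinf.congr' ?_
      filter_upwards [Ioo_mem_nhdsLT hT] with s hs using heq ⟨hs.1.le, by rw [heqT]; exact hs.2⟩
  refine ⟨w₀.re, hblow, ?_⟩
  congr 1
  have hn' : (n : ℂ) ≠ 0 := by exact_mod_cast hn.ne'
  have hpt : ∀ s : ℝ, w₀ + s * d = (w₀.re : ℂ) + ((w₀.im - s * n⁻¹ : ℝ) : ℂ) * Complex.I := fun s => by
    rw [hd]
    push_cast
    linear_combination -(Complex.re_add_im w₀)
  -- By uniqueness every trajectory from `z` follows the vertical line: forwards it ends before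
  -- `T₁`, where `φ` blows up; backwards it is unrestricted.
  ext u
  constructor
  · rintro ⟨γ', T', h0', rfl, hγ'⟩
    rcases le_total 0 T' with hT' | hT'
    · rw [uIcc_of_le hT'] at hγ'
      have hγ'' : T' < T₁ := by
        by_contra hcon
        push Not at hcon
        have heq' : ∀ s ∈ Ico (0 : ℝ) T₁, γ' s = K.φ (w₀ + s * d) := fun s hs =>
          eqOn_of_hasDerivAt_real (P := P) (c := d * period P a) (T := s)
            (fun u hu => hγ' u ⟨hu.1, hu.2.trans (hs.2.le.trans hcon)⟩)
            (fun u hu => hyd u (hu.2.trans_lt hs.2)) (by simp [h0', hw₀z]) ⟨hs.1, le_rfl⟩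
        have hc : Tendsto γ' (𝓝[<] T₁) (𝓝 (γ' T₁)) :=
          (hγ' T₁ ⟨hT₁pos.le, hcon⟩).continuousAt.tendsto.mono_left nhdsWithin_le_nhds
        rw [hblow, tendsto_coe_infty_iff] at hlimΦ
        refine hc.not_tendsto (Metric.disjoint_nhds_cobounded _) (hlimΦ.congr' ?_)
        filter_upwards [Ioo_mem_nhdsLT hT₁pos] with s hs
        exact (heq' s ⟨hs.1.le, hs.2⟩).symm
      have : γ' T' = K.φ (w₀ + T' * d) := eqOn_of_hasDerivAt_real (P := P) (c := d * period P a)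
        (T := T') hγ' (fun u hu => hyd u (hu.2.trans_lt hγ'')) (by simp [h0', hw₀z]) ⟨hT', le_rfl⟩
      refine ⟨w₀.im - T' * n⁻¹, ?_, ?_⟩
      · have := hpos T' hγ''
        rw [him] at this; exact this
      · rw [this, hpt T']
    · rw [uIcc_of_ge hT'] at hγ'
      have hγn : ∀ s ∈ Icc 0 (-T'), HasDerivAt (fun s => γ' (-s))
          (-(d * period P a) * P.eval (γ' (-s))) s := fun s hs => by
        have h1 := (hγ' (-s) ⟨by linarith [hs.2], by linarith [hs.1]⟩)
        exact (h1.scomp s (hasDerivAt_neg s)).congr_deriv (by simp)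
      have : γ' (-(-T')) = K.φ (w₀ + (-T' : ℝ) * -d) :=
        eqOn_of_hasDerivAt_real (P := P) (c := -(d * period P a))
          (T := -T') (γ₁ := fun s => γ' (-s)) (γ₂ := fun s : ℝ => K.φ (w₀ + s * -d)) hγn
          (fun u hu => K.hasDerivAt_trajectory (by
            rw [him']; have := mul_nonneg hu.1 (inv_nonneg.2 hn.le); linarith) (by ring))
          (by simp [h0', hw₀z]) ⟨by linarith, le_rfl⟩
      rw [neg_neg] at this
      have h3 : w₀ + ((-T' : ℝ) : ℂ) * -d = w₀ + (T' : ℂ) * d := by push_cast; ring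
      refine ⟨w₀.im - T' * n⁻¹, ?_, ?_⟩
      · have := mul_nonneg (neg_nonneg.2 hT') (inv_nonneg.2 hn.le)
        show 0 < w₀.im - T' * n⁻¹
        linarith
      · rw [this, h3, hpt T']
  · rintro ⟨r, hr, rfl⟩
    have hr : 0 < r := hr
    have hsT : (w₀.im - r) * n < T₁ := by rw [hT₁]; nlinarith
    refine ⟨fun s => K.φ (w₀ + s * d), (w₀.im - r) * n, by simp [hw₀z], ?_, fun s hs => hyd s ?_⟩
    · simp only
      rw [hpt]
      congr 3
      rw [mul_assoc, mul_inv_cancel₀ hn.ne', mul_one]; simp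
    · rcases mem_uIcc.1 hs with h | h
      · exact h.2.trans_lt hsT
      · exact h.2.trans_lt hT₁pos

end PeriodicChart

/-! ### Translation, disjointness and continuation of charts -/

namespace PeriodicChart
variable {k : ℕ} {P : Polynomial ℂ} {a : ℂ}

/-- Real translation of a chart. -/
noncomputable def translate (K : PeriodicChart P a) (x₀ : ℝ) : PeriodicChart P a where
  φ w := K.φ (w + x₀)
  Φ w := K.Φ (w + x₀)
  hasDerivAt w hw := (K.hasDerivAt (w + x₀) (by simpa using hw)).comp_add_const w x₀
  eval_ne w hw := K.eval_ne _ (by simpa using hw)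
  Φ_eq w hw := K.Φ_eq _ (by simpa using hw)
  continuousOn := K.continuousOn.comp (by fun_prop) fun w hw => by simpa using hw
  periodic w hw := by
    rw [← K.periodic (w + x₀) (by simpa using hw)]
    congr 1; ring
  inj w w' hw hw' h := by
    obtain ⟨n, hn⟩ := K.inj _ _ (by simpa using hw) (by simpa using hw') h
    exact ⟨n, by linear_combination hn⟩
  tendsto := by
    refine K.tendsto.comp ?_
    rw [tendsto_comap_iff]
    refine tendsto_comap.congr fun w => ?_
    simp
  isOpen := by
    convert K.isOpen using 2
    ext z
    constructor
    · rintro ⟨w, hw, rfl⟩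
      exact ⟨w + x₀, by simpa using hw, rfl⟩
    · rintro ⟨w, hw, rfl⟩
      exact ⟨w - x₀, by simpa using hw, by simp⟩
  extend x hx := by
    obtain ⟨Y, ε, hε, h1, h2⟩ := K.extend (x + x₀) (by simpa using hx)
    have hb : ∀ t ∈ Metric.ball (x : ℂ) ε, t + x₀ ∈ Metric.ball ((x + x₀ : ℝ) : ℂ) ε := fun t ht => by
      simpa [dist_eq_norm] using ht
    exact ⟨fun t => Y (t + x₀), ε, hε, fun t ht => (h1 _ (hb t ht)).comp_add_const t x₀,
      fun t ht h0 => h2 _ (hb t ht) (by simpa using h0)⟩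
  exists_infty := by
    obtain ⟨x, hx⟩ := K.exists_infty
    exact ⟨x - x₀, by simpa using hx⟩

lemma translate_Φ (K : PeriodicChart P a) (x₀ : ℝ) (w : ℂ) : (K.translate x₀).Φ w = K.Φ (w + x₀) := rfl

lemma translate_φ (K : PeriodicChart P a) (x₀ : ℝ) (w : ℂ) : (K.translate x₀).φ w = K.φ (w + x₀) := rfl

variable (K : PeriodicChart P a)

lemma tendsto_vertical (w d : ℂ) {l : Filter ℝ} (h : Tendsto (fun s : ℝ => (w + s * d).im) l atTop) :
    Tendsto (fun s : ℝ => K.φ (w + s * d)) l (𝓝 a) :=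
  K.tendsto.comp (tendsto_comap_iff.2 h)

lemma hasDerivAt_div {w t : ℂ} (hν : period P a ≠ 0) (h : 0 < (w + t / period P a).im) :
    HasDerivAt (fun t => K.φ (w + t / period P a)) (1 * P.eval (K.φ (w + t / period P a))) t := by
  have h1 : HasDerivAt (fun t : ℂ => w + t / period P a) (1 / period P a) t :=
    ((hasDerivAt_id t).div_const _).const_add w
  refine ((K.hasDerivAt _ h).comp_of_eq t h1 rfl).congr_deriv ?_
  field_simp

/-- The vector `i (μ/|μ| + ν/|ν|)` bisects the inner normals `iμ` and `iν` of two half planes. It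
points into both unless the normals are opposite; the imaginary part equals `(1 + ⟨p, q⟩) / |μ|` for
the unit vectors `p` and `q`. -/
lemma im_div_add_pos {μ ν : ℂ} (hμ : μ ≠ 0) (hν : ν ≠ 0) (h : μ / ‖μ‖ + ν / ‖ν‖ ≠ 0) :
    0 < (Complex.I * (μ / ‖μ‖ + ν / ‖ν‖) / μ).im := by
  have hm : 0 < ‖μ‖ := norm_pos_iff.2 hμ
  have hn : 0 < ‖ν‖ := norm_pos_iff.2 hν
  set p : ℂ := μ / ‖μ‖ with hp
  set q : ℂ := ν / ‖ν‖ with hq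
  have hp1 : ‖p‖ = 1 := by rw [hp, norm_div]; simp [hm.ne']
  have hq1 : ‖q‖ = 1 := by rw [hq, norm_div]; simp [hn.ne']
  have hp2 : p.re * p.re + p.im * p.im = 1 := by
    rw [← Complex.normSq_apply, Complex.normSq_eq_norm_sq, hp1]; norm_num
  have hq2 : q.re * q.re + q.im * q.im = 1 := by
    rw [← Complex.normSq_apply, Complex.normSq_eq_norm_sq, hq1]; norm_num
  have hinv : (μ)⁻¹ = ((‖μ‖⁻¹ : ℝ) : ℂ) * (starRingEnd ℂ) p := by
    rw [Complex.inv_def, hp, map_div₀, Complex.conj_ofReal, Complex.normSq_eq_norm_sq]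
    have : (‖μ‖ : ℂ) ≠ 0 := by exact_mod_cast hm.ne'
    push_cast
    field_simp
  rw [div_eq_mul_inv, hinv]
  have : (Complex.I * (p + q) * (((‖μ‖⁻¹ : ℝ) : ℂ) * (starRingEnd ℂ) p)).im =
      ‖μ‖⁻¹ * (1 + (p.re * q.re + p.im * q.im)) := by
    simp only [Complex.mul_im, Complex.mul_re, Complex.I_re, Complex.I_im, Complex.add_re,
      Complex.add_im, Complex.conj_re, Complex.conj_im, Complex.ofReal_re, Complex.ofReal_im]
    linear_combination ‖μ‖⁻¹ * hp2
  rw [this]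
  refine mul_pos (inv_pos.2 hm) ?_
  have hsum : 0 < Complex.normSq (p + q) := Complex.normSq_pos.2 h
  rw [Complex.normSq_apply, Complex.add_re, Complex.add_im] at hsum
  nlinarith

/-- The uniformized domains of different equilibria are disjoint. -/
lemma disjoint_image {b : ℂ} (L : PeriodicChart P b) (C : InfinityChart k P)
    (ha : P.derivative.eval a ≠ 0) (hb : P.derivative.eval b ≠ 0) (hab : a ≠ b) :
    Disjoint K.image L.image := by
  rw [Set.disjoint_left]
  rintro _ ⟨w₁, hw₁, rfl⟩ ⟨w₂, hw₂, h12⟩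
  have hw₁ : 0 < w₁.im := hw₁
  have hw₂ : 0 < w₂.im := hw₂
  set μ := period P a with hμd
  set ν := period P b with hνd
  have hμ : μ ≠ 0 := period_ne_zero ha
  have hν : ν ≠ 0 := period_ne_zero hb
  have hm : 0 < ‖μ‖ := norm_pos_iff.2 hμ
  have hn : 0 < ‖ν‖ := norm_pos_iff.2 hν
  have hm' : (‖μ‖ : ℂ) ≠ 0 := by exact_mod_cast hm.ne'
  have hn' : (‖ν‖ : ℂ) ≠ 0 := by exact_mod_cast hn.ne'
  have hconv : ∀ (w ρ : ℂ), Convex ℝ {t : ℂ | 0 < (w + t / ρ).im} := fun w ρ => by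
    intro x hx y hy s t hs ht hst
    have hx : 0 < (w + x / ρ).im := hx
    have hy : 0 < (w + y / ρ).im := hy
    have h1 : w + (s • x + t • y) / ρ = (s : ℂ) * (w + x / ρ) + (t : ℂ) * (w + y / ρ) := by
      have : (s : ℂ) + t = 1 := by exact_mod_cast hst
      simp only [Complex.real_smul]
      linear_combination (-w) * this
    show 0 < (w + (s • x + t • y) / ρ).im
    rw [h1, Complex.add_im, Complex.im_ofReal_mul, Complex.im_ofReal_mul]
    rcases hs.eq_or_lt with h | h
    · subst h
      have : t = 1 := by linarith
      subst this; simpa using hy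
    · have := mul_pos h hx
      have := mul_nonneg ht hy.le
      linarith
  set y₁ : ℂ → ℂ := fun t => K.φ (w₁ + t / μ) with hy₁
  set y₂ : ℂ → ℂ := fun t => L.φ (w₂ + t / ν) with hy₂
  have hd₁ : ∀ t ∈ {t : ℂ | 0 < (w₁ + t / μ).im}, HasDerivAt y₁ (1 * P.eval (y₁ t)) t := fun t ht =>
    K.hasDerivAt_div hμ ht
  have hd₂ : ∀ t ∈ {t : ℂ | 0 < (w₂ + t / ν).im}, HasDerivAt y₂ (1 * P.eval (y₂ t)) t := fun t ht =>
    L.hasDerivAt_div hν ht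
  -- In the common time `t` both charts solve `ż = P(z)`, on two half planes that contain `0`, with
  -- the same value at `0`.
  have heq : EqOn y₁ y₂ ({t : ℂ | 0 < (w₁ + t / μ).im} ∩ {t : ℂ | 0 < (w₂ + t / ν).im}) :=
    eqOn_of_hasDerivAt_complex ((hconv w₁ μ).inter (hconv w₂ ν)) (fun t ht => hd₁ t ht.1)
      (fun t ht => hd₂ t ht.2) (t₀ := 0) ⟨by simpa using hw₁, by simpa using hw₂⟩
      (by simp [hy₁, hy₂, h12])
  by_cases hop : μ / ‖μ‖ + ν / ‖ν‖ = 0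
  · -- the two half planes cover the plane
    have hop' : μ * ‖ν‖ + ν * ‖μ‖ = 0 := by
      field_simp at hop
      linear_combination hop
    have hcov : ∀ t : ℂ, 0 < (w₁ + t / μ).im ∨ 0 < (w₂ + t / ν).im := fun t => by
      by_contra hcon
      push Not at hcon
      obtain ⟨h1, h2⟩ := hcon
      have h3 : t / ν = ((-(‖μ‖ / ‖ν‖) : ℝ) : ℂ) * (t / μ) := by
        push_cast
        field_simp
        linear_combination t * hop'
      rw [h3, Complex.add_im, Complex.im_ofReal_mul] at h2
      rw [Complex.add_im] at h1
      have : 0 < ‖μ‖ / ‖ν‖ := div_pos hm hn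
      nlinarith
    classical
    -- The two solutions glue to an entire one, which would have to start at a zero of `P`.
    set y : ℂ → ℂ := fun t => if 0 < (w₁ + t / μ).im then y₁ t else y₂ t with hy
    have hopen : ∀ w ρ : ℂ, IsOpen {t : ℂ | 0 < (w + t / ρ).im} := fun w ρ =>
      isOpen_lt continuous_const (by fun_prop)
    have hy1 : ∀ t ∈ {t : ℂ | 0 < (w₁ + t / μ).im}, y t = y₁ t := fun t ht => if_pos ht
    have hy2 : ∀ t ∈ {t : ℂ | 0 < (w₂ + t / ν).im}, y t = y₂ t := fun t ht => by
      by_cases h : 0 < (w₁ + t / μ).im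
      · rw [hy1 t h]; exact heq ⟨h, ht⟩
      · exact if_neg h
    have hyd : ∀ t, HasDerivAt y (1 * P.eval (y t)) t := fun t => by
      rcases hcov t with h | h
      · rw [hy1 t h]
        refine (hd₁ t h).congr_of_eventuallyEq ?_
        filter_upwards [(hopen w₁ μ).mem_nhds h] with s hs using hy1 s hs
      · rw [hy2 t h]
        refine (hd₂ t h).congr_of_eventuallyEq ?_
        filter_upwards [(hopen w₂ ν).mem_nhds h] with s hs using hy2 s hs
    have h0 := eval_eq_zero_of_entire C one_ne_zero hyd
    rw [hy1 0 (by simpa using hw₁)] at h0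
    exact K.eval_ne w₁ hw₁ (by simpa [hy₁] using h0)
  · -- a common direction
    set e : ℂ := Complex.I * (μ / ‖μ‖ + ν / ‖ν‖) with he
    have hi₁ : 0 < (e / μ).im := im_div_add_pos hμ hν hop
    have hi₂ : 0 < (e / ν).im := by
      have := im_div_add_pos hν hμ (by rwa [add_comm])
      rwa [add_comm, ← he] at this
    have him : ∀ (w d : ℂ), 0 < d.im → Tendsto (fun s : ℝ => (w + s * d).im) atTop atTop := fun w d hd => by
      simp only [Complex.add_im, Complex.im_ofReal_mul]
      exact tendsto_atTop_add_const_left _ _ (tendsto_id.atTop_mul_const hd)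
    have ht₁ := K.tendsto_vertical w₁ (e / μ) (him w₁ _ hi₁)
    have ht₂ := L.tendsto_vertical w₂ (e / ν) (him w₂ _ hi₂)
    -- In the direction `e` both charts describe the same curve; it tends to `a` by one chart and to
    -- `b` by the other.
    refine hab (tendsto_nhds_unique (ht₁.congr' ?_) ht₂)
    filter_upwards [eventually_ge_atTop 0] with s hs
    have hpos : ∀ (w d : ℂ), 0 < w.im → 0 < d.im → 0 < (w + s * d).im := fun w d hw hd => by
      rw [Complex.add_im, Complex.im_ofReal_mul]
      have := mul_nonneg hs hd.le
      linarith
    have h1 : w₁ + s * (e / μ) = w₁ + (s * e) / μ := by ring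
    have h2 : w₂ + s * (e / ν) = w₂ + (s * e) / ν := by ring
    have := @heq (s * e) ⟨by rw [mem_ofPred_eq, ← h1]; exact hpos _ _ hw₁ hi₁,
      by rw [mem_ofPred_eq, ← h2]; exact hpos _ _ hw₂ hi₂⟩
    rw [h1, h2]
    exact this

lemma disjoint_domain {b : ℂ} (L : PeriodicChart P b) (C : InfinityChart k P) (ha : P.IsRoot a)
    (hb : P.IsRoot b) (ha' : P.derivative.eval a ≠ 0) (hb' : P.derivative.eval b ≠ 0) (hab : a ≠ b) :
    Disjoint K.domain L.domain := by
  rw [Set.disjoint_left]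
  rintro _ (rfl | h) (h' | h')
  · exact hab h'
  · obtain ⟨w, hw, h⟩ := h'
    exact L.eval_ne w hw (by rw [h]; exact ha)
  · rw [h'] at h
    obtain ⟨w, hw, h⟩ := h
    exact K.eval_ne w hw (by rw [h]; exact hb)
  · exact Set.disjoint_left.1 (K.disjoint_image L C ha' hb' hab) h h'

/-- Analytic continuation across finite boundary points. -/
lemma extend' {w₀ : ℂ} (hw₀ : 0 ≤ w₀.im) (h : K.Φ w₀ ≠ OnePoint.infty) : ∃ Y : ℂ → ℂ, ∃ ε > 0,
    (∀ t ∈ Metric.ball w₀ ε, HasDerivAt Y (period P a * P.eval (Y t)) t) ∧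
      ∀ t ∈ Metric.ball w₀ ε, 0 ≤ t.im → K.Φ t = Y t := by
  rcases hw₀.lt_or_eq with h0 | h0
  · obtain ⟨ε, hε, hb⟩ := Metric.isOpen_iff.1 (isOpen_im_gt 0) w₀ h0
    exact ⟨K.φ, ε, hε, fun t ht => K.hasDerivAt t (hb ht), fun t ht _ => K.Φ_eq t (hb ht)⟩
  · have : w₀ = (w₀.re : ℂ) := Complex.ext (by simp) (by simp [← h0])
    rw [this] at h ⊢
    exact K.extend _ h

/-- At a zero of `P` the solution `Y` would be constant by uniqueness, yet it agrees with `φ` on the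
part of the disc in the upper half plane, where `P ∘ φ` does not vanish. -/
lemma eval_ne_of_extend {w₀ : ℂ} (hw₀ : 0 ≤ w₀.im) {Y : ℂ → ℂ} {ε : ℝ} (hε : 0 < ε)
    (hY : ∀ t ∈ Metric.ball w₀ ε, HasDerivAt Y (period P a * P.eval (Y t)) t)
    (hYΦ : ∀ t ∈ Metric.ball w₀ ε, 0 ≤ t.im → K.Φ t = Y t) : P.eval (Y w₀) ≠ 0 := by
  intro h0
  have hc : EqOn Y (fun _ => Y w₀) (Metric.ball w₀ ε) :=
    eqOn_of_hasDerivAt_complex (P := P) (c := period P a) (convex_ball _ _) hY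
      (fun t _ => by simpa [h0] using hasDerivAt_const t (Y w₀)) (Metric.mem_ball_self hε) rfl
  have := nhdsWithin_upperHalfPlane_neBot hw₀
  obtain ⟨t, ht, htb⟩ := Filter.nonempty_of_mem (inter_mem (self_mem_nhdsWithin (s := {w : ℂ | 0 < w.im}))
    (mem_nhdsWithin_of_mem_nhds (Metric.ball_mem_nhds w₀ hε)))
  have ht : 0 < t.im := ht
  refine K.eval_ne t ht ?_
  have := hYΦ t htb ht.le
  rw [K.Φ_eq t ht, OnePoint.coe_eq_coe, hc htb] at this
  rw [this, h0]

end PeriodicChart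

/-! ### The chart near a blow-up point -/

lemma im_I_mul_exp (x : ℂ) : (Complex.I * Complex.exp x).im = Real.exp x.re * Real.cos x.im := by
  rw [Complex.I_mul_im, Complex.exp_re]

lemma re_I_mul_exp (x : ℂ) : (Complex.I * Complex.exp x).re = -(Real.exp x.re * Real.sin x.im) := by
  rw [Complex.I_mul_re, Complex.exp_im]

lemma norm_I_mul_exp (x : ℂ) : ‖Complex.I * Complex.exp x‖ = Real.exp x.re := by
  rw [norm_mul, Complex.norm_I, one_mul, Complex.norm_exp]

namespace PeriodicChart
variable {k : ℕ} {P : Polynomial ℂ} {a : ℂ} (K : PeriodicChart P a)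

lemma hasDerivAt_comp_primitive {Y g : ℂ → ℂ} {ν t : ℂ} (hY : HasDerivAt Y (ν * P.eval (Y t)) t)
    (hg : HasDerivAt g (1 / P.eval (Y t)) (Y t)) (h0 : P.eval (Y t) ≠ 0) :
    HasDerivAt (fun t => g (Y t)) ν t :=
  (hg.comp t hY).congr_deriv (by field_simp)

lemma hasDerivAt_const_mul_id (ν t : ℂ) : HasDerivAt (fun t => ν * t) ν t :=
  ((hasDerivAt_id t).const_mul ν).congr_deriv (mul_one ν)

variable (C : InfinityChart k P)

/-- Near a blow-up point the time is a multiple of the uniformizing coordinate. -/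
lemma near_infty (hinf : K.Φ 0 = OnePoint.infty) {R : ℝ} (hR : C.r⁻¹ ≤ R) (c : ℂ) :
    ∃ ε > 0, ∀ w : ℂ, 0 ≤ w.im → ‖w‖ < ε → K.Φ w ∈ exterior R ∧
      (K.Φ w).elim c (fun z => C.f z + c) = c + period P a * w := by
  have hN : K.Φ ⁻¹' exterior R ∈ 𝓝[{w : ℂ | 0 ≤ w.im}] 0 :=
    (K.continuousOn 0 (by simp)).preimage_mem_nhdsWithin
      (by rw [hinf]; exact (isOpen_exterior R).mem_nhds (infty_mem_exterior R))
  obtain ⟨ε, hε, hb⟩ := Metric.mem_nhdsWithin_iff.1 hN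
  refine ⟨ε, hε, ?_⟩
  have hb : ∀ w : ℂ, 0 ≤ w.im → ‖w‖ < ε → K.Φ w ∈ exterior R := fun w h1 h2 => hb ⟨by simpa using h2, h1⟩
  -- The defect between the two expressions for the time. It is constant on the open half disc,
  -- hence by continuity up to the diameter, and equals `c` at `0`.
  set h : ℂ → ℂ := fun w => (K.Φ w).elim c (fun z => C.f z + c) - period P a * w with hh
  have hcont : ∀ w : ℂ, 0 ≤ w.im → ‖w‖ < ε → ContinuousWithinAt h {w | 0 ≤ w.im} w := fun w h1 h2 => by
    have hprim := C.isLocalPrimitive hR c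
    refine ContinuousWithinAt.sub ?_ (by fun_prop)
    exact ContinuousAt.comp_continuousWithinAt (g := fun y : OnePoint ℂ => y.elim c (fun z => C.f z + c))
      (hprim.2.1.continuousAt (hprim.1.mem_nhds (hb w h1 h2))) (K.continuousOn w h1)
  set S := Metric.ball (0 : ℂ) ε ∩ {w : ℂ | 0 < w.im} with hS
  have hφR : ∀ w ∈ S, C.r⁻¹ < ‖K.φ w‖ := fun w hw => by
    have := hb w (le_of_lt hw.2) (by simpa using hw.1)
    rw [K.Φ_eq w hw.2, coe_mem_exterior] at this
    exact hR.trans_lt this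
  have hconst : ∀ w ∈ S, ∀ w' ∈ S, h w = h w' := fun w hw w' hw' => by
    have h1 : ∀ w ∈ S, h w = (C.f (K.φ w) - period P a * w) + c := fun w hw => by
      simp only [hh]; rw [K.Φ_eq w hw.2, OnePoint.elim_some]; ring
    rw [h1 w hw, h1 w' hw']
    congr 1
    refine sub_eq_sub_of_hasDerivAt (f := fun w => C.f (K.φ w)) (g := fun w => period P a * w)
      (f' := fun _ => period P a)
      (Metric.isOpen_ball.inter (isOpen_im_gt 0))
      ((convex_ball 0 ε).inter (convex_im_gt 0)).isPreconnected (fun x hx => ?_)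
      (fun x _ => hasDerivAt_const_mul_id _ x) hw hw'
    exact hasDerivAt_comp_primitive (K.hasDerivAt x hx.2) (C.hasDerivAt_f (hφR x hx))
      (C.eval_ne' (hφR x hx))
  have hlim : ∀ w : ℂ, 0 ≤ w.im → ‖w‖ < ε → ∀ w' ∈ S, h w' = h w := fun w h1 h2 w' hw' => by
    have := nhdsWithin_upperHalfPlane_neBot h1
    have ht : Tendsto h (𝓝[{w : ℂ | 0 < w.im}] w) (𝓝 (h w)) :=
      (hcont w h1 h2).tendsto.mono_left (nhdsWithin_mono _ fun w (hw : 0 < w.im) => hw.le)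
    refine tendsto_nhds_unique (tendsto_const_nhds.congr' ?_) ht
    filter_upwards [self_mem_nhdsWithin,
      mem_nhdsWithin_of_mem_nhds (Metric.isOpen_ball.mem_nhds (show w ∈ Metric.ball (0:ℂ) ε by simpa using h2))]
      with v hv1 hv2 using hconst w' hw' v ⟨hv2, hv1⟩
  have hS0 : ((ε / 2 : ℝ) : ℂ) * Complex.I ∈ S := by
    refine ⟨?_, ?_⟩
    · rw [mem_ball_zero_iff, norm_mul, Complex.norm_I, mul_one, Complex.norm_real, Real.norm_eq_abs,
        abs_of_pos (half_pos hε)]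
      exact half_lt_self hε
    · simpa using hε
  intro w h1 h2
  refine ⟨hb w h1 h2, ?_⟩
  have e1 := hlim w h1 h2 _ hS0
  have e2 := hlim 0 (by simp) (by simpa using hε) _ hS0
  have e3 : h 0 = c := by simp [hh, hinf]
  have e4 : h w = c := by rw [← e1, e2, e3]
  have e5 : (K.Φ w).elim c (fun z => C.f z + c) - period P a * w = c := e4
  linear_combination e5

include C in
/-- The time along the chart is given by a local branch at every point of the closed half plane. -/
lemma exists_local_branch {w₀ : ℂ} (hw₀ : 0 ≤ w₀.im) (b : ℂ) :
    ∃ (V : Set (OnePoint ℂ)) (f : OnePoint ℂ → ℂ), IsLocalPrimitive P V f ∧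
      IsPreconnected ((↑) ⁻¹' V : Set ℂ) ∧ K.Φ w₀ ∈ V ∧
      ∀ᶠ w in 𝓝[{w : ℂ | 0 ≤ w.im}] w₀, K.Φ w ∈ V ∧ f (K.Φ w) = b + period P a * w := by
  by_cases h : K.Φ w₀ = OnePoint.infty
  · have him : w₀.im = 0 := by
      rcases hw₀.lt_or_eq with h0 | h0
      · rw [K.Φ_eq w₀ h0] at h; exact absurd h (OnePoint.coe_ne_infty _)
      · exact h0.symm
    have hre : (w₀.re : ℂ) = w₀ := Complex.ext (by simp) (by simp [him])
    obtain ⟨ε, hε, hb⟩ := (K.translate w₀.re).near_infty C (by simp [translate_Φ, hre, h]) le_rfl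
      (b + period P a * w₀)
    refine ⟨_, _, C.isLocalPrimitive le_rfl (b + period P a * w₀),
      isPreconnected_coe_preimage_exterior _, by rw [h]; exact infty_mem_exterior _, ?_⟩
    filter_upwards [self_mem_nhdsWithin, mem_nhdsWithin_of_mem_nhds (Metric.ball_mem_nhds w₀ hε)]
      with w h1 h2
    have := hb (w - w₀) (by simpa [him] using h1) (by simpa [dist_eq_norm] using h2)
    rw [translate_Φ, hre, sub_add_cancel] at this
    exact ⟨this.1, this.2.trans (by ring)⟩
  · obtain ⟨Y, ε, hε, hY, hYΦ⟩ := K.extend' hw₀ h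
    have h0 := K.eval_ne_of_extend hw₀ hε hY hYΦ
    obtain ⟨g, r, hr, hg0, hg⟩ := exists_primitive_ball h0 (b + period P a * w₀)
    have hYc : ContinuousAt Y w₀ := (hY w₀ (Metric.mem_ball_self hε)).continuousAt
    obtain ⟨δ, hδ, hδb⟩ := Metric.eventually_nhds_iff_ball.1
      ((hYc.eventually_mem (Metric.ball_mem_nhds _ hr)).and (Metric.ball_mem_nhds w₀ hε))
    refine ⟨_, _, isLocalPrimitive_coe (c := 0) Metric.isOpen_ball (fun w hw => (hg w hw).1)
      (fun w hw => (hg w hw).2), ?_, ?_, ?_⟩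
    · rw [preimage_image_eq _ OnePoint.coe_injective]
      exact (convex_ball _ _).isPreconnected
    · rw [hYΦ w₀ (Metric.mem_ball_self hε) hw₀]
      exact mem_image_of_mem _ (Metric.mem_ball_self hr)
    · filter_upwards [self_mem_nhdsWithin, mem_nhdsWithin_of_mem_nhds (Metric.ball_mem_nhds w₀ hδ)]
        with w h1 h2
      rw [hYΦ w (hδb w h2).2 h1]
      refine ⟨mem_image_of_mem _ (hδb w h2).1, ?_⟩
      rw [OnePoint.elim_some]
      have := sub_eq_sub_of_hasDerivAt (f := fun t => g (Y t)) (g := fun t => period P a * t)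
        (f' := fun _ => period P a) Metric.isOpen_ball (convex_ball w₀ δ).isPreconnected
        (fun x hx => hasDerivAt_comp_primitive (hY x (hδb x hx).2) (hg _ (hδb x hx).1).2
          (hg _ (hδb x hx).1).1)
        (fun x _ => hasDerivAt_const_mul_id _ x) h2
        (Metric.mem_ball_self hδ)
      simp only [hg0] at this
      linear_combination this

/-- In the coordinate `ζ` at `∞` the domain contains a full sector, of opening `π / k`. -/
lemma exists_sector (hk : 1 ≤ k) (hν : period P a ≠ 0) (hinf : K.Φ 0 = OnePoint.infty) {θ : ℝ}
    (hθ : Tendsto (fun r : ℝ => K.φ (r * Complex.I) / (‖K.φ (r * Complex.I)‖ : ℂ)) (𝓝[>] 0)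
      (𝓝 (Complex.exp (θ * Complex.I)))) :
    ∃ (l : ℝ) (ρ : ℝ), 0 < ρ ∧ ∀ x : ℂ, x.re < l → |x.im| < Real.pi / (2 * k) →
      C.r⁻¹ < ‖K.φ (Complex.I * Complex.exp (k * x))‖ ∧
      C.ζ (K.φ (Complex.I * Complex.exp (k * x)))⁻¹ =
        ρ * Complex.exp (-(θ * Complex.I)) * Complex.exp x := by
  have hk0 : (0 : ℝ) < k := by exact_mod_cast hk
  have hkC : (k : ℂ) ≠ 0 := by exact_mod_cast hk0.ne'
  obtain ⟨ε, hε, hb⟩ := K.near_infty C hinf le_rfl 0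
  set l : ℝ := Real.log ε / k with hl
  set S : Set ℂ := {x | x.re < l} ∩ {x | |x.im| < Real.pi / (2 * k)} with hS
  have hSo : IsOpen S := (isOpen_lt Complex.continuous_re continuous_const).inter
    (isOpen_lt (continuous_abs.comp Complex.continuous_im) continuous_const)
  have hSc : Convex ℝ S := by
    refine (convex_halfSpace_re_lt l).inter ?_
    have : {x : ℂ | |x.im| < Real.pi / (2 * k)} =
        {x : ℂ | -(Real.pi / (2 * k)) < x.im} ∩ {x | x.im < Real.pi / (2 * k)} := by
      ext x; simp only [mem_inter_iff, mem_ofPred_eq, abs_lt]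
    rw [this]
    exact (convex_halfSpace_im_gt _).inter (convex_halfSpace_im_lt _)
  have hre : ∀ x : ℂ, ((k : ℂ) * x).re = k * x.re := fun x => by
    rw [← Complex.ofReal_natCast, Complex.re_ofReal_mul]
  have him : ∀ x : ℂ, ((k : ℂ) * x).im = k * x.im := fun x => by
    rw [← Complex.ofReal_natCast, Complex.im_ofReal_mul]
  -- In logarithmic coordinates the upper half plane becomes the strip `|Im x| < π / (2k)`; the
  -- bound `Re x < l` means `|W x| < ε`.
  set W : ℂ → ℂ := fun x => Complex.I * Complex.exp (k * x) with hW
  have hWim : ∀ x ∈ S, 0 < (W x).im := fun x hx => by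
    rw [im_I_mul_exp, him]
    refine mul_pos (Real.exp_pos _) (Real.cos_pos_of_mem_Ioo ?_)
    have h2 := abs_lt.1 (show |x.im| < Real.pi / (2 * k) from hx.2)
    have h3 : k * (Real.pi / (2 * k)) = Real.pi / 2 := by field_simp
    constructor
    · rw [← h3]; nlinarith
    · rw [← h3]; nlinarith
  have hWn : ∀ x ∈ S, ‖W x‖ < ε := fun x hx => by
    rw [norm_I_mul_exp, hre, ← Real.lt_log_iff_exp_lt hε]
    have : x.re < Real.log ε / k := hx.1
    rw [lt_div_iff₀ hk0] at this
    linarith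
  have hφ : ∀ x ∈ S, C.r⁻¹ < ‖K.φ (W x)‖ ∧ C.f (K.φ (W x)) = period P a * W x := fun x hx => by
    obtain ⟨h1, h2⟩ := hb (W x) (hWim x hx).le (hWn x hx)
    rw [K.Φ_eq _ (hWim x hx)] at h1 h2
    exact ⟨coe_mem_exterior.1 h1, by simpa using h2⟩
  -- The relation `κ ζ ^ k = ν w` says that `Q ^ k` is constant; a nonvanishing holomorphic `Q` on a
  -- connected set is then constant itself.
  set Q : ℂ → ℂ := fun x => C.ζ (K.φ (W x))⁻¹ / Complex.exp x with hQ
  have hQk : ∀ x ∈ S, Q x ^ k = period P a * Complex.I / C.κ := fun x hx => by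
    obtain ⟨h1, h2⟩ := hφ x hx
    rw [C.f_eq h1] at h2
    have hexp : Complex.exp x ^ k = Complex.exp (k * x) := by rw [← Complex.exp_nat_mul]
    simp only [hQ]
    rw [div_pow, hexp, div_eq_div_iff (Complex.exp_ne_zero _) C.κ_ne]
    simp only [hW] at h2 ⊢
    linear_combination h2
  have hc0 : period P a * Complex.I / C.κ ≠ 0 := div_ne_zero (mul_ne_zero hν Complex.I_ne_zero) C.κ_ne
  have hQ0 : ∀ x ∈ S, Q x ≠ 0 := fun x hx h => hc0 (by
    rw [← hQk x hx, h, zero_pow (by omega)])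
  have hQd : ∀ x ∈ S, DifferentiableAt ℂ Q x := fun x hx => by
    obtain ⟨h1, -⟩ := hφ x hx
    have hd : DifferentiableAt ℂ (fun x => K.φ (W x)) x :=
      DifferentiableAt.comp (g := K.φ) (f := W) x (K.hasDerivAt _ (hWim x hx)).differentiableAt
        (by simp only [hW]; fun_prop)
    have hd2 : DifferentiableAt ℂ (fun x => C.ζ (K.φ (W x))⁻¹) x :=
      DifferentiableAt.comp (g := C.ζ) (f := fun x => (K.φ (W x))⁻¹) x
        (C.analyticAt_ζ _ (C.inv_mem h1)).differentiableAt (hd.inv (C.ne_zero h1))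
    exact hd2.div (by fun_prop) (Complex.exp_ne_zero _)
  have hQ' : ∀ x ∈ S, deriv Q x = 0 := fun x hx => by
    have h1 := (hQd x hx).hasDerivAt.fun_pow k
    have h2 : HasDerivAt (fun x => Q x ^ k) 0 x := by
      refine (hasDerivAt_const x (period P a * Complex.I / C.κ)).congr_of_eventuallyEq ?_
      filter_upwards [hSo.mem_nhds hx] with y hy using hQk y hy
    have h3 := h1.unique h2
    have h4 := mul_ne_zero hkC (pow_ne_zero (k - 1) (hQ0 x hx))
    exact (mul_eq_zero.1 h3).resolve_left h4
  have hQc : ∀ x ∈ S, ∀ y ∈ S, Q x = Q y := fun x hx y hy =>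
    hSo.is_const_of_deriv_eq_zero hSc.isPreconnected
      (fun x hx => (hQd x hx).differentiableWithinAt) hQ' hx hy
  have hreal : ∀ t : ℝ, t < l → (t : ℂ) ∈ S := fun t ht => by
    refine ⟨by simpa using ht, ?_⟩
    have : 0 < Real.pi / (2 * k) := by positivity
    simpa using this
  set p : ℂ := Q ((l - 1 : ℝ) : ℂ) with hp
  have hp0 : p ≠ 0 := hQ0 _ (hreal _ (by linarith))
  have hQp : ∀ x ∈ S, C.ζ (K.φ (W x))⁻¹ = p * Complex.exp x := fun x hx => by
    rw [hp, hQc _ (hreal _ (by linarith)) x hx]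
    simp only [hQ]
    rw [div_mul_cancel₀ _ (Complex.exp_ne_zero _)]
  -- the direction of the central ray
  have hWr : ∀ t : ℝ, W t = (Real.exp (k * t) : ℝ) * Complex.I := fun t => by
    simp only [hW]; push_cast; ring
  have hr : Tendsto (fun t : ℝ => Real.exp (k * t)) atBot (𝓝[>] 0) := by
    refine tendsto_nhdsWithin_iff.2 ⟨?_, Eventually.of_forall fun t => Real.exp_pos _⟩
    exact Real.tendsto_exp_atBot.comp (tendsto_id.const_mul_atBot hk0)
  have hdir := hθ.comp hr
  have hzinf : Tendsto (fun t : ℝ => K.φ (W t)) atBot (Bornology.cobounded ℂ) := by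
    rw [← tendsto_coe_infty_iff, ← hinf]
    have h1 : Tendsto W (atBot.map ((↑) : ℝ → ℂ)) (𝓝[{w : ℂ | 0 ≤ w.im}] 0) := by
      rw [tendsto_map'_iff]
      refine tendsto_nhdsWithin_iff.2 ⟨?_, ?_⟩
      · have := ((Complex.continuous_ofReal.tendsto 0).comp
          (hr.mono_right nhdsWithin_le_nhds)).mul_const Complex.I
        simp only [Complex.ofReal_zero, zero_mul] at this
        exact this.congr fun t => (hWr t).symm
      · refine Eventually.of_forall fun t => ?_
        show 0 ≤ (W t).im
        rw [hWr, Complex.im_ofReal_mul, Complex.I_im, mul_one]; exact (Real.exp_pos _).le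
    have h2 := (K.continuousOn 0 (by simp)).tendsto.comp (tendsto_map'_iff.1 h1)
    refine h2.congr' ?_
    filter_upwards [eventually_lt_atBot l] with t ht using K.Φ_eq _ (hWim t (hreal t ht))
  have hinv : Tendsto (fun t : ℝ => (K.φ (W t))⁻¹) atBot (𝓝[≠] 0) := by
    refine tendsto_nhdsWithin_iff.2 ⟨tendsto_inv₀_cobounded.comp hzinf, ?_⟩
    filter_upwards [eventually_lt_atBot l] with t ht
    exact inv_ne_zero (C.ne_zero (hφ t (hreal t ht)).1)
  have hone : Tendsto (fun t : ℝ => p * Complex.exp t * K.φ (W t)) atBot (𝓝 1) := by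
    refine (C.tendsto_ζ_div.comp hinv).congr' ?_
    filter_upwards [eventually_lt_atBot l] with t ht
    simp only [Function.comp]
    rw [hQp t (hreal t ht), div_inv_eq_mul]
  -- Since `ζ v ∼ v`, the product `p e^t φ(W t)` tends to `1`. Dividing by moduli leaves only the
  -- direction of `p`, which must be `e^{-iθ}`.
  have hquot : Tendsto (fun t : ℝ => p / ‖p‖ * (K.φ (W t) / ‖K.φ (W t)‖)) atBot (𝓝 1) := by
    have h1 := hone.div ((Complex.continuous_ofReal.tendsto _).comp hone.norm) (by simp)
    simp only [norm_one, Complex.ofReal_one, div_one] at h1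
    refine h1.congr fun t => ?_
    simp only [Pi.div_apply, Function.comp, norm_mul, Complex.norm_exp, Complex.ofReal_re]
    push_cast
    have := Complex.exp_ne_zero (t : ℂ)
    field_simp
  have hfin : p / ‖p‖ * Complex.exp (θ * Complex.I) = 1 := by
    refine tendsto_nhds_unique ((hdir.const_mul (p / (‖p‖ : ℂ))).congr fun t => ?_) hquot
    simp only [Function.comp, hWr]
  have hpeq : p = (‖p‖ : ℝ) * Complex.exp (-(θ * Complex.I)) := by
    have hpn : (‖p‖ : ℂ) ≠ 0 := by exact_mod_cast norm_ne_zero_iff.2 hp0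
    rw [Complex.exp_neg]
    field_simp at hfin ⊢
    linear_combination hfin
  refine ⟨l, ‖p‖, norm_pos_iff.2 hp0, fun x h1 h2 => ⟨(hφ x ⟨h1, h2⟩).1, ?_⟩⟩
  rw [← hpeq]
  exact hQp x ⟨h1, h2⟩

include C in
/-- The domain contains all large points whose direction is close to that of the central ray. -/
lemma eventually_mem_sector (hk : 1 ≤ k) (hν : period P a ≠ 0) (hinf : K.Φ 0 = OnePoint.infty) {θ : ℝ}
    (hθ : Tendsto (fun r : ℝ => K.φ (r * Complex.I) / (‖K.φ (r * Complex.I)‖ : ℂ)) (𝓝[>] 0)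
      (𝓝 (Complex.exp (θ * Complex.I)))) {δ ε : ℝ} (hδ : 0 < δ) (hδk : 3 * δ < Real.pi / (2 * k))
    (hε : 0 < ε) :
    ∀ᶠ z : ℂ in Bornology.cobounded ℂ, ∀ α : ℝ, z = ‖z‖ * Complex.exp (α * Complex.I) →
      |α - θ| ≤ 2 * δ → ∃ w : ℂ, 0 < w.im ∧ ‖w‖ < ε ∧ K.φ w = z ∧ (δ ≤ α - θ → 0 < w.re) ∧
        (α - θ ≤ -δ → w.re < 0) := by
  have hk0 : (0 : ℝ) < k := by exact_mod_cast hk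
  obtain ⟨l, ρ, hρ, hsec⟩ := K.exists_sector C hk hν hinf hθ
  have hinv : Tendsto (fun z : ℂ => z⁻¹) (Bornology.cobounded ℂ) (𝓝[≠] 0) := by
    refine tendsto_nhdsWithin_iff.2 ⟨tendsto_inv₀_cobounded, ?_⟩
    filter_upwards [eventually_norm_gt 0] with z hz
    exact inv_ne_zero (norm_pos_iff.1 hz)
  have hone : Tendsto (fun z : ℂ => C.ζ z⁻¹ / z⁻¹) (Bornology.cobounded ℂ) (𝓝 1) :=
    C.tendsto_ζ_div.comp hinv
  have harg : ∀ᶠ z : ℂ in Bornology.cobounded ℂ, |(C.ζ z⁻¹ / z⁻¹).arg| < δ := by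
    have h1 : ContinuousAt Complex.arg 1 := Complex.continuousAt_arg Complex.one_mem_slitPlane
    have h2 := (h1.tendsto.comp hone).abs
    simp only [Complex.arg_one, abs_zero] at h2
    exact h2.eventually_lt_const hδ
  have hre : Tendsto (fun z : ℂ => Real.log ‖C.ζ z⁻¹ / z⁻¹‖ - Real.log ‖z‖ - Real.log ρ)
      (Bornology.cobounded ℂ) atBot := by
    have h1 : Tendsto (fun z : ℂ => Real.log ‖C.ζ z⁻¹ / z⁻¹‖) (Bornology.cobounded ℂ) (𝓝 0) := by
      have := (Real.continuousAt_log one_ne_zero).tendsto.comp (norm_one (α := ℂ) ▸ hone.norm)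
      rwa [Real.log_one] at this
    have h2 : Tendsto (fun z : ℂ => Real.log ‖z‖) (Bornology.cobounded ℂ) atTop :=
      Real.tendsto_log_atTop.comp tendsto_norm_cobounded_atTop
    have h3 := h1.add_atBot (tendsto_neg_atTop_atBot.comp h2)
    refine (tendsto_atBot_add_const_right _ (-Real.log ρ) h3).congr fun z => ?_
    simp only [Function.comp]; ring
  filter_upwards [harg, hre.eventually_lt_atBot l, hre.eventually_lt_atBot (Real.log ε / k),
    eventually_norm_gt C.r⁻¹, eventually_norm_gt 0] with z h1 h2 h3 h4 h5 α hα hαθ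
  set h : ℂ := C.ζ z⁻¹ / z⁻¹ with hh
  have hz0 : z ≠ 0 := norm_pos_iff.1 h5
  have hh0 : h ≠ 0 := div_ne_zero (C.ζ_ne_zero (C.inv_mem h4) (inv_ne_zero hz0)) (inv_ne_zero hz0)
  -- The solution of `ρ e^{-iθ} e^x = ζ (z⁻¹)`. The argument of `h`, which tends to `1`, costs less
  -- than `δ`, in addition to the `2δ` allowed for `α - θ`; hence the condition on `3 * δ`.
  set x : ℂ := ⟨Real.log ‖h‖ - Real.log ‖z‖ - Real.log ρ, h.arg - (α - θ)⟩ with hx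
  have hxim : |x.im| < Real.pi / (2 * k) := by
    refine lt_of_le_of_lt (abs_sub _ _) ?_
    linarith
  obtain ⟨h6, h7⟩ := hsec x h2 hxim
  have hexp : Complex.exp x = ((‖h‖ / ‖z‖ / ρ : ℝ) : ℂ) *
      (Complex.exp (h.arg * Complex.I) / Complex.exp (α * Complex.I) * Complex.exp (θ * Complex.I)) := by
    have e1 : x = ((Real.log ‖h‖ - Real.log ‖z‖ - Real.log ρ : ℝ) : ℂ) +
        ((h.arg - (α - θ) : ℝ) : ℂ) * Complex.I := by rw [← Complex.mk_eq_add_mul_I]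
    have e2 : Real.exp (Real.log ‖h‖ - Real.log ‖z‖ - Real.log ρ) = ‖h‖ / ‖z‖ / ρ := by
      rw [Real.exp_sub, Real.exp_sub, Real.exp_log (norm_pos_iff.2 hh0), Real.exp_log h5,
        Real.exp_log hρ]
    rw [e1, Complex.exp_add, ← Complex.ofReal_exp, e2, ← Complex.exp_sub, ← Complex.exp_add]
    congr 2; push_cast; ring
  have hζ : C.ζ (K.φ (Complex.I * Complex.exp (k * x)))⁻¹ = C.ζ z⁻¹ := by
    have e3 : C.ζ z⁻¹ = h * z⁻¹ := by rw [hh, div_mul_cancel₀ _ (inv_ne_zero hz0)]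
    have e4 := Complex.norm_mul_exp_arg_mul_I h
    have hρ' : (ρ : ℂ) ≠ 0 := by exact_mod_cast hρ.ne'
    have hz' : (‖z‖ : ℂ) ≠ 0 := by exact_mod_cast h5.ne'
    have e5 : z⁻¹ = (‖z‖ * Complex.exp (α * Complex.I) : ℂ)⁻¹ := by rw [← hα]
    have hE1 := Complex.exp_ne_zero (α * Complex.I)
    have hE2 := Complex.exp_ne_zero (θ * Complex.I)
    rw [h7, hexp, e3, e5, Complex.exp_neg]
    push_cast
    generalize Complex.exp (h.arg * Complex.I) = E at e4
    generalize Complex.exp (θ * Complex.I) = E₁ at hE2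
    generalize Complex.exp (α * Complex.I) = E₂ at hE1
    field_simp
    linear_combination e4
  have hφz : K.φ (Complex.I * Complex.exp (k * x)) = z :=
    inv_injective (C.injOn_ζ (C.inv_mem h6) (C.inv_mem h4) hζ)
  have hkre : ((k : ℂ) * x).re = k * x.re := by rw [← Complex.ofReal_natCast, Complex.re_ofReal_mul]
  have hkim : ((k : ℂ) * x).im = k * x.im := by rw [← Complex.ofReal_natCast, Complex.im_ofReal_mul]
  have hpi : k * (Real.pi / (2 * k)) = Real.pi / 2 := by field_simp
  have hxim' := abs_lt.1 hxim
  have h1' := abs_lt.1 h1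
  have hximv : x.im = h.arg - (α - θ) := rfl
  refine ⟨Complex.I * Complex.exp (k * x), ?_, ?_, hφz, fun hle => ?_, fun hle => ?_⟩
  · rw [im_I_mul_exp, hkim]
    exact mul_pos (Real.exp_pos _) (Real.cos_pos_of_mem_Ioo
      ⟨by rw [← hpi]; nlinarith, by rw [← hpi]; nlinarith⟩)
  · rw [norm_I_mul_exp, hkre, ← Real.lt_log_iff_exp_lt hε]
    have : x.re < Real.log ε / k := h3
    rw [lt_div_iff₀ hk0] at this
    linarith
  -- A direction anti-clockwise of `θ` has `Im x < 0`, that is `Re w > 0`: it lies on the side of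
  -- the strip `0 < Re w < 1`.
  · rw [re_I_mul_exp, hkim]
    have hneg : x.im < 0 := by rw [hximv]; linarith
    have := Real.sin_neg_of_neg_of_neg_pi_lt (x := k * x.im) (mul_neg_of_pos_of_neg hk0 hneg)
      (by have : -(Real.pi / 2) < k * x.im := by rw [← hpi]; nlinarith
          linarith [Real.pi_pos])
    have := mul_neg_of_pos_of_neg (Real.exp_pos (k * x : ℂ).re) this
    linarith
  · rw [re_I_mul_exp, hkim]
    have hpos : 0 < x.im := by rw [hximv]; linarith
    have := Real.sin_pos_of_pos_of_lt_pi (x := k * x.im) (mul_pos hk0 hpos)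
      (by have : k * x.im < Real.pi / 2 := by rw [← hpi]; nlinarith
          linarith [Real.pi_pos])
    have := mul_pos (Real.exp_pos (k * x : ℂ).re) this
    linarith

end PeriodicChart

/-! ### Logarithms off the cuts -/

/-- Partial fractions for the reciprocal of a polynomial with simple zeros. -/
lemma sum_inv_derivative_mul_inv_sub {k : ℕ} {P : Polynomial ℂ} (hdeg : P.natDegree = k + 1)
    {z : Fin (k + 1) → ℂ} (hz : Function.Injective z) (hroot : ∀ j, P.IsRoot (z j)) {x : ℂ}
    (hx : ∀ j, x ≠ z j) :
    ∑ j, (P.derivative.eval (z j))⁻¹ * (x - z j)⁻¹ = 1 / P.eval x := by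
  have hP : P ≠ 0 := by rintro rfl; simp at hdeg
  have hlc : P.leadingCoeff ≠ 0 := Polynomial.leadingCoeff_ne_zero.2 hP
  have hmonic : (Lagrange.nodal Finset.univ z).Monic := Lagrange.nodal_monic
  have hdegN : (Lagrange.nodal Finset.univ z).degree = (k + 1 : ℕ) := by
    rw [Lagrange.degree_nodal, Finset.card_univ, Fintype.card_fin]
  have hdegP : P.degree = (k + 1 : ℕ) := by rw [Polynomial.degree_eq_natDegree hP, hdeg]
  have hPN : P = Polynomial.C P.leadingCoeff * Lagrange.nodal Finset.univ z := by
    refine Polynomial.eq_of_degree_sub_lt_of_eval_index_eq Finset.univ hz.injOn ?_ fun i _ => ?_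
    · rw [Finset.card_univ, Fintype.card_fin, ← hdegP]
      refine Polynomial.degree_sub_lt_left ?_ hP ?_
      · rw [Polynomial.degree_C_mul hlc, hdegN, hdegP]
      · rw [Polynomial.leadingCoeff_mul, Polynomial.leadingCoeff_C, hmonic.leadingCoeff, mul_one]
    · rw [Polynomial.eval_mul, Lagrange.eval_nodal_at_node (Finset.mem_univ i), mul_zero]
      exact hroot i
  -- Partial fractions are Lagrange interpolation of the constant `1` at the zeros.
  have hone := Lagrange.eval_interpolate_not_at_node (s := Finset.univ) (v := z) (x := x) 1
    (fun i _ => hx i)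
  rw [Lagrange.interpolate_one hz.injOn Finset.univ_nonempty, Polynomial.eval_one] at hone
  have hder : ∀ j, P.derivative.eval (z j) =
      P.leadingCoeff * (Lagrange.nodal Finset.univ z).derivative.eval (z j) := fun j => by
    conv_lhs => rw [hPN, Polynomial.derivative_C_mul, Polynomial.eval_mul, Polynomial.eval_C]
  have hev : P.eval x = P.leadingCoeff * (Lagrange.nodal Finset.univ z).eval x := by
    conv_lhs => rw [hPN, Polynomial.eval_mul, Polynomial.eval_C]
  have hN0 : (Lagrange.nodal Finset.univ z).eval x ≠ 0 :=
    Lagrange.eval_nodal_not_at_node fun i _ => hx i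
  have hsum : ∑ j, (P.derivative.eval (z j))⁻¹ * (x - z j)⁻¹ =
      P.leadingCoeff⁻¹ * ∑ j, Lagrange.nodalWeight Finset.univ z j * (x - z j)⁻¹ * (1 : Fin (k + 1) → ℂ) j := by
    rw [Finset.mul_sum]
    refine Finset.sum_congr rfl fun j _ => ?_
    rw [hder, Lagrange.nodalWeight_eq_eval_derivative_nodal (Finset.mem_univ j), Pi.one_apply,
      mul_inv]
    ring
  rw [hsum, hev]
  generalize ∑ j, Lagrange.nodalWeight Finset.univ z j * (x - z j)⁻¹ * (1 : Fin (k + 1) → ℂ) j = T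
    at hone
  field_simp
  linear_combination -hone

/-- A logarithm of `z - a` off a curve that joins `∞` to `a`; the curve is given by the reciprocal
`E` of its distance to a base point `c`. -/
lemma exists_log_off_curve {a c : ℂ} (hca : c ≠ a) {D : Set ℂ} (hD : IsClosed D)
    (E : C(unitInterval, ℂ)) (h0 : E 0 = 0) (h1 : E 1 = (c - a)⁻¹)
    (hE : ∀ z, z ∉ D → ∀ t, 1 + (z - c) * E t ≠ 0) :
    ∃ L : ℂ → ℂ, ∀ z, z ∉ D → HasDerivAt L (1 / (z - a)) z := by
  classical
  let A := (Dᶜ : Set ℂ)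
  -- For `E t = 1 / (c - γ t)` the map is `(z - γ t) / (c - γ t)`. It joins `1` to `(z - a) / (c -
  -- a)` without zeros off the curve, so lifting through `exp` gives the logarithm without any
  -- knowledge of the topology of the complement.
  let H : C(unitInterval × A, {z : ℂ // z ≠ 0}) :=
    ⟨fun q => ⟨1 + ((q.2 : ℂ) - c) * E q.1, hE q.2 q.2.2 q.1⟩,
      Continuous.subtype_mk (by fun_prop) _⟩
  let f : C(A, ℂ) := ⟨fun _ => 0, continuous_const⟩
  have H0 : ∀ q : A, H (0, q) = (fun z : ℂ ↦ (⟨_, z.exp_ne_zero⟩ : {z : ℂ // z ≠ 0})) (f q) := fun q => by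
    refine Subtype.ext ?_
    simp [H, f, h0]
  let Lf := Complex.isCoveringMap_exp.liftHomotopy H f H0
  have hL : ∀ q : A, Complex.exp (Lf (1, q)) = ((q : ℂ) - a) / (c - a) := fun q => by
    have := congrArg Subtype.val (congr_fun (Complex.isCoveringMap_exp.liftHomotopy_lifts H f H0) (1, q))
    have h2 : Complex.exp (Lf (1, q)) = 1 + ((q : ℂ) - c) * E 1 := this
    rw [h2, h1]
    have : c - a ≠ 0 := sub_ne_zero.2 hca
    field_simp
    ring
  let L : ℂ → ℂ := fun z => if h : z ∈ A then Lf (1, ⟨z, h⟩) else 0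
  have hLA : ∀ (z : ℂ) (h : z ∈ A), L z = Lf (1, ⟨z, h⟩) := fun z h => dif_pos h
  have hAo : IsOpen A := hD.isOpen_compl
  have hcont : ContinuousOn L A := by
    rw [continuousOn_iff_continuous_domRestrict]
    have : A.domRestrict L = fun q => Lf (1, q) := funext fun q => hLA q q.2
    rw [this]
    fun_prop
  have hca' : c - a ≠ 0 := sub_ne_zero.2 hca
  have hval : ∀ z ∈ A, Complex.exp (L z) * (c - a) + a = z := fun z hz => by
    rw [hLA z hz, hL]; field_simp; ring
  refine ⟨L, fun z hz => ?_⟩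
  have hd : HasDerivAt (fun w => Complex.exp w * (c - a) + a) (z - a) (L z) := by
    refine (((Complex.hasDerivAt_exp (L z)).mul_const (c - a)).add_const a).congr_deriv ?_
    linear_combination hval z hz
  have hza : z - a ≠ 0 := by
    have := hval z hz
    intro h
    have h2 : Complex.exp (L z) * (c - a) = 0 := by linear_combination this + h
    exact mul_ne_zero (Complex.exp_ne_zero _) hca' h2
  rw [one_div]
  refine HasDerivAt.of_local_left_inverse (hcont.continuousAt (hAo.mem_nhds hz)) hd hza ?_
  filter_upwards [hAo.mem_nhds hz] with y hy using hval y hy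

namespace PeriodicChart
variable {P : Polynomial ℂ} {a : ℂ} (K : PeriodicChart P a)

lemma continuousAt_inv_sub {c : ℂ} {y : OnePoint ℂ} (hy : y ≠ (c : OnePoint ℂ)) :
    ContinuousAt (fun y : OnePoint ℂ => y.elim 0 fun z => (c - z)⁻¹) y := by
  induction y using OnePoint.rec with
  | infty =>
    rw [ContinuousAt, nhds_infty_onePoint, tendsto_sup, tendsto_map'_iff]
    refine ⟨?_, tendsto_pure_nhds _ _⟩
    refine tendsto_inv₀_cobounded.comp ?_
    rw [← tendsto_norm_atTop_iff_cobounded]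
    refine tendsto_atTop_mono (f := fun z : ℂ => ‖z‖ + -‖c‖) (fun z => ?_)
      (tendsto_atTop_add_const_right _ _ tendsto_norm_cobounded_atTop)
    have := norm_sub_norm_le z c
    rw [norm_sub_rev] at this
    linarith
  | coe z =>
    refine OnePoint.continuousAt_coe.2 ?_
    have : c - z ≠ 0 := sub_ne_zero.2 fun h => hy (by rw [h])
    exact ContinuousAt.inv₀ (f := fun z => c - z) (by fun_prop) this

/-- The reciprocal distance to `c` along the central ray of a chart. -/
lemma exists_ray_curve (hinf : K.Φ 0 = OnePoint.infty) {c : ℂ} (hca : c ≠ a)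
    (hc : ∀ r : ℝ, 0 < r → K.φ (r * Complex.I) ≠ c) :
    ∃ E : C(unitInterval, ℂ), E 0 = 0 ∧ E 1 = (c - a)⁻¹ ∧
      ∀ z, z ∈ insert a ((fun r : ℝ => K.φ (r * Complex.I)) '' Ioi 0) ↔
        ∃ t, 1 + (z - c) * E t = 0 := by
  classical
  set e : OnePoint ℂ → ℂ := fun y => y.elim 0 fun z => (c - z)⁻¹ with he
  -- The ray is compactified: `t = 0` corresponds to `∞`, and `t = 1` to the equilibrium `a`.
  set ρ : ℝ → ℝ := fun t => t / (1 - t) with hρ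
  set G : ℝ → OnePoint ℂ := fun t => if t = 1 then (a : OnePoint ℂ) else K.Φ (ρ t * Complex.I) with hG
  have hρ0 : ∀ t : ℝ, 0 ≤ t → t < 1 → 0 ≤ ρ t := fun t h0 h1 => div_nonneg h0 (by linarith)
  have hG1 : ∀ t : ℝ, t < 1 → G t = K.Φ (ρ t * Complex.I) := fun t ht => if_neg ht.ne
  have hGφ : ∀ t : ℝ, 0 < t → t < 1 → G t = K.φ (ρ t * Complex.I) := fun t h0 h1 => by
    rw [hG1 t h1, K.Φ_eq]
    simpa using div_pos h0 (by linarith : 0 < 1 - t)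
  have hG0 : G 0 = OnePoint.infty := by rw [hG1 0 one_pos]; simp [hρ, hinf]
  have hGcont : ContinuousOn G (Icc 0 1) := by
    intro t ht
    rcases ht.2.lt_or_eq with h1 | h1
    · have hc1 : ContinuousWithinAt (fun t : ℝ => K.Φ (ρ t * Complex.I)) (Icc 0 1 ∩ Iio 1) t := by
        refine ContinuousWithinAt.comp (t := {w : ℂ | 0 ≤ w.im})
          (K.continuousOn _ (by simpa using hρ0 t ht.1 h1)) ?_ fun s hs => by
            simpa using hρ0 s hs.1.1 hs.2
        refine ContinuousAt.continuousWithinAt ?_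
        refine (Complex.continuous_ofReal.continuousAt.comp (f := ρ) ?_).mul continuousAt_const
        exact continuousAt_id.div (by fun_prop) (by linarith : (1 - t) ≠ 0)
      refine (continuousWithinAt_inter (Iio_mem_nhds h1)).1 ?_
      exact hc1.congr (fun s hs => hG1 s hs.2) (hG1 t h1)
    · subst h1
      have hlim : Tendsto (fun t : ℝ => K.φ (0 + ρ t * Complex.I)) (𝓝[<] 1) (𝓝 a) := by
        refine (K.tendsto_vertical 0 Complex.I (l := atTop) ?_).comp ?_
        · exact tendsto_id.congr fun s => by simp
        · have h1 : Tendsto (fun t : ℝ => 1 - t) (𝓝[<] 1) (𝓝[>] 0) := by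
            refine tendsto_nhdsWithin_iff.2 ⟨?_, ?_⟩
            · have : Tendsto (fun t : ℝ => 1 - t) (𝓝 1) (𝓝 (1 - 1)) := by
                exact (continuous_const.sub continuous_id).tendsto 1
              rw [sub_self] at this
              exact this.mono_left nhdsWithin_le_nhds
            · filter_upwards [self_mem_nhdsWithin] with t ht
              simpa using ht
          have h2 : Tendsto (fun t : ℝ => t) (𝓝[<] 1) (𝓝 1) := tendsto_id.mono_left nhdsWithin_le_nhds
          have := h2.pos_mul_atTop one_pos (tendsto_inv_nhdsGT_zero.comp h1)
          exact this.congr fun t => by simp [hρ, div_eq_mul_inv]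
      have hcl : ContinuousWithinAt G (Iio 1) 1 := by
        rw [ContinuousWithinAt, show G 1 = (a : OnePoint ℂ) from if_pos rfl]
        refine (tendsto_coe_coe_iff.2 hlim).congr' ?_
        filter_upwards [Ioo_mem_nhdsLT (zero_lt_one (α := ℝ))] with t ht
        rw [hGφ t ht.1 ht.2, zero_add]
      exact (continuousWithinAt_insert_self.2 hcl).mono fun t ht => by
        rcases ht.2.lt_or_eq with h | h
        · exact Or.inr h
        · exact Or.inl h
  have hGc : ∀ t ∈ Icc (0 : ℝ) 1, G t ≠ (c : OnePoint ℂ) := fun t ht => by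
    rcases ht.2.lt_or_eq with h1 | h1
    · rcases ht.1.lt_or_eq with h0 | h0
      · rw [hGφ t h0 h1]
        exact fun h => hc _ (div_pos h0 (by linarith)) (OnePoint.coe_injective h)
      · rw [← h0, hG0]; exact (OnePoint.coe_ne_infty c).symm
    · rw [h1, show G 1 = (a : OnePoint ℂ) from if_pos rfl]
      exact fun h => hca (OnePoint.coe_injective h).symm
  have hEc : ContinuousOn (fun t => e (G t)) (Icc 0 1) := fun t ht =>
    (continuousAt_inv_sub (hGc t ht)).comp_continuousWithinAt (hGcont t ht)
  have hv0 : e (G 0) = 0 := by rw [hG0]; rfl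
  have hv1 : e (G 1) = (c - a)⁻¹ := by rw [show G 1 = (a : OnePoint ℂ) from if_pos rfl]; rfl
  have hz : ∀ z u : ℂ, u ≠ c → (1 + (z - c) * (c - u)⁻¹ = 0 ↔ z = u) := fun z u hu => by
    have : c - u ≠ 0 := sub_ne_zero.2 hu.symm
    field_simp
    constructor
    · intro h; linear_combination h
    · intro h; linear_combination h
  refine ⟨⟨fun t => e (G t), by
    have := continuousOn_iff_continuous_domRestrict.1 hEc
    exact this⟩, hv0, hv1, fun z => ⟨?_, ?_⟩⟩
  · rintro (rfl | ⟨r, hr, rfl⟩)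
    · refine ⟨1, ?_⟩
      show 1 + (z - c) * e (G 1) = 0
      rw [hv1]
      exact (hz z z hca.symm).2 rfl
    · have hr : 0 < r := hr
      have h1 : 0 < r / (1 + r) := by positivity
      have h2 : r / (1 + r) < 1 := by rw [div_lt_one (by positivity)]; linarith
      refine ⟨⟨r / (1 + r), h1.le, h2.le⟩, ?_⟩
      show 1 + (K.φ (r * Complex.I) - c) * e (G (r / (1 + r))) = 0
      have h3 : ρ (r / (1 + r)) = r := by
        simp only [hρ]
        have : 1 + r ≠ 0 := by positivity
        field_simp
        ring
      rw [hGφ _ h1 h2, h3]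
      exact (hz _ _ (hc r hr)).2 rfl
  · rintro ⟨⟨t, ht⟩, h⟩
    have h : 1 + (z - c) * e (G t) = 0 := h
    rcases ht.2.lt_or_eq with h1 | h1
    · rcases ht.1.lt_or_eq with h0 | h0
      · have hpos : 0 < ρ t := div_pos h0 (by linarith)
        rw [hGφ t h0 h1] at h
        exact Or.inr ⟨ρ t, hpos, ((hz _ _ (hc _ hpos)).1 h).symm⟩
      · rw [← h0, hv0, mul_zero, add_zero] at h
        exact absurd h one_ne_zero
    · rw [h1, hv1] at h
      exact Or.inl ((hz _ _ hca.symm).1 h)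

/-- The image of `1/2 + i` is the base point `c` off the cut: its real part is not an integer. -/
lemma ray_ne (r : ℝ) (hr : 0 < r) : K.φ (r * Complex.I) ≠ K.φ (1 / 2 + Complex.I) := fun h => by
  obtain ⟨n, hn⟩ := K.inj _ _ (by simpa using hr) (by simp) h
  have h1 := congrArg Complex.re hn
  simp at h1
  have h2 : (2 : ℝ)⁻¹ = n := h1
  have h3 : (1 : ℤ) = 2 * n := by
    have : (1 : ℝ) = 2 * n := by rw [← h2]; norm_num
    exact_mod_cast this
  omega

/-- The cut along the central ray is closed and admits a logarithm of `z - a` off it. -/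
lemma isClosed_ray_and_exists_log (ha : P.IsRoot a) (hinf : K.Φ 0 = OnePoint.infty) :
    IsClosed (insert a ((fun r : ℝ => K.φ (r * Complex.I)) '' Ioi 0)) ∧
    ∃ L : ℂ → ℂ, ∀ z, z ∉ insert a ((fun r : ℝ => K.φ (r * Complex.I)) '' Ioi 0) →
      HasDerivAt L (1 / (z - a)) z := by
  have hca : K.φ (1 / 2 + Complex.I) ≠ a := fun h => K.eval_ne (1 / 2 + Complex.I) (by simp) (by
    rw [h]; exact ha)
  obtain ⟨E, h0, h1, hE⟩ := K.exists_ray_curve hinf hca K.ray_ne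
  have hcl : IsClosed (insert a ((fun r : ℝ => K.φ (r * Complex.I)) '' Ioi 0)) := by
    -- The cut is the projection of a closed set along the compact factor `[0, 1]`.
    have : insert a ((fun r : ℝ => K.φ (r * Complex.I)) '' Ioi 0) =
        Prod.snd '' {q : unitInterval × ℂ | 1 + (q.2 - K.φ (1 / 2 + Complex.I)) * E q.1 = 0} := by
      ext z
      rw [hE]
      constructor
      · rintro ⟨t, ht⟩; exact ⟨(t, z), ht, rfl⟩
      · rintro ⟨⟨t, z⟩, ht, rfl⟩; exact ⟨t, ht⟩
    rw [this]
    exact isClosedMap_snd_of_compactSpace _ (isClosed_eq (by fun_prop) continuous_const)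
  exact ⟨hcl, exists_log_off_curve hca hcl E h0 h1 fun z hz t ht => hz ((hE z).2 ⟨t, ht⟩)⟩

end PeriodicChart

/-! ### Angular sectors between consecutive directions -/

section Angles
variable {k : ℕ} {θ : Fin (k + 1) → ℝ}

/-- The angle that follows `θ j` in the cyclic order. -/
noncomputable def nextAngle (θ : Fin (k + 1) → ℝ) (j : Fin (k + 1)) : ℝ :=
  if j = Fin.last k then θ 0 + 2 * Real.pi else θ (j + 1)

lemma exp_nextAngle (θ : Fin (k + 1) → ℝ) (j : Fin (k + 1)) :
    ∃ n : ℤ, nextAngle θ j = θ (j + 1) + n * (2 * Real.pi) := by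
  rw [nextAngle]
  split_ifs with h
  · exact ⟨1, by rw [h, Fin.last_add_one]; push_cast; ring⟩
  · exact ⟨0, by simp⟩

lemma lt_add_one_of_ne_last {j : Fin (k + 1)} (h : j ≠ Fin.last k) : j < j + 1 :=
  Fin.lt_add_one_iff.2 (lt_of_le_of_ne (Fin.le_last j) h)

lemma lt_nextAngle (hθ : StrictMono θ) (hlast : θ (Fin.last k) < θ 0 + 2 * Real.pi) (j : Fin (k + 1)) :
    θ j < nextAngle θ j := by
  rw [nextAngle]
  split_ifs with h
  · rwa [h]
  · exact hθ (lt_add_one_of_ne_last h)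

/-- The angle is moved into the period starting at `θ 0 - δ`, and `j` is the last index with `θ j -
δ` below it. The shift by `δ` puts the directions just before `θ j` into the sector of index `j`. -/
lemma exists_angle_sector (θ : Fin (k + 1) → ℝ) (α₀ δ : ℝ) :
    ∃ (n : ℤ) (j : Fin (k + 1)), θ j - δ ≤ α₀ + n * (2 * Real.pi) ∧
      α₀ + n * (2 * Real.pi) < nextAngle θ j - δ := by
  obtain ⟨h1, h2⟩ := toIcoMod_mem_Ico Real.two_pi_pos (θ 0 - δ) α₀
  set n : ℤ := -toIcoDiv Real.two_pi_pos (θ 0 - δ) α₀ with hn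
  have hα : toIcoMod Real.two_pi_pos (θ 0 - δ) α₀ = α₀ + n * (2 * Real.pi) := by
    rw [toIcoMod, hn, zsmul_eq_mul]; push_cast; ring
  rw [hα] at h1 h2
  obtain ⟨j, hj, hmax⟩ := (Finset.univ.filter fun j => θ j - δ ≤ α₀ + n * (2 * Real.pi)).exists_max_image
    id ⟨0, by simpa using h1⟩
  refine ⟨n, j, (Finset.mem_filter.1 hj).2, ?_⟩
  rw [nextAngle]
  split_ifs with h
  · linarith
  · by_contra hcon
    push Not at hcon
    have := hmax (j + 1) (Finset.mem_filter.2 ⟨Finset.mem_univ _, hcon⟩)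
    exact absurd (lt_add_one_of_ne_last h) (not_lt.2 this)

/-- Away from the ends of its gap, `α` has distance at least `δ` from every `θ i` modulo `2π`; the
cosine expresses this independently of the multiple of `2π`. -/
lemma cos_sub_le (hθ : StrictMono θ) (hlast : θ (Fin.last k) < θ 0 + 2 * Real.pi) {δ : ℝ} (hδ : 0 ≤ δ)
    {j : Fin (k + 1)} {α : ℝ} (h1 : θ j + δ ≤ α) (h2 : α ≤ nextAngle θ j - δ)
    (i : Fin (k + 1)) : Real.cos (α - θ i) ≤ Real.cos δ := by
  have key : ∀ x : ℝ, δ ≤ x → x ≤ 2 * Real.pi - δ → Real.cos x ≤ Real.cos δ := fun x hx1 hx2 => by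
    rcases le_total x Real.pi with h | h
    · exact Real.cos_le_cos_of_nonneg_of_le_pi hδ h hx1
    · rw [← Real.cos_two_pi_sub x]
      exact Real.cos_le_cos_of_nonneg_of_le_pi hδ (by linarith) (by linarith)
  have hmono := hθ.monotone
  have h0 : ∀ i, θ 0 ≤ θ i := fun i => hmono (Fin.zero_le i)
  have hl : ∀ i, θ i ≤ θ (Fin.last k) := fun i => hmono (Fin.le_last i)
  rcases le_or_gt i j with hij | hij
  · refine key _ (by linarith [hmono hij]) ?_
    have : nextAngle θ j ≤ θ 0 + 2 * Real.pi := by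
      rw [nextAngle]
      split_ifs with h
      · exact le_rfl
      · exact (hl _).trans hlast.le
    linarith [h0 i]
  · rw [← Real.cos_neg, neg_sub]
    have hj : j ≠ Fin.last k := fun h => absurd (Fin.le_last i) (not_le.2 (h ▸ hij))
    rw [nextAngle, if_neg hj] at h2
    have := hmono (Fin.add_one_le_of_lt hij)
    exact key _ (by linarith) (by linarith [h0 j, hl i])

end Angles

lemma notMem_cut_of_mem {k : ℕ} {D : Fin (k + 1) → Set ℂ} {u : ℂ} (hu : u ∈ cutPlane D) (j : Fin (k + 1)) : u ∉ D j := fun h =>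
  hu (mem_iUnion.2 ⟨j, h⟩)

lemma ne_int_of_mem_Ioo {x : ℝ} (h0 : 0 < x) (h1 : x < 1) (n : ℤ) : x ≠ n := by
  rintro rfl
  have h0 : 0 < n := by exact_mod_cast h0
  have h1 : n < 1 := by exact_mod_cast h1
  omega

/-! ### Charts adapted to the cuts and existence of a branch of time -/

/-- Uniformizing charts for the periodic domains that are adapted to a system of cuts. -/
structure CutCharts {k : ℕ} (P : Polynomial ℂ) (z : Fin (k + 1) → ℂ) (D : Fin (k + 1) → Set ℂ) where
  C : InfinityChart k P
  K : ∀ j, PeriodicChart P (z j)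
  hk : 1 ≤ k
  natDegree : P.natDegree = k + 1
  simple : ∀ j, P.derivative.eval (z j) ≠ 0
  injective : Function.Injective z
  root : ∀ a, P.IsRoot a ↔ a ∈ range z
  infty : ∀ j, (K j).Φ 0 = OnePoint.infty
  cut_eq : ∀ j, D j = insert (z j) ((fun r : ℝ => (K j).φ (r * Complex.I)) '' Ioi 0)
  θ : Fin (k + 1) → ℝ
  strictMono : StrictMono θ
  last_lt : θ (Fin.last k) < θ 0 + 2 * Real.pi
  tendsto_dir : ∀ j, Tendsto (fun w : ℂ => w / (‖w‖ : ℂ)) (Bornology.cobounded ℂ ⊓ 𝓟 (D j))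
      (𝓝 (Complex.exp (θ j * Complex.I)))

/-- Each chart is translated by the blow-up point under its cut, which places the cut on the
positive imaginary axis. -/
lemma exists_cutCharts {k : ℕ} (hk : 1 ≤ k) {P : Polynomial ℂ} (hdeg : P.natDegree = k + 1)
    (hsimple : ∀ a : ℂ, P.IsRoot a → P.derivative.eval a ≠ 0)
    {z : Fin (k + 1) → ℂ} {D : Fin (k + 1) → Set ℂ} (hD : IsCutSystem P z D) :
    Nonempty (CutCharts P z D) := by
  obtain ⟨hinj, hroot, hcut, θ, hθ, hlast, hdir⟩ := hD
  obtain ⟨C⟩ := exists_infinityChart k hk P hdeg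
  have hr : ∀ j, P.IsRoot (z j) := fun j => (hroot _).2 ⟨j, rfl⟩
  have h : ∀ j, ∃ K : PeriodicChart P (z j), K.Φ 0 = OnePoint.infty ∧
      D j = insert (z j) ((fun r : ℝ => K.φ (r * Complex.I)) '' Ioi 0) := fun j => by
    obtain ⟨K⟩ := exists_periodicChart C hsimple (hr j)
    obtain ⟨x, hx, hDx⟩ := K.exists_of_isCut (hsimple _ (hr j)) (hr j) (hcut j)
    refine ⟨K.translate x, by simpa [PeriodicChart.translate_Φ] using hx, ?_⟩
    rw [hDx]
    simp only [PeriodicChart.translate_φ, add_comm]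
  choose K hK hDK using h
  exact ⟨⟨C, K, hk, hdeg, fun j => hsimple _ (hr j), hinj, hroot, hK, hDK, θ, hθ, hlast, hdir⟩⟩

namespace CutCharts
variable {k : ℕ} {P : Polynomial ℂ} {z : Fin (k + 1) → ℂ} {D : Fin (k + 1) → Set ℂ}
  (S : CutCharts P z D)
include S

lemma isRoot (j : Fin (k + 1)) : P.IsRoot (z j) := (S.root _).2 ⟨j, rfl⟩

lemma period_ne (j : Fin (k + 1)) : period P (z j) ≠ 0 := period_ne_zero (S.simple j)

lemma disjoint {i j : Fin (k + 1)} (hij : i ≠ j) : Disjoint (S.K i).domain (S.K j).domain :=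
  (S.K i).disjoint_domain (S.K j) S.C (S.isRoot i) (S.isRoot j) (S.simple i) (S.simple j)
    fun h => hij (S.injective h)

lemma eq_of_mem {i j : Fin (k + 1)} {u : ℂ} (hi : u ∈ (S.K i).domain) (hj : u ∈ (S.K j).domain) :
    i = j := by
  by_contra h
  exact Set.disjoint_left.1 (S.disjoint h) hi hj

lemma φ_mem (j : Fin (k + 1)) {w : ℂ} (hw : 0 < w.im) : (S.K j).φ w ∈ (S.K j).domain :=
  Or.inr ⟨w, hw, rfl⟩

lemma cut_subset_domain (j : Fin (k + 1)) : D j ⊆ (S.K j).domain := by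
  rw [S.cut_eq j]
  rintro _ (rfl | ⟨r, hr, rfl⟩)
  · exact Or.inl rfl
  · exact S.φ_mem j (by simpa using hr)

lemma φ_ne (j : Fin (k + 1)) {w : ℂ} (hw : 0 < w.im) (i : Fin (k + 1)) : (S.K j).φ w ≠ z i := fun h =>
  (S.K j).eval_ne w hw (by rw [h]; exact S.isRoot i)

/-- Domains are disjoint, so a domain meets only its own cut; by periodicity the preimage of the
latter consists of all vertical lines over the integers. -/
lemma φ_mem_cut_iff (i j : Fin (k + 1)) {w : ℂ} (hw : 0 < w.im) :
    (S.K j).φ w ∈ D i ↔ i = j ∧ ∃ n : ℤ, w.re = n := by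
  constructor
  · intro h
    obtain rfl := S.eq_of_mem (S.cut_subset_domain i h) (S.φ_mem j hw)
    refine ⟨rfl, ?_⟩
    rw [S.cut_eq] at h
    rcases h with h | ⟨r, hr, h⟩
    · exact absurd h (S.φ_ne i hw i)
    · obtain ⟨n, hn⟩ := (S.K i).inj _ _ (by simpa using hr) hw h
      exact ⟨n, by rw [hn]; simp⟩
  · rintro ⟨rfl, n, hn⟩
    rw [S.cut_eq]
    refine Or.inr ⟨w.im, hw, ?_⟩
    have h1 := (S.K i).φ_add_int n (w := (w.im : ℂ) * Complex.I) (by simpa using hw)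
    show (S.K i).φ (w.im * Complex.I) = (S.K i).φ w
    rw [← h1]
    congr 1
    exact Complex.ext (by simp [hn]) (by simp)

lemma φ_mem_cutPlane (j : Fin (k + 1)) {w : ℂ} (hw : 0 < w.im) (hre : ∀ n : ℤ, w.re ≠ n) :
    (S.K j).φ w ∈ cutPlane D := by
  rw [cutPlane, mem_compl_iff, mem_iUnion]
  rintro ⟨i, hi⟩
  obtain ⟨-, n, hn⟩ := (S.φ_mem_cut_iff i j hw).1 hi
  exact hre n hn

lemma isOpen_cutPlane : IsOpen (cutPlane D) := by
  refine (isClosed_iUnion_of_finite fun j => ?_).isOpen_compl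
  rw [S.cut_eq]
  exact ((S.K j).isClosed_ray_and_exists_log (S.isRoot j) (S.infty j)).1

lemma center_mem_cut (j : Fin (k + 1)) : z j ∈ D j := by rw [S.cut_eq]; exact Or.inl rfl

lemma eval_ne_of_mem {u : ℂ} (hu : u ∈ cutPlane D) : P.eval u ≠ 0 := fun h => by
  obtain ⟨j, rfl⟩ := (S.root u).1 h
  exact notMem_cut_of_mem hu j (S.center_mem_cut j)

/-- The residues of `1 / P` times logarithms of `u - z j`, each defined off its own cut. -/
lemma exists_primitive : ∃ τ : ℂ → ℂ, ∀ u ∈ cutPlane D, HasDerivAt τ (1 / P.eval u) u := by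
  have h : ∀ j, ∃ L : ℂ → ℂ, ∀ u, u ∉ D j → HasDerivAt L (1 / (u - z j)) u := fun j => by
    obtain ⟨L, hL⟩ := ((S.K j).isClosed_ray_and_exists_log (S.isRoot j) (S.infty j)).2
    exact ⟨L, by rw [S.cut_eq]; exact hL⟩
  choose L hL using h
  refine ⟨fun u => ∑ j, (P.derivative.eval (z j))⁻¹ * L j u, fun u hu => ?_⟩
  have hd := HasDerivAt.fun_sum (u := Finset.univ) (A := fun j u => (P.derivative.eval (z j))⁻¹ * L j u)
    (A' := fun j => (P.derivative.eval (z j))⁻¹ * (1 / (u - z j))) (x := u)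
    fun j _ => (hL j u (notMem_cut_of_mem hu j)).const_mul _
  refine hd.congr_deriv ?_
  have hne : ∀ j, u ≠ z j := fun j h => notMem_cut_of_mem hu j (by rw [h]; exact S.center_mem_cut j)
  rw [← sum_inv_derivative_mul_inv_sub S.natDegree S.injective S.isRoot hne]
  simp [one_div]

/-- The open strip of width one. -/
lemma isPreconnected_strip_image (j : Fin (k + 1)) :
    IsPreconnected ((S.K j).φ '' {w | 0 < w.re ∧ w.re < 1 ∧ 0 < w.im}) := by
  have hc : Convex ℝ {w : ℂ | 0 < w.re ∧ w.re < 1 ∧ 0 < w.im} :=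
    (convex_halfSpace_re_gt 0).inter ((convex_halfSpace_re_lt 1).inter (convex_im_gt 0))
  exact hc.isPreconnected.image _ fun w hw => ((S.K j).hasDerivAt w hw.2.2).continuousAt.continuousWithinAt

lemma strip_image_subset (j : Fin (k + 1)) :
    (S.K j).φ '' {w | 0 < w.re ∧ w.re < 1 ∧ 0 < w.im} ⊆ cutPlane D := by
  rintro _ ⟨w, hw, rfl⟩
  exact S.φ_mem_cutPlane j hw.2.2 (ne_int_of_mem_Ioo hw.1 hw.2.1)

lemma domain_diff_cut_subset (j : Fin (k + 1)) :
    (S.K j).domain \ D j ⊆ (S.K j).φ '' {w | 0 < w.re ∧ w.re < 1 ∧ 0 < w.im} := by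
  rintro u ⟨h1 | ⟨w, hw, rfl⟩, h2⟩
  · exact absurd (h1 ▸ S.center_mem_cut j) h2
  · have hw : 0 < w.im := hw
    obtain ⟨w', hre, him, -, n, hn⟩ := (S.K j).exists_fundamental w hw.le
    have hφ : (S.K j).φ w' = (S.K j).φ w := by rw [hn, (S.K j).φ_add_int n hw]
    refine ⟨w', ⟨lt_of_le_of_ne hre.1 fun h => h2 ?_, hre.2, by rwa [him]⟩, hφ⟩
    rw [← hφ]
    exact (S.φ_mem_cut_iff j j (by rwa [him])).2 ⟨rfl, 0, by simp [← h]⟩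

lemma tendsto_fin_ray (j : Fin (k + 1)) (d : ℂ) (hd : 0 < d.im) :
    Tendsto (fun r : ℝ => (S.K j).φ (r * d)) (𝓝[>] 0) (Bornology.cobounded ℂ) := by
  rw [← tendsto_coe_infty_iff]
  have hc := (S.K j).continuousOn_line (w := 0) (d := d) (S := Ici 0) fun s hs => by
    simpa using mul_nonneg hs hd.le
  have := (hc 0 self_mem_Ici).tendsto
  simp only [zero_add, Complex.ofReal_zero, zero_mul, S.infty j] at this
  refine (this.mono_left (nhdsWithin_mono _ Ioi_subset_Ici_self)).congr' ?_
  filter_upwards [self_mem_nhdsWithin] with r hr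
  exact (S.K j).Φ_eq _ (by simpa using mul_pos (show 0 < r from hr) hd)

/-- Every component of the cut plane contains points near `∞`. -/
lemma exists_large_mem_component {u : ℂ} (hu : u ∈ cutPlane D) (R : ℝ) :
    ∃ u' ∈ connectedComponentIn (cutPlane D) u, R < ‖u'‖ := by
  set V := connectedComponentIn (cutPlane D) u with hV
  by_contra hcon
  push Not at hcon
  have hVo : IsOpen V := S.isOpen_cutPlane.connectedComponentIn
  have hVne : V.Nonempty := ⟨u, mem_connectedComponentIn hu⟩
  have hVuniv : V ≠ univ := fun h => by
    obtain ⟨u', hu'⟩ := (eventually_norm_gt R).exists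
    exact absurd (hcon u' (h ▸ mem_univ _)) (not_le.2 hu')
  -- a boundary point of the component lies on some cut
  obtain ⟨d, hdV, hd⟩ : ∃ d ∈ closure V, d ∉ V := by
    by_contra h
    push Not at h
    have hcl : IsClosed V := isClosed_of_closure_subset h
    rcases isClopen_iff.1 ⟨hcl, hVo⟩ with h | h
    · exact hVne.ne_empty h
    · exact hVuniv h
  have hdU : d ∉ cutPlane D := fun hdU => by
    obtain ⟨y, hy1, hy2⟩ := mem_closure_iff.1 hdV _ S.isOpen_cutPlane.connectedComponentIn
      (mem_connectedComponentIn hdU)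
    have h1 := connectedComponentIn_eq hy1
    have h2 := connectedComponentIn_eq hy2
    apply hd
    rw [hV, h2, ← h1]
    exact mem_connectedComponentIn hdU
  rw [cutPlane, mem_compl_iff, not_not, mem_iUnion] at hdU
  obtain ⟨j, hj⟩ := hdU
  obtain ⟨y, hyB, hyV⟩ := mem_closure_iff.1 hdV _ (S.K j).isOpen_domain (S.cut_subset_domain j hj)
  have hyU : y ∈ cutPlane D := connectedComponentIn_subset _ _ hyV
  have hy := S.domain_diff_cut_subset j ⟨hyB, notMem_cut_of_mem hyU j⟩
  -- Near the cut through `d` the component meets the domain minus its cut. It thus contains the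
  -- whole connected strip image, which reaches `∞`.
  have hsub : (S.K j).φ '' {w | 0 < w.re ∧ w.re < 1 ∧ 0 < w.im} ⊆ V := by
    rw [hV, connectedComponentIn_eq hyV]
    exact (S.isPreconnected_strip_image j).subset_connectedComponentIn hy (S.strip_image_subset j)
  have h1 := (S.tendsto_fin_ray j (1 / 2 + Complex.I) (by simp)).eventually (eventually_norm_gt R)
  obtain ⟨r, hr, hr0, hr1⟩ := (h1.and (Ioo_mem_nhdsGT (zero_lt_one (α := ℝ)))).exists
  refine absurd (hcon _ (hsub ⟨_, ⟨?_, ?_, ?_⟩, rfl⟩)) (not_le.2 hr)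
  · simp; linarith
  · simp; linarith
  · simpa using hr0

/-- A primitive is an integral from `∞` only for the right constant. This is fixed on each component
by a point near `∞`, where `C.f` is a time value, so connectedness of the cut plane is not needed.
-/
theorem exists_isTimeBranch : ∃ τ : ℂ → ℂ, IsTimeBranch P (cutPlane D) τ := by
  classical
  obtain ⟨τ₀, hτ₀⟩ := S.exists_primitive
  -- one normalization per component
  let good : Set ℂ → ℂ → Prop := fun V u' => u' ∈ V ∧ S.C.r⁻¹ < ‖u'‖
  let pick : Set ℂ → ℂ := fun V => if h : ∃ u', good V u' then h.choose else 0
  have hpick : ∀ u ∈ cutPlane D, good (connectedComponentIn (cutPlane D) u)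
      (pick (connectedComponentIn (cutPlane D) u)) := fun u hu => by
    have hex : ∃ u', good (connectedComponentIn (cutPlane D) u) u' :=
      S.exists_large_mem_component hu _
    simp only [pick, dif_pos hex]
    exact hex.choose_spec
  let c : Set ℂ → ℂ := fun V => S.C.f (pick V) - τ₀ (pick V)
  refine ⟨fun u => τ₀ u + c (connectedComponentIn (cutPlane D) u), fun u hu => ⟨?_, ?_⟩⟩
  · obtain ⟨h1, h2⟩ := hpick u hu
    set V := connectedComponentIn (cutPlane D) u with hV
    have hVU : V ⊆ cutPlane D := connectedComponentIn_subset _ _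
    refine (Reach.propagate (g := fun u => τ₀ u + c V) S.isOpen_cutPlane.connectedComponentIn
      isPreconnected_connectedComponentIn (fun w hw => S.eval_ne_of_mem (hVU hw))
      (fun w hw => (hτ₀ w (hVU hw)).add_const _) h1 ?_ (mem_connectedComponentIn hu)).isTimeValue
    have := S.C.reach h2
    simp only [c]
    rwa [add_sub_cancel]
  · refine ((hτ₀ u hu).add_const (c (connectedComponentIn (cutPlane D) u))).congr_of_eventuallyEq ?_
    filter_upwards [S.isOpen_cutPlane.connectedComponentIn.mem_nhds (mem_connectedComponentIn hu)]
      with v hv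
    rw [connectedComponentIn_eq hv]

end CutCharts

/-! ### The branch of time near infinity -/

namespace CutCharts
variable {k : ℕ} {P : Polynomial ℂ} {z : Fin (k + 1) → ℂ} {D : Fin (k + 1) → Set ℂ}
  (S : CutCharts P z D)

/-- The time of the branch `τ` at the blow-up point of the chart, approached on the side of the
strip. -/
noncomputable def base (τ : ℂ → ℂ) (j : Fin (k + 1)) : ℂ :=
  τ ((S.K j).φ (1 / 2 + Complex.I)) - period P (z j) * (1 / 2 + Complex.I)

variable {τ : ℂ → ℂ} (hτ : ∀ u ∈ cutPlane D, HasDerivAt τ (1 / P.eval u) u)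
include hτ

/-- Both sides have derivative `ν` on the strip, where `φ` avoids the cuts, and `base` makes them
agree at `1/2 + i`. -/
lemma branch_strip (j : Fin (k + 1)) {w : ℂ} (h0 : 0 < w.re) (h1 : w.re < 1) (hw : 0 < w.im) :
    τ ((S.K j).φ w) = S.base τ j + period P (z j) * w := by
  have hc : Convex ℝ {w : ℂ | 0 < w.re ∧ w.re < 1 ∧ 0 < w.im} :=
    (convex_halfSpace_re_gt 0).inter ((convex_halfSpace_re_lt 1).inter (convex_im_gt 0))
  have ho : IsOpen {w : ℂ | 0 < w.re ∧ w.re < 1 ∧ 0 < w.im} :=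
    (isOpen_lt continuous_const Complex.continuous_re).inter
      ((isOpen_lt Complex.continuous_re continuous_const).inter (isOpen_im_gt 0))
  have := sub_eq_sub_of_hasDerivAt (f := fun w => τ ((S.K j).φ w)) (g := fun w => period P (z j) * w)
    (f' := fun _ => period P (z j)) ho hc.isPreconnected
    (fun x hx => PeriodicChart.hasDerivAt_comp_primitive ((S.K j).hasDerivAt x hx.2.2)
      (hτ _ (S.φ_mem_cutPlane j hx.2.2 (ne_int_of_mem_Ioo hx.1 hx.2.1))) ((S.K j).eval_ne x hx.2.2))
    (fun x _ => PeriodicChart.hasDerivAt_const_mul_id _ x) (x := w) (y := 1 / 2 + Complex.I)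
    ⟨h0, h1, hw⟩ ⟨by simp, by norm_num, by simp⟩
  rw [base]
  linear_combination this

/-- By periodicity this is the same strip, entered from its other edge; the additional period is the
jump across the cut. -/
lemma branch_left (j : Fin (k + 1)) {w : ℂ} (h0 : -1 < w.re) (h1 : w.re < 0) (hw : 0 < w.im) :
    τ ((S.K j).φ w) = S.base τ j + period P (z j) + period P (z j) * w := by
  have h := (S.K j).φ_add_int 1 hw
  have := S.branch_strip hτ j (w := w + 1) (by simp; linarith) (by simpa using h1) (by simpa using hw)
  rw [Int.cast_one] at h
  rw [← h, this]
  ring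

omit hτ in
lemma tendsto_ray_dir (j : Fin (k + 1)) :
    Tendsto (fun r : ℝ => (S.K j).φ (r * Complex.I) / (‖(S.K j).φ (r * Complex.I)‖ : ℂ)) (𝓝[>] 0)
      (𝓝 (Complex.exp (S.θ j * Complex.I))) := by
  refine (S.tendsto_dir j).comp (tendsto_inf.2 ⟨S.tendsto_fin_ray j Complex.I (by simp), ?_⟩)
  refine tendsto_principal.2 ?_
  filter_upwards [self_mem_nhdsWithin] with r hr
  rw [S.cut_eq]
  exact Or.inr ⟨r, hr, rfl⟩

omit hτ in
lemma eventually_cut_dir (j : Fin (k + 1)) {δ : ℝ} (hδ : 0 < δ) (hδπ : δ ≤ Real.pi) :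
    ∀ᶠ u : ℂ in Bornology.cobounded ℂ, ∀ α : ℝ, u = ‖u‖ * Complex.exp (α * Complex.I) →
      Real.cos (α - S.θ j) ≤ Real.cos δ → u ∉ D j := by
  have h1 := ((Complex.continuous_re.tendsto _).comp
    ((S.tendsto_dir j).mul_const (Complex.exp (-(S.θ j * Complex.I)))))
  rw [← Complex.exp_add, add_neg_cancel, Complex.exp_zero, Complex.one_re] at h1
  have hcos : Real.cos δ < 1 := by
    rw [← Real.cos_zero]
    exact Real.cos_lt_cos_of_nonneg_of_le_pi le_rfl hδπ hδ
  have h2 := h1.eventually_const_lt hcos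
  rw [eventually_inf_principal] at h2
  filter_upwards [h2, eventually_norm_gt 0] with u hu hu0 α hα hle hmem
  have h3 := hu hmem
  have h4 : u / (‖u‖ : ℂ) = Complex.exp (α * Complex.I) := by
    have : (‖u‖ : ℂ) ≠ 0 := by exact_mod_cast hu0.ne'
    rw [div_eq_iff this, mul_comm]
    exact hα
  have h5 : (u / (‖u‖ : ℂ) * Complex.exp (-(S.θ j * Complex.I))).re = Real.cos (α - S.θ j) := by
    rw [h4, ← Complex.exp_add, show (α : ℂ) * Complex.I + -(S.θ j * Complex.I) =
      ((α - S.θ j : ℝ) : ℂ) * Complex.I by push_cast; ring, Complex.exp_ofReal_mul_I_re]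
  simp only [Function.comp, h5] at h3
  linarith

omit hτ in
-- The bound with `k` keeps the charts of `eventually_mem_sector` valid; the bound by the gaps
-- leaves room for both `θ j + 2δ` and `nextAngle θ j - 2δ` inside the reduced gap.
lemma exists_sector_width : ∃ δ : ℝ, 0 < δ ∧ 3 * δ < Real.pi / (2 * k) ∧ δ ≤ Real.pi ∧
    ∀ j, 4 * δ < nextAngle S.θ j - S.θ j := by
  have hk0 : (0 : ℝ) < k := by exact_mod_cast S.hk
  have hlin : ∀ c : ℝ, ∀ g : ℝ, 0 < g → ∀ᶠ δ in 𝓝[>] (0 : ℝ), c * δ < g := fun c g hg => by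
    have : Tendsto (fun δ : ℝ => c * δ) (𝓝 0) (𝓝 (c * 0)) := (continuous_const.mul continuous_id).tendsto 0
    rw [mul_zero] at this
    exact (this.eventually_lt_const hg).filter_mono nhdsWithin_le_nhds
  have h := (((hlin 3 (Real.pi / (2 * k)) (by positivity)).and (hlin 1 Real.pi Real.pi_pos)).and
    (eventually_all.2 fun j => hlin 4 (nextAngle S.θ j - S.θ j)
      (sub_pos.2 (lt_nextAngle S.strictMono S.last_lt j)))).and self_mem_nhdsWithin
  obtain ⟨δ, ⟨⟨h1, h2⟩, h3⟩, h4⟩ := h.exists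
  exact ⟨δ, h4, h1, by linarith, h3⟩

/-- The branch near `∞`: on the sector between consecutive cuts it differs from the local branch of
time by a constant. -/
theorem branch_near_infty : (∀ j, S.base τ j = S.base τ (j + 1) + period P (z (j + 1))) ∧
    ∃ R : ℝ, ∀ u : ℂ, R < ‖u‖ → (∀ j, u ∉ (S.K j).domain) → ∃ j, τ u = S.base τ j + S.C.f u := by
  obtain ⟨δ, hδ, hδk, hδπ, hgap⟩ := S.exists_sector_width
  have hnear : ∀ j, ∃ ε > 0, ε ≤ 1 ∧ ∀ w : ℂ, 0 < w.im → ‖w‖ < ε →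
      S.C.f ((S.K j).φ w) = period P (z j) * w := fun j => by
    obtain ⟨ε, hε, h⟩ := (S.K j).near_infty S.C (S.infty j) le_rfl 0
    refine ⟨min ε 1, lt_min hε one_pos, min_le_right _ _, fun w hw hwε => ?_⟩
    have := (h w hw.le (hwε.trans_le (min_le_left _ _))).2
    rw [(S.K j).Φ_eq w hw] at this
    simpa using this
  choose ε hε hε1 hfε using hnear
  have hev := (eventually_all.2 fun j => (S.K j).eventually_mem_sector S.C S.hk (S.period_ne j)
    (S.infty j) (S.tendsto_ray_dir j) hδ hδk (hε j)).and
    ((eventually_all.2 fun j => S.eventually_cut_dir j hδ hδπ).and (eventually_norm_gt S.C.r⁻¹))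
  obtain ⟨R, hR, hall⟩ := cobounded_norm_gt_iff.1 hev
  have hexpn : ∀ x : ℂ, Complex.exp x = ‖Complex.exp x‖ * Complex.exp (x.im * Complex.I) := fun x => by
    rw [Complex.norm_exp, Complex.ofReal_exp, ← Complex.exp_add, Complex.re_add_im]
  -- The truncated sector strictly between two consecutive cuts, convex in the logarithmic
  -- coordinate; `exp` sends it into the cut plane near `∞`.
  set T : Fin (k + 1) → Set ℂ := fun j => {x | Real.log R < x.re ∧ S.θ j + δ < x.im ∧
    x.im < nextAngle S.θ j - δ} with hT
  have hTo : ∀ j, IsOpen (T j) := fun j => (isOpen_lt continuous_const Complex.continuous_re).inter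
    ((isOpen_lt continuous_const Complex.continuous_im).inter
      (isOpen_lt Complex.continuous_im continuous_const))
  have hTc : ∀ j, Convex ℝ (T j) := fun j => (convex_halfSpace_re_gt _).inter
    ((convex_halfSpace_im_gt _).inter (convex_halfSpace_im_lt _))
  have hTR : ∀ j, ∀ x ∈ T j, R < ‖Complex.exp x‖ := fun j x hx => by
    rw [Complex.norm_exp]; exact (Real.log_lt_iff_lt_exp hR).1 hx.1
  have hTU : ∀ j, ∀ x ∈ T j, Complex.exp x ∈ cutPlane D := fun j x hx => by
    rw [cutPlane, mem_compl_iff, mem_iUnion]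
    rintro ⟨i, hi⟩
    exact (hall _ (hTR j x hx)).2.1 i x.im (hexpn x)
      (cos_sub_le S.strictMono S.last_lt hδ.le hx.2.1.le hx.2.2.le i) hi
  have hconst : ∀ j, ∀ x ∈ T j, ∀ y ∈ T j, τ (Complex.exp x) - S.C.f (Complex.exp x) =
      τ (Complex.exp y) - S.C.f (Complex.exp y) := fun j x hx y hy =>
    sub_eq_sub_of_hasDerivAt (f := fun x => τ (Complex.exp x)) (g := fun x => S.C.f (Complex.exp x))
      (f' := fun x => 1 / P.eval (Complex.exp x) * Complex.exp x) (hTo j) (hTc j).isPreconnected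
      (fun x hx => (hτ _ (hTU j x hx)).comp x (Complex.hasDerivAt_exp x))
      (fun x hx => (S.C.hasDerivAt_f (hall _ (hTR j x hx)).2.2).comp x (Complex.hasDerivAt_exp x))
      hx hy
  have hpoint : ∀ (j : Fin (k + 1)) (α : ℝ), ∃ x : ℂ, x.re = Real.log R + 1 ∧ x.im = α := fun j α =>
    ⟨⟨Real.log R + 1, α⟩, rfl, rfl⟩
  have hre : ∀ (w : ℂ) (j : Fin (k + 1)), ‖w‖ < ε j → |w.re| < 1 := fun w j h =>
    (Complex.abs_re_le_norm w).trans_lt (h.trans_le (hε1 j))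
  -- Just anti-clockwise of `D j` the chart has `0 < Re w < 1`, and `branch_strip` identifies the
  -- constant.
  have hval : ∀ j, ∀ x ∈ T j, τ (Complex.exp x) - S.C.f (Complex.exp x) = S.base τ j := fun j x hx => by
    obtain ⟨y, hy1, hy2⟩ := hpoint j (S.θ j + 2 * δ)
    have hyT : y ∈ T j := ⟨by linarith, by linarith, by linarith [hgap j]⟩
    rw [hconst j x hx y hyT]
    obtain ⟨w, hw, hwε, hwφ, hpos, -⟩ := (hall _ (hTR j y hyT)).1 j y.im (hexpn y) (by
      rw [hy2, abs_of_pos (by linarith)]; linarith)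
    have hw0 := hpos (by linarith)
    rw [← hwφ, S.branch_strip hτ j hw0 (abs_lt.1 (hre w j hwε)).2 hw, hfε j w hw hwε]
    ring
  -- Just clockwise of the next cut its chart has `Re w < 0`, and `branch_left` adds the period.
  -- Comparison with `hval` shows that the side `j + 1` ends where the side `j` begins.
  have hval' : ∀ j, ∀ x ∈ T j, τ (Complex.exp x) - S.C.f (Complex.exp x) =
      S.base τ (j + 1) + period P (z (j + 1)) := fun j x hx => by
    obtain ⟨y, hy1, hy2⟩ := hpoint j (nextAngle S.θ j - 2 * δ)
    have hyT : y ∈ T j := ⟨by linarith, by linarith [hgap j], by linarith⟩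
    rw [hconst j x hx y hyT]
    obtain ⟨n, hn⟩ := exp_nextAngle S.θ j
    have hyexp : Complex.exp y = ‖Complex.exp y‖ *
        Complex.exp ((y.im - n * (2 * Real.pi) : ℝ) * Complex.I) := by
      conv_lhs => rw [hexpn y]
      congr 1
      rw [Complex.exp_eq_exp_iff_exists_int]
      exact ⟨n, by push_cast; ring⟩
    obtain ⟨w, hw, hwε, hwφ, -, hneg⟩ := (hall _ (hTR j y hyT)).1 (j + 1) _ hyexp (by
      rw [hy2, hn, show S.θ (j + 1) + n * (2 * Real.pi) - 2 * δ - n * (2 * Real.pi) - S.θ (j + 1) =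
        -(2 * δ) by ring, abs_neg, abs_of_pos (by linarith)])
    have hw0 := hneg (by rw [hy2, hn]; linarith)
    rw [← hwφ, S.branch_left hτ (j + 1) (abs_lt.1 (hre w _ hwε)).1 hw0 hw, hfε _ w hw hwε]
    ring
  refine ⟨fun j => ?_, R, fun u hu hdom => ?_⟩
  · obtain ⟨y, hy1, hy2⟩ := hpoint j (S.θ j + 2 * δ)
    have hyT : y ∈ T j := ⟨by linarith, by linarith, by linarith [hgap j]⟩
    rw [← hval j y hyT, hval' j y hyT]
  · obtain ⟨n, j, h1, h2⟩ := exists_angle_sector S.θ u.arg δ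
    have hu0 : 0 < ‖u‖ := hR.trans hu
    have huα : u = ‖u‖ * Complex.exp ((u.arg + n * (2 * Real.pi) : ℝ) * Complex.I) := by
      conv_lhs => rw [← Complex.norm_mul_exp_arg_mul_I u]
      congr 1
      rw [Complex.exp_eq_exp_iff_exists_int]
      exact ⟨-n, by push_cast; ring⟩
    set α := u.arg + n * (2 * Real.pi) with hα
    have h3 : S.θ j + δ < α := by
      by_contra hcon
      push Not at hcon
      obtain ⟨w, hw, -, hwφ, -⟩ := (hall u hu).1 j α huα (by rw [abs_le]; constructor <;> linarith)
      exact hdom j (hwφ ▸ S.φ_mem j hw)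
    have hxT : (⟨Real.log ‖u‖, α⟩ : ℂ) ∈ T j := ⟨Real.log_lt_log hR hu, h3, h2⟩
    have hx : Complex.exp ⟨Real.log ‖u‖, α⟩ = u := by
      rw [hexpn, Complex.norm_exp, Real.exp_log hu0]
      exact huα.symm
    have := hval j _ hxT
    rw [hx] at this
    exact ⟨j, by linear_combination this⟩

end CutCharts

/-! ### The core and the lift of the charts to the surface -/

namespace CutCharts
variable {k : ℕ} {P : Polynomial ℂ} {z : Fin (k + 1) → ℂ} {D : Fin (k + 1) → Set ℂ}
  (S : CutCharts P z D)

section Domains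

/-- The complement of the closed periodic domains. -/
def core : Set ℂ := (⋃ j, closure (S.K j).domain)ᶜ

lemma isOpen_core : IsOpen S.core :=
  (isClosed_iUnion_of_finite fun _ => isClosed_closure).isOpen_compl

lemma notMem_closure_of_mem_core {u : ℂ} (hu : u ∈ S.core) (j : Fin (k + 1)) :
    u ∉ closure (S.K j).domain := fun h => hu (mem_iUnion.2 ⟨j, h⟩)

lemma mem_cutPlane_of_forall {u : ℂ} (hu : ∀ j, u ∉ (S.K j).domain) : u ∈ cutPlane D := fun h => by
  obtain ⟨j, hj⟩ := mem_iUnion.1 h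
  exact hu j (S.cut_subset_domain j hj)

lemma core_subset : S.core ⊆ cutPlane D := fun _ hu => S.mem_cutPlane_of_forall fun j h =>
  S.notMem_closure_of_mem_core hu j (subset_closure h)

/-- For `i ≠ j`, the open domain `i` around such a point would meet the domain `j`, against
disjointness. -/
lemma boundary_notMem (j : Fin (k + 1)) {x : ℝ} {u : ℂ} (hx : (S.K j).Φ x = u) (i : Fin (k + 1)) :
    u ∉ (S.K i).domain := fun h => by
  by_cases hij : i = j
  · subst hij
    exact (S.K i).boundary_notMem_domain (S.simple i) (S.isRoot i) hx h
  · obtain ⟨v, hv1, hv2⟩ := mem_closure_iff.1 ((S.K j).mem_closure_of_boundary hx) _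
      (S.K i).isOpen_domain h
    exact hij (S.eq_of_mem hv1 hv2)

lemma Φ_int (j : Fin (k + 1)) (n : ℤ) : (S.K j).Φ n = OnePoint.infty := by
  have := (S.K j).periodic_int n 0 (by simp)
  rwa [zero_add, S.infty] at this

lemma exists_boundary_param (j : Fin (k + 1)) {u : ℂ} (h1 : u ∈ closure (S.K j).domain)
    (h2 : u ∉ (S.K j).domain) : ∃ x : ℝ, 0 < x ∧ x < 1 ∧ (S.K j).Φ x = u := by
  obtain ⟨x, hx⟩ := ((S.K j).closure_domain_subset h1).resolve_left h2
  obtain ⟨w, hre, him, hΦ, -⟩ := (S.K j).exists_fundamental x (by simp)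
  have hw : w = (w.re : ℂ) := Complex.ext (by simp) (by simpa using him)
  rw [hx, hw] at hΦ
  refine ⟨w.re, lt_of_le_of_ne hre.1 fun h => ?_, hre.2, hΦ⟩
  rw [← h, Complex.ofReal_zero, S.infty] at hΦ
  exact OnePoint.infty_ne_coe _ hΦ

lemma frontier_eq (j : Fin (k + 1)) :
    frontier (periodicDomain P (z j)) = {u : ℂ | ∃ x : ℝ, (S.K j).Φ x = u} := by
  rw [(S.K j).periodicDomain_eq (S.simple j) (S.isRoot j),
    (S.K j).frontier_domain (S.simple j) (S.isRoot j)]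

end Domains

variable {τ : ℂ → ℂ} (h : IsTimeBranch P (cutPlane D) τ)
include h

/-- The limit of `branch_strip` from above; finite boundary points lie on no cut, so `τ` is
continuous there. -/
lemma branch_boundary (j : Fin (k + 1)) {x : ℝ} (h0 : 0 < x) (h1 : x < 1) {u : ℂ}
    (hx : (S.K j).Φ x = u) : τ u = S.base τ j + period P (z j) * x := by
  have hu : u ∈ cutPlane D := S.mem_cutPlane_of_forall (S.boundary_notMem j hx)
  have hne := nhdsWithin_upperHalfPlane_neBot (w := (x : ℂ)) (by simp)
  have hc := ((S.K j).continuousOn (x : ℂ) (by simp)).tendsto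
  rw [hx] at hc
  have hc2 : Tendsto (S.K j).φ (𝓝[{w : ℂ | 0 < w.im}] (x : ℂ)) (𝓝 u) := by
    rw [← tendsto_coe_coe_iff]
    refine (hc.mono_left (nhdsWithin_mono _ fun w (hw : 0 < w.im) => hw.le)).congr' ?_
    filter_upwards [self_mem_nhdsWithin] with w hw using (S.K j).Φ_eq w hw
  have ht := (h u hu).2.continuousAt.tendsto.comp hc2
  have ht2 : Tendsto (fun w => S.base τ j + period P (z j) * w) (𝓝[{w : ℂ | 0 < w.im}] (x : ℂ))
      (𝓝 (S.base τ j + period P (z j) * x)) :=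
    ((continuous_const.add (continuous_const.mul continuous_id)).tendsto (x : ℂ)).mono_left
      nhdsWithin_le_nhds
  refine tendsto_nhds_unique (ht.congr' ?_) ht2
  have ho : {w : ℂ | 0 < w.re} ∩ {w : ℂ | w.re < 1} ∈ 𝓝[{w : ℂ | 0 < w.im}] (x : ℂ) :=
    mem_nhdsWithin_of_mem_nhds (((isOpen_lt continuous_const Complex.continuous_re).inter
      (isOpen_lt Complex.continuous_re continuous_const)).mem_nhds ⟨by simpa using h0, by simpa using h1⟩)
  filter_upwards [self_mem_nhdsWithin, ho] with w hw hw2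
  exact S.branch_strip (fun u hu => (h u hu).2) j hw2.1 hw2.2 hw

/-- Local branches propagate the property along the connected closed half plane, starting from `1/2
+ i` in the cut plane. -/
lemma isTimeValue_chart (j : Fin (k + 1)) {w : ℂ} (hw : 0 ≤ w.im) :
    IsTimeValue P ((S.K j).Φ w) (S.base τ j + period P (z j) * w) := by
  have hpre : IsPreconnected {w : ℂ | 0 ≤ w.im} := (convex_halfSpace_im_ge 0).isPreconnected
  have hiff := hpre.induction₂ (fun v w : ℂ =>
    IsTimeValue P ((S.K j).Φ v) (S.base τ j + period P (z j) * v) ↔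
      IsTimeValue P ((S.K j).Φ w) (S.base τ j + period P (z j) * w)) (fun v hv => ?_)
      (fun _ _ _ _ _ _ h1 h2 => h1.trans h2) (fun _ _ _ _ h1 => h1.symm)
      (show (0 : ℝ) ≤ (1 / 2 + Complex.I : ℂ).im by simp) hw
  · refine hiff.1 ?_
    have him : 0 < (1 / 2 + Complex.I : ℂ).im := by simp
    rw [← S.branch_strip (fun u hu => (h u hu).2) j (by simp) (by norm_num) him, (S.K j).Φ_eq _ him]
    exact (h _ (S.φ_mem_cutPlane j him (ne_int_of_mem_Ioo (by simp) (by norm_num)))).1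
  · obtain ⟨V, f, hf, hc, hV, hev⟩ := (S.K j).exists_local_branch S.C hv (S.base τ j)
    have hfv := (hev.self_of_nhdsWithin hv).2
    filter_upwards [hev] with w' hw'
    rw [← hfv, ← hw'.2]
    exact ⟨fun h1 => h1.of_sheet S.C hf hc hV hw'.1, fun h1 => h1.of_sheet S.C hf hc hw'.1 hV⟩

/-- The chart of a periodic domain, lifted to the Riemann surface of time. -/
noncomputable def lift (j : Fin (k + 1)) (w : ℂ) : TimeSurface P :=
  if hw : 0 ≤ w.im then ⟨(S.K j).Φ w, S.base τ j + period P (z j) * w, S.isTimeValue_chart h j hw⟩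
  -- A default value that makes the function total.
  else ⟨(S.K j).Φ 0, S.base τ j + period P (z j) * 0, S.isTimeValue_chart h j le_rfl⟩

lemma lift_pt (j : Fin (k + 1)) {w : ℂ} (hw : 0 ≤ w.im) : (S.lift h j w).pt = (S.K j).Φ w := by
  rw [lift, dif_pos hw]

lemma lift_time (j : Fin (k + 1)) {w : ℂ} (hw : 0 ≤ w.im) :
    (S.lift h j w).time = S.base τ j + period P (z j) * w := by
  rw [lift, dif_pos hw]

lemma continuousOn_lift (j : Fin (k + 1)) : ContinuousOn (S.lift h j) {w : ℂ | 0 ≤ w.im} := by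
  intro w hw
  obtain ⟨V, f, hf, -, hV, hev⟩ := (S.K j).exists_local_branch S.C hw (S.base τ j)
  have hfw := (hev.self_of_nhdsWithin hw).2
  refine tendsto_timeSurface hf (p := S.lift h j w) ⟨?_, ?_⟩ ?_ ?_
  · rw [S.lift_pt h j hw]; exact hV
  · rw [S.lift_pt h j hw, S.lift_time h j hw, hfw]
  · rw [S.lift_pt h j hw]
    refine ((S.K j).continuousOn w hw).tendsto.congr' ?_
    filter_upwards [self_mem_nhdsWithin] with v hv using (S.lift_pt h j hv).symm
  · filter_upwards [hev, self_mem_nhdsWithin] with v hv hv0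
    rw [S.lift_pt h j hv0, S.lift_time h j hv0, hv.2]

/-- The coordinate of the chart as a function of time. -/
noncomputable def coord (τ : ℂ → ℂ) (j : Fin (k + 1)) (t : ℂ) : ℂ := (t - S.base τ j) / period P (z j)

omit h in
lemma coord_base_add (j : Fin (k + 1)) (w : ℂ) :
    S.coord τ j (S.base τ j + period P (z j) * w) = w := by
  have := S.period_ne j
  rw [coord]
  field_simp
  ring

lemma lift_injOn (j : Fin (k + 1)) : InjOn (S.lift h j) {w : ℂ | 0 ≤ w.im} := fun v hv w hw hvw => by
  have := congrArg TimeSurface.time hvw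
  rw [S.lift_time h j hv, S.lift_time h j hw] at this
  exact mul_left_cancel₀ (S.period_ne j) (add_left_cancel this)

omit h in
lemma continuous_coord (j : Fin (k + 1)) : Continuous (S.coord τ j) :=
  (continuous_id.sub continuous_const).div_const _

/-- The charts are closed embeddings. -/
lemma isClosed_lift_image (j : Fin (k + 1)) {A : Set ℂ} (hA : IsClosed A)
    (hA0 : A ⊆ {w : ℂ | 0 ≤ w.im}) : IsClosed (S.lift h j '' A) := by
  have := TimeSurface.t2Space S.C
  set T : Set (TimeSurface P) := (fun p => S.coord τ j p.time) ⁻¹' A with hT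
  have hcc : Continuous fun p : TimeSurface P => S.coord τ j p.time :=
    (S.continuous_coord j).comp (TimeSurface.continuous_time S.C)
  have hTc : IsClosed T := hA.preimage hcc
  -- The map `coord ∘ time` is a left inverse of the lift, so the image is the set in `T` where
  -- lifting it back changes nothing; this is closed since the surface is Hausdorff.
  have heq : S.lift h j '' A = {p | p ∈ T ∧ S.lift h j (S.coord τ j p.time) = p} := by
    ext p
    constructor
    · rintro ⟨w, hw, rfl⟩
      have h1 : S.coord τ j (S.lift h j w).time = w := by
        rw [S.lift_time h j (hA0 hw), S.coord_base_add]
      refine ⟨?_, by rw [h1]⟩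
      show S.coord τ j (S.lift h j w).time ∈ A
      rwa [h1]
    · rintro ⟨h1, h2⟩
      exact ⟨_, h1, h2⟩
  rw [heq]
  refine isClosed_of_closure_subset fun p hp => ?_
  have hpT : p ∈ T := closure_minimal (fun q hq => hq.1) hTc hp
  refine ⟨hpT, ?_⟩
  have hne := mem_closure_iff_nhdsWithin_neBot.1 hp
  have hc : ContinuousWithinAt (fun p : TimeSurface P => S.lift h j (S.coord τ j p.time)) T p :=
    ContinuousWithinAt.comp (f := fun p : TimeSurface P => S.coord τ j p.time)
      (g := S.lift h j) (t := {w : ℂ | 0 ≤ w.im}) (S.continuousOn_lift h j _ (hA0 hpT))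
      hcc.continuousWithinAt fun q hq => hA0 hq
  have ht := hc.tendsto.mono_left (nhdsWithin_mono p (s := {p | p ∈ T ∧
    S.lift h j (S.coord τ j p.time) = p}) fun q hq => hq.1)
  refine tendsto_nhds_unique ht (Tendsto.congr' ?_ (tendsto_id.mono_left nhdsWithin_le_nhds))
  filter_upwards [self_mem_nhdsWithin] with q hq using hq.2.symm

end CutCharts

/-! ### Decomposition of the star domain -/

namespace CutCharts
variable {k : ℕ} {P : Polynomial ℂ} {z : Fin (k + 1) → ℂ} {D : Fin (k + 1) → Set ℂ}
  (S : CutCharts P z D)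

/-- The closed half strip. -/
def strip : Set ℂ := {w | 0 ≤ w.re ∧ w.re ≤ 1 ∧ 0 ≤ w.im}

lemma isClosed_strip : IsClosed strip :=
  (isClosed_le continuous_const Complex.continuous_re).inter
    ((isClosed_le Complex.continuous_re continuous_const).inter
      (isClosed_le continuous_const Complex.continuous_im))

lemma strip_subset : strip ⊆ {w : ℂ | 0 ≤ w.im} := fun _ hw => hw.2.2

lemma ofReal_mem_strip {s : ℝ} (hs : s ∈ Icc (0 : ℝ) 1) : (s : ℂ) ∈ strip :=
  ⟨by simpa using hs.1, by simpa using hs.2, by simp⟩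

variable {τ : ℂ → ℂ} (h : IsTimeBranch P (cutPlane D) τ)

/-- The graph of the branch `τ` over a subset of the plane. -/
def graph (P : Polynomial ℂ) (τ : ℂ → ℂ) (V : Set ℂ) : Set (TimeSurface P) :=
  sheet P ((↑) '' V) (fun y => y.elim 0 τ)

lemma mem_graph {V : Set ℂ} {p : TimeSurface P} :
    p ∈ graph P τ V ↔ ∃ u ∈ V, p.pt = u ∧ p.time = τ u := by
  constructor
  · rintro ⟨⟨u, hu, hup⟩, ht⟩
    refine ⟨u, hu, hup.symm, ?_⟩
    rw [ht, ← hup]; rfl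
  · rintro ⟨u, hu, hp, ht⟩
    refine ⟨⟨u, hu, hp.symm⟩, ?_⟩
    rw [ht, hp]; rfl

lemma graph_mono {V W : Set ℂ} (hVW : V ⊆ W) : graph P τ V ⊆ graph P τ W := fun p hp => by
  obtain ⟨u, hu, h1, h2⟩ := mem_graph.1 hp
  exact mem_graph.2 ⟨u, hVW hu, h1, h2⟩

lemma range_branchMap {U : Set ℂ} (h : IsTimeBranch P U τ) : range (branchMap h) = graph P τ U := by
  ext p
  rw [mem_graph]
  constructor
  · rintro ⟨u, rfl⟩
    exact ⟨u, u.2, rfl, rfl⟩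
  · rintro ⟨u, hu, h1, h2⟩
    exact ⟨⟨u, hu⟩, TimeSurface.ext' h1.symm h2.symm⟩

include S h in
lemma isLocalPrimitive_branch {V : Set ℂ} (hV : IsOpen V) (hVU : V ⊆ cutPlane D) :
    IsLocalPrimitive P ((↑) '' V) (fun y => y.elim 0 τ) :=
  isLocalPrimitive_coe hV (fun _ hu => S.eval_ne_of_mem (hVU hu)) fun u hu => (h u (hVU hu)).2

include S h in
lemma isOpen_graph {V : Set ℂ} (hV : IsOpen V) (hVU : V ⊆ cutPlane D) : IsOpen (graph P τ V) :=
  (S.isLocalPrimitive_branch h hV hVU).isOpen_sheet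

/-- The union of the lifted boundaries of the periodic domains. -/
def boundaryCurve : Set (TimeSurface P) := ⋃ j, (fun s : ℝ => S.lift h j s) '' Icc 0 1

lemma continuousOn_lift_real (j : Fin (k + 1)) : Continuous fun s : ℝ => S.lift h j s :=
  continuousOn_univ.1 ((S.continuousOn_lift h j).comp Complex.continuous_ofReal.continuousOn
    fun s _ => by simp)

lemma isCompact_boundaryCurve : IsCompact (S.boundaryCurve h) :=
  isCompact_iUnion fun j => isCompact_Icc.image (S.continuousOn_lift_real h j)

lemma lift_real_pt (j : Fin (k + 1)) (s : ℝ) : (S.lift h j s).pt = (S.K j).Φ s :=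
  S.lift_pt h j (by simp)

lemma lift_real_time (j : Fin (k + 1)) (s : ℝ) :
    (S.lift h j s).time = S.base τ j + period P (z j) * s :=
  S.lift_time h j (by simp)

/-- A point of the cut plane on the boundary of a periodic domain gives a point of the curve. -/
lemma graph_boundary (j : Fin (k + 1)) {u : ℂ} (h1 : u ∈ closure (S.K j).domain)
    (h2 : u ∉ (S.K j).domain) {p : TimeSurface P} (hp : p.pt = u) (ht : p.time = τ u) :
    ∃ x : ℝ, 0 < x ∧ x < 1 ∧ p = S.lift h j x := by
  obtain ⟨x, h0, h1, hx⟩ := S.exists_boundary_param j h1 h2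
  refine ⟨x, h0, h1, TimeSurface.ext' ?_ ?_⟩
  · rw [hp, S.lift_real_pt, hx]
  · rw [ht, S.lift_real_time, S.branch_boundary h j h0 h1 hx]

lemma mem_boundaryCurve (j : Fin (k + 1)) {s : ℝ} (hs : s ∈ Icc (0 : ℝ) 1) :
    S.lift h j s ∈ S.boundaryCurve h := mem_iUnion.2 ⟨j, s, hs, rfl⟩

/-- The core part of the star domain together with its boundary is compact. -/
lemma isCompact_core_union : IsCompact (graph P τ S.core ∪ S.boundaryCurve h) := by
  rw [isCompact_iff_ultrafilter_le_nhds]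
  intro F hF
  rw [le_principal_iff, Ultrafilter.mem_coe, Ultrafilter.union_mem_iff] at hF
  rcases hF with hF | hF
  swap
  · obtain ⟨p, hp, hFp⟩ := isCompact_iff_ultrafilter_le_nhds.1 (S.isCompact_boundaryCurve h) F
      (le_principal_iff.2 hF)
    exact ⟨p, Or.inr hp, hFp⟩
  obtain ⟨y, -, hy⟩ := isCompact_iff_ultrafilter_le_nhds.1 (isCompact_univ (X := OnePoint ℂ))
    (F.map TimeSurface.pt) (by simp)
  have hy : Tendsto TimeSurface.pt (F : Filter (TimeSurface P)) (𝓝 y) := hy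
  have hFc : ∀ᶠ p in (F : Filter (TimeSurface P)), p ∈ graph P τ S.core := hF
  suffices hsuf : ∃ p ∈ graph P τ S.core ∪ S.boundaryCurve h, ∃ V f, IsLocalPrimitive P V f ∧
      p ∈ sheet P V f ∧ p.pt = y ∧ ∀ᶠ q in (F : Filter (TimeSurface P)), q.time = f q.pt by
    obtain ⟨p, hp, V, f, hf, hpf, hpy, hev⟩ := hsuf
    exact ⟨p, hp, tendsto_timeSurface (G := id) hf hpf (by rw [hpy]; exact hy) hev⟩
  induction y using OnePoint.rec with
  | infty =>
    obtain ⟨R, hR⟩ := (S.branch_near_infty fun u hu => (h u hu).2).2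
    -- Near `∞` the time of a core point is `C.f` plus one of finitely many constants; the
    -- ultrafilter selects one of them, hence a vertex of the period curve as limit.
    have hex : ∀ᶠ q in (F : Filter (TimeSurface P)), ∃ j, q.time =
        q.pt.elim (S.base τ j) (fun u => S.C.f u + S.base τ j) := by
      filter_upwards [hFc, hy.eventually ((isOpen_exterior R).mem_nhds (infty_mem_exterior R))]
        with q hq hqR
      obtain ⟨u, hu, h1, h2⟩ := mem_graph.1 hq
      have hqR : q.pt ∈ exterior R := hqR
      rw [h1, coe_mem_exterior] at hqR
      obtain ⟨j, hj⟩ := hR u hqR fun j hj => S.notMem_closure_of_mem_core hu j (subset_closure hj)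
      refine ⟨j, ?_⟩
      rw [h1, h2, OnePoint.elim_some, hj, add_comm]
    obtain ⟨j, hj⟩ := Ultrafilter.eventually_exists_iff.1 hex
    have hpt : (S.lift h j (0 : ℝ)).pt = OnePoint.infty := by
      rw [S.lift_real_pt, Complex.ofReal_zero, S.infty]
    refine ⟨S.lift h j (0 : ℝ), Or.inr (S.mem_boundaryCurve h j (by simp)), _, _,
      S.C.isLocalPrimitive le_rfl (S.base τ j), ⟨?_, ?_⟩, hpt, hj⟩
    · rw [hpt]; exact infty_mem_exterior _
    · rw [hpt, S.lift_real_time]; simp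
  | coe u =>
    -- A finite limit of core points lies in no open periodic domain, hence in the cut plane, where
    -- `τ` itself is the required sheet.
    have hcl : ∀ V : Set ℂ, IsOpen V → u ∈ V → (V ∩ S.core).Nonempty := fun V hV huV => by
      obtain ⟨q, hq1, hq2⟩ := (hFc.and (hy.eventually
        ((OnePoint.isOpen_image_coe.2 hV).mem_nhds (mem_image_of_mem _ huV)))).exists
      obtain ⟨v, hv, h1, -⟩ := mem_graph.1 hq1
      obtain ⟨v', hv', h2⟩ := hq2
      rw [h1, OnePoint.coe_eq_coe] at h2
      exact ⟨v, h2 ▸ hv', hv⟩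
    have hudom : ∀ j, u ∉ (S.K j).domain := fun j hj => by
      obtain ⟨v, hv1, hv2⟩ := hcl _ (S.K j).isOpen_domain hj
      exact S.notMem_closure_of_mem_core hv2 j (subset_closure hv1)
    have huU := S.mem_cutPlane_of_forall hudom
    refine ⟨branchMap h ⟨u, huU⟩, ?_, _, _, S.isLocalPrimitive_branch h S.isOpen_cutPlane Subset.rfl,
      ⟨⟨u, huU, rfl⟩, rfl⟩, rfl, ?_⟩
    · by_cases huc : u ∈ S.core
      · exact Or.inl (mem_graph.2 ⟨u, huc, rfl, rfl⟩)
      · rw [core, mem_compl_iff, not_not, mem_iUnion] at huc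
        obtain ⟨j, hj⟩ := huc
        obtain ⟨x, h0, h1, hx⟩ := S.graph_boundary h j hj (hudom j) (p := branchMap h ⟨u, huU⟩) rfl rfl
        rw [hx]
        exact Or.inr (S.mem_boundaryCurve h j ⟨h0.le, h1.le⟩)
    · filter_upwards [hFc] with q hq
      exact (graph_mono S.core_subset hq).2

lemma lift_mem_graph (j : Fin (k + 1)) {w : ℂ} (h0 : 0 < w.re) (h1 : w.re < 1) (hw : 0 < w.im) :
    S.lift h j w ∈ graph P τ (cutPlane D) := by
  refine mem_graph.2 ⟨(S.K j).φ w, S.φ_mem_cutPlane j hw (ne_int_of_mem_Ioo h0 h1), ?_, ?_⟩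
  · rw [S.lift_pt h j hw.le, (S.K j).Φ_eq w hw]
  · rw [S.lift_time h j hw.le, S.branch_strip (fun u hu => (h u hu).2) j h0 h1 hw]

/-- The open segment from `w` to `1/2 + i` lies in the open strip, over the cut plane. -/
lemma lift_mem_closure (j : Fin (k + 1)) {w : ℂ} (hw : w ∈ strip) :
    S.lift h j w ∈ closure (graph P τ (cutPlane D)) := by
  set γ : ℝ → ℂ := fun t => w + t * (1 / 2 + Complex.I - w) with hγ
  have hre : ∀ t : ℝ, (γ t).re = (1 - t) * w.re + t * (1 / 2) := fun t => by simp [hγ]; ring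
  have him : ∀ t : ℝ, (γ t).im = (1 - t) * w.im + t := fun t => by simp [hγ]; ring
  have hγ0 : γ 0 = w := by simp [hγ]
  have hmem : ∀ t ∈ Ioo (0 : ℝ) 1, 0 < (γ t).re ∧ (γ t).re < 1 ∧ 0 < (γ t).im := fun t ht => by
    rw [hre, him]
    have h1 := mul_nonneg (sub_nonneg.2 ht.2.le) hw.1
    have h2 := mul_nonneg (sub_nonneg.2 ht.2.le) hw.2.2
    have h3 := mul_nonneg (sub_nonneg.2 ht.2.le) (sub_nonneg.2 hw.2.1)
    refine ⟨by linarith [ht.1], by nlinarith [ht.1], by linarith [ht.1]⟩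
  have hcont : Tendsto γ (𝓝[>] 0) (𝓝[{w : ℂ | 0 ≤ w.im}] w) := by
    refine tendsto_nhdsWithin_iff.2 ⟨?_, ?_⟩
    · rw [← hγ0]
      have : Continuous γ := by fun_prop
      exact (this.tendsto 0).mono_left nhdsWithin_le_nhds
    · filter_upwards [Ioo_mem_nhdsGT (zero_lt_one (α := ℝ))] with t ht using (hmem t ht).2.2.le
  refine mem_closure_of_tendsto ((S.continuousOn_lift h j w hw.2.2).tendsto.comp hcont) ?_
  filter_upwards [Ioo_mem_nhdsGT (zero_lt_one (α := ℝ))] with t ht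
  obtain ⟨h1, h2, h3⟩ := hmem t ht
  exact S.lift_mem_graph h j h1 h2 h3

lemma boundaryCurve_subset : S.boundaryCurve h ⊆ ⋃ j, S.lift h j '' strip := by
  refine iUnion_mono fun j => ?_
  rintro _ ⟨s, hs, rfl⟩
  exact ⟨s, ofReal_mem_strip hs, rfl⟩

lemma graph_subset : graph P τ (cutPlane D) ⊆ graph P τ S.core ∪ S.boundaryCurve h ∪
    ⋃ j, S.lift h j '' strip := by
  intro p hp
  obtain ⟨u, hu, h1, h2⟩ := mem_graph.1 hp
  by_cases huc : u ∈ S.core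
  · exact Or.inl (Or.inl (mem_graph.2 ⟨u, huc, h1, h2⟩))
  rw [core, mem_compl_iff, not_not, mem_iUnion] at huc
  obtain ⟨j, hj⟩ := huc
  by_cases hud : u ∈ (S.K j).domain
  · obtain ⟨w, ⟨hw0, hw1, hw⟩, rfl⟩ := S.domain_diff_cut_subset j ⟨hud, notMem_cut_of_mem hu j⟩
    refine Or.inr (mem_iUnion.2 ⟨j, w, ⟨hw0.le, hw1.le, hw.le⟩, TimeSurface.ext' ?_ ?_⟩)
    · rw [h1, S.lift_pt h j hw.le, (S.K j).Φ_eq w hw]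
    · rw [h2, S.lift_time h j hw.le, S.branch_strip (fun u hu => (h u hu).2) j hw0 hw1 hw]
  · obtain ⟨x, h0, h1, hx⟩ := S.graph_boundary h j hj hud h1 h2
    rw [hx]
    exact Or.inl (Or.inr (S.mem_boundaryCurve h j ⟨h0.le, h1.le⟩))

/-- The right-hand side is a compact set together with finitely many closed strips, hence closed. It
contains the graph of the branch, and all its pieces lie in the closure of that graph. -/
theorem starDomain_eq : starDomain h = graph P τ S.core ∪ S.boundaryCurve h ∪
    ⋃ j, S.lift h j '' strip := by
  have := TimeSurface.t2Space S.C
  rw [starDomain, range_branchMap]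
  refine Subset.antisymm (closure_minimal (S.graph_subset h) ?_) ?_
  · exact (S.isCompact_core_union h).isClosed.union
      (isClosed_iUnion_of_finite fun j => S.isClosed_lift_image h j isClosed_strip strip_subset)
  · have h1 : ⋃ j, S.lift h j '' strip ⊆ closure (graph P τ (cutPlane D)) := by
      refine iUnion_subset fun j => ?_
      rintro _ ⟨w, hw, rfl⟩
      exact S.lift_mem_closure h j hw
    exact union_subset (union_subset ((graph_mono S.core_subset).trans subset_closure)
      ((S.boundaryCurve_subset h).trans h1)) h1

/-- The points of the core part and of its boundary do not lie over periodic domains. -/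
lemma pt_ne_of_mem {p : TimeSurface P} (hp : p ∈ graph P τ S.core ∪ S.boundaryCurve h)
    (j : Fin (k + 1)) {u : ℂ} (hu : u ∈ (S.K j).domain) : p.pt ≠ u := by
  rcases hp with hp | hp
  · obtain ⟨v, hv, h1, -⟩ := mem_graph.1 hp
    rw [h1]
    intro h2
    rw [OnePoint.coe_injective h2] at hv
    exact S.notMem_closure_of_mem_core hv j (subset_closure hu)
  · obtain ⟨i, s, -, rfl⟩ := mem_iUnion.1 hp
    rw [S.lift_real_pt]
    exact fun h2 => S.boundary_notMem i h2 j hu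

lemma lift_notMem (j : Fin (k + 1)) {w : ℂ} (hw : 0 < w.im) :
    S.lift h j w ∉ graph P τ S.core ∪ S.boundaryCurve h := fun hp =>
  S.pt_ne_of_mem h hp j (S.φ_mem j hw) (by rw [S.lift_pt h j hw.le, (S.K j).Φ_eq w hw])

lemma disjoint_core_boundaryCurve : Disjoint (graph P τ S.core) (S.boundaryCurve h) := by
  rw [Set.disjoint_left]
  intro p hp hq
  obtain ⟨u, hu, h1, -⟩ := mem_graph.1 hp
  obtain ⟨i, s, -, rfl⟩ := mem_iUnion.1 hq
  rw [S.lift_real_pt] at h1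
  exact S.notMem_closure_of_mem_core hu i ((S.K i).mem_closure_of_boundary h1)

end CutCharts

/-! ### The periodgon as the filled-in boundary curve -/

lemma nhdsWithin_Icc_sdiff_neBot {s : ℝ} (hs : s ∈ Icc (0 : ℝ) 1) :
    (𝓝[Icc (0 : ℝ) 1 \ {s}] s).NeBot := by
  refine mem_closure_iff_nhdsWithin_neBot.1 ?_
  have hcl : s ∈ closure (Ioo (0 : ℝ) 1 \ {s}) := by
    by_cases hs' : s ∈ Ioo (0 : ℝ) 1
    · have h1 : (𝓝[≠] s).NeBot := inferInstance
      rw [mem_closure_iff_nhdsWithin_neBot, Set.sdiff_eq,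
        nhdsWithin_inter_of_mem (mem_nhdsWithin_of_mem_nhds (isOpen_Ioo.mem_nhds hs'))]
      exact h1
    · rw [sdiff_singleton_eq_self hs', closure_Ioo zero_ne_one]; exact hs
  exact closure_mono (sdiff_subset_sdiff_left Ioo_subset_Icc_self) hcl

namespace CutCharts
variable {k : ℕ} {P : Polynomial ℂ} {z : Fin (k + 1) → ℂ} {D : Fin (k + 1) → Set ℂ}
  (S : CutCharts P z D) {τ : ℂ → ℂ} (h : IsTimeBranch P (cutPlane D) τ)

/-- A component of the complement of the boundary curve that does not meet the core is not
relatively compact. -/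
lemma not_isCompact_closure_component {p : TimeSurface P} (hp : p ∉ S.boundaryCurve h)
    (hpc : p ∉ graph P τ S.core) :
    ¬ IsCompact (closure (connectedComponentIn (S.boundaryCurve h)ᶜ p)) := by
  intro hcomp
  have := TimeSurface.t2Space S.C
  have := TimeSurface.locallyConnectedSpace S.C
  set Γ := S.boundaryCurve h with hΓ
  set V := connectedComponentIn Γᶜ p with hV
  have hΓc : IsClosed Γ := (S.isCompact_boundaryCurve h).isClosed
  have hVo : IsOpen V := hΓc.isOpen_compl.connectedComponentIn
  have hpV : p ∈ V := mem_connectedComponentIn hp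
  have hVΓ : V ⊆ Γᶜ := connectedComponentIn_subset _ _
  have hVpre : IsPreconnected V := isPreconnected_connectedComponentIn
  have hgrow : ∀ A : Set (TimeSurface P), IsPreconnected A → A ⊆ Γᶜ → (V ∩ A).Nonempty → A ⊆ V := by
    rintro A hA hAΓ ⟨q, hqV, hqA⟩
    rw [hV, connectedComponentIn_eq hqV]
    exact hA.subset_connectedComponentIn hqA hAΓ
  -- the component does not meet the core
  have hcoreo : IsOpen (graph P τ S.core) := S.isOpen_graph h S.isOpen_core S.core_subset
  have hVcore : Disjoint V (graph P τ S.core) := by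
    rw [Set.disjoint_left]
    intro q hqV hqc
    refine hpc (hVpre.subset_of_closure_inter_subset hcoreo ⟨q, hqV, hqc⟩ ?_ hpV)
    rintro r ⟨hr, hrV⟩
    have h1 := closure_minimal (subset_union_left (t := Γ)) (S.isCompact_core_union h).isClosed hr
    exact h1.resolve_right (hVΓ hrV)
  -- nor the half strips
  have hstrip : ∀ j, ∀ w : ℂ, 0 < w.im → S.lift h j w ∉ V := fun j w hw hwV => by
    have hA : IsPreconnected (S.lift h j '' {w : ℂ | 0 < w.im}) :=
      (convex_im_gt 0).isPreconnected.image _ ((S.continuousOn_lift h j).mono fun w (hw : 0 < w.im) => hw.le)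
    have hAV := hgrow _ hA (by
      rintro _ ⟨v, hv, rfl⟩ hvΓ
      exact S.lift_notMem h j hv (Or.inr hvΓ)) ⟨_, hwV, w, hw, rfl⟩
    obtain ⟨M, hM⟩ := (hcomp.image (TimeSurface.continuous_time S.C)).isBounded.exists_norm_le
    have hν := norm_pos_iff.2 (S.period_ne j)
    set b := S.base τ j
    -- High enough in the strip for the time to exceed its bound `M` on the compact closure.
    set s : ℝ := (|M| + ‖b‖ + 1) / ‖period P (z j)‖ with hs
    have hs0 : 0 < s := by positivity
    have him : (0 : ℝ) < ((s : ℂ) * Complex.I).im := by simpa using hs0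
    have h1 := hM _ (mem_image_of_mem _ (subset_closure (hAV ⟨(s : ℂ) * Complex.I, him, rfl⟩)))
    rw [S.lift_time h j him.le] at h1
    have h2 : ‖period P (z j) * (s * Complex.I)‖ = |M| + ‖b‖ + 1 := by
      rw [norm_mul, norm_mul, Complex.norm_I, mul_one, Complex.norm_real, Real.norm_eq_abs,
        abs_of_pos hs0, hs]
      field_simp
    have h3 := norm_sub_le (b + period P (z j) * (s * Complex.I)) b
    rw [add_sub_cancel_left, h2] at h3
    linarith [le_abs_self M]
  -- the frontier of the component lies over `∞`
  have hfr : ∀ q ∈ closure V, q ∉ V → q ∈ Γ := fun q hq hqV => by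
    by_contra hqΓ
    obtain ⟨r, hr1, hr2⟩ := mem_closure_iff.1 hq _ hΓc.isOpen_compl.connectedComponentIn
      (mem_connectedComponentIn hqΓ)
    apply hqV
    rw [hV, connectedComponentIn_eq hr2, ← connectedComponentIn_eq hr1]
    exact mem_connectedComponentIn hqΓ
  have hfr2 : ∀ q ∈ closure V, q ∉ V → q.pt = OnePoint.infty := fun q hq hqV => by
    by_contra hinf
    obtain ⟨u, hu⟩ := OnePoint.ne_infty_iff_exists.1 hinf
    obtain ⟨j, s, hs, hjs⟩ := mem_iUnion.1 (hfr q hq hqV)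
    have hjs : S.lift h j s = q := hjs
    have hΦ : (S.K j).Φ s = u := by rw [← S.lift_real_pt h j s, hjs, hu]
    have hs0 : s ≠ 0 := by
      rintro rfl
      rw [Complex.ofReal_zero, S.infty] at hΦ; exact OnePoint.infty_ne_coe _ hΦ
    have hs1 : s ≠ 1 := by
      rintro rfl
      have := S.Φ_int j 1
      rw [Int.cast_one, ← Complex.ofReal_one, hΦ] at this; exact OnePoint.coe_ne_infty _ this
    have huU := S.mem_cutPlane_of_forall (S.boundary_notMem j hΦ)
    have hqg : q ∈ graph P τ (cutPlane D) := mem_graph.2 ⟨u, huU, hu.symm, by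
      rw [← hjs, S.lift_real_time, S.branch_boundary h j (lt_of_le_of_ne hs.1 hs0.symm)
        (lt_of_le_of_ne hs.2 hs1) hΦ]⟩
    -- The graph over the cut plane is a neighbourhood of `q`, and it is covered by the core, the
    -- curve and the strips, none of which meets `V`.
    obtain ⟨r, hrg, hrV⟩ := mem_closure_iff.1 hq _ (S.isOpen_graph h S.isOpen_cutPlane Subset.rfl) hqg
    rcases S.graph_subset h hrg with (hr | hr) | hr
    · exact Set.disjoint_left.1 hVcore hrV hr
    · exact hVΓ hrV hr
    · obtain ⟨i, w, hw, rfl⟩ := mem_iUnion.1 hr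
      rcases hw.2.2.lt_or_eq with h0 | h0
      · exact hstrip i w h0 hrV
      · have hw' : w = (w.re : ℂ) := Complex.ext (by simp) (by simp [← h0])
        rw [hw'] at hrV
        exact hVΓ hrV (S.mem_boundaryCurve h i ⟨hw.1, hw.2.1⟩)
  -- so the component is closed
  have hVcl : IsClosed V := by
    refine isClosed_of_closure_subset fun q hq => ?_
    by_contra hqV
    have hqinf := hfr2 q hq hqV
    obtain ⟨j, s, hs, hjs⟩ := mem_iUnion.1 (hfr q hq hqV)
    have hjs : S.lift h j s = q := hjs
    obtain ⟨N, f, hf, hqN, -, -, hNpre, hNt⟩ := q.exists_connected_sheet S.C univ_mem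
    -- A sheet at `q` without the point over `∞` is still connected and contains no frontier point
    -- of `V`. As it meets `V`, it would lie in `V`; but the curve through `q` runs inside it.
    set E := sheet P ((↑) '' ((↑) ⁻¹' N : Set ℂ)) f with hE
    have hEpre : IsPreconnected E := isPreconnected_sheet hf hNt (image_preimage_subset _ _)
      (hNpre.image _ OnePoint.continuous_coe.continuousOn)
    have hEmem : ∀ r ∈ sheet P N f, r ≠ q → r ∈ E := fun r hr hrq => by
      refine ⟨?_, hr.2⟩
      have : r.pt ≠ OnePoint.infty := fun hinf => hrq (TimeSurface.ext' (hinf.trans hqinf.symm) (by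
        rw [hr.2, hqN.2, hinf, hqinf]))
      obtain ⟨v, hv⟩ := OnePoint.ne_infty_iff_exists.1 this
      exact ⟨v, by rw [mem_preimage, hv]; exact hr.1, hv⟩
    have hEinf : ∀ r ∈ E, r.pt ≠ OnePoint.infty := by
      rintro r ⟨⟨v, -, hv⟩, -⟩
      rw [← hv]; exact OnePoint.coe_ne_infty v
    have hEV : E ⊆ V := by
      obtain ⟨r, hrN, hrV⟩ := mem_closure_iff.1 hq _ hf.isOpen_sheet hqN
      refine hEpre.subset_of_closure_inter_subset hVo ⟨r, hEmem r hrN fun hrq => hqV (hrq ▸ hrV), hrV⟩ ?_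
      rintro r' ⟨h1, h2⟩
      by_contra hr'
      exact hEinf r' h2 (hfr2 r' h1 hr')
    have hnear : ∀ᶠ t : ℝ in 𝓝[Icc (0 : ℝ) 1 \ {s}] s, S.lift h j (t : ℂ) ∈ sheet P N f :=
      ((S.continuousOn_lift_real h j).tendsto s).mono_left nhdsWithin_le_nhds
        |>.eventually (by rw [hjs]; exact hf.sheet_mem_nhds hqN)
    have hne := nhdsWithin_Icc_sdiff_neBot hs
    obtain ⟨t, ht, htI, hts⟩ := (hnear.and self_mem_nhdsWithin).exists
    have htq : S.lift h j t ≠ q := fun hq' => hts (by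
      have := S.lift_injOn h j (show (0:ℝ) ≤ ((t : ℝ) : ℂ).im by simp)
        (show (0:ℝ) ≤ ((s : ℝ) : ℂ).im by simp) (hq'.trans hjs.symm)
      exact_mod_cast this)
    exact hVΓ (hEV (hEmem _ ht htq)) (S.mem_boundaryCurve h j htI)
  -- Now `V` is compact and open, so its image under `time` would be a nonempty compact open subset
  -- of `ℂ`.
  rw [hVcl.closure_eq] at hcomp
  have h1 := (TimeSurface.isOpenMap_time S.C) V hVo
  have h2 := hcomp.image (TimeSurface.continuous_time S.C)
  rcases isClopen_iff.1 ⟨h2.isClosed, h1⟩ with h3 | h3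
  · exact ((nonempty_of_mem hpV).image TimeSurface.time).ne_empty h3
  · rw [h3] at h2
    exact noncompact_univ ℂ h2

/-- The periodgon. -/
theorem fillIn_boundaryCurve :
    fillIn (S.boundaryCurve h) = graph P τ S.core ∪ S.boundaryCurve h := by
  have := TimeSurface.t2Space S.C
  have := TimeSurface.locallyConnectedSpace S.C
  have hcl := (S.isCompact_core_union h).isClosed
  refine Subset.antisymm ?_ ?_
  · rintro p (hp | ⟨hp, hc⟩)
    · exact Or.inr hp
    · by_contra hcon
      exact S.not_isCompact_closure_component h hp (fun hpc => hcon (Or.inl hpc)) hc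
  · rintro p (hp | hp)
    · have hpΓ : p ∉ S.boundaryCurve h := Set.disjoint_left.1 (S.disjoint_core_boundaryCurve h) hp
      refine Or.inr ⟨hpΓ, (S.isCompact_core_union h).of_isClosed_subset isClosed_closure ?_⟩
      refine closure_minimal (fun q hq => Or.inl ?_) hcl
      -- The core part is open and its closure adds only points of the curve, so a component off the
      -- curve that meets it stays in it.
      refine isPreconnected_connectedComponentIn.subset_of_closure_inter_subset
        (S.isOpen_graph h S.isOpen_core S.core_subset) ⟨p, mem_connectedComponentIn hpΓ, hp⟩ ?_ hq
      rintro r ⟨hr, hrV⟩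
      have h1 := closure_minimal (subset_union_left (t := S.boundaryCurve h)) hcl hr
      exact h1.resolve_right (connectedComponentIn_subset _ _ hrV)
    · exact Or.inl hp

lemma starDomain_eq_fillIn :
    starDomain h = fillIn (S.boundaryCurve h) ∪ ⋃ j, S.lift h j '' strip := by
  rw [S.fillIn_boundaryCurve, S.starDomain_eq]

lemma im_pos_or_eq_ofReal {w : ℂ} (hw : w ∈ strip) :
    0 < w.im ∨ ∃ s ∈ Icc (0 : ℝ) 1, w = s := by
  rcases hw.2.2.lt_or_eq with h0 | h0
  · exact Or.inl h0
  · exact Or.inr ⟨w.re, ⟨hw.1, hw.2.1⟩, Complex.ext (by simp) (by simp [← h0])⟩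

lemma strip_inter_fillIn (j : Fin (k + 1)) :
    S.lift h j '' strip ∩ fillIn (S.boundaryCurve h) = (fun s : ℝ => S.lift h j s) '' Icc 0 1 := by
  rw [S.fillIn_boundaryCurve]
  refine Subset.antisymm ?_ ?_
  · rintro _ ⟨⟨w, hw, rfl⟩, hp⟩
    rcases im_pos_or_eq_ofReal hw with h0 | ⟨s, hs, rfl⟩
    · exact absurd hp (S.lift_notMem h j h0)
    · exact ⟨s, hs, rfl⟩
  · rintro _ ⟨s, hs, rfl⟩
    exact ⟨⟨s, ofReal_mem_strip hs, rfl⟩, Or.inr (S.mem_boundaryCurve h j hs)⟩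

lemma lift_ne_of_im_pos {i j : Fin (k + 1)} (hij : i ≠ j) {w w' : ℂ} (hw : 0 < w.im) (hw' : 0 ≤ w'.im) :
    S.lift h i w ≠ S.lift h j w' := fun heq => by
  rcases hw'.lt_or_eq with h0 | h0
  · have := congrArg TimeSurface.pt heq
    rw [S.lift_pt h i hw.le, S.lift_pt h j hw', (S.K i).Φ_eq w hw, (S.K j).Φ_eq w' h0,
      OnePoint.coe_eq_coe] at this
    exact hij (S.eq_of_mem (S.φ_mem i hw) (this ▸ S.φ_mem j h0))
  · have hreal : w' = (w'.re : ℂ) := Complex.ext (by simp) (by simp [← h0])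
    have := congrArg TimeSurface.pt heq
    rw [S.lift_pt h i hw.le, S.lift_pt h j hw', (S.K i).Φ_eq w hw, hreal] at this
    exact S.boundary_notMem j this.symm i (S.φ_mem i hw)

lemma strip_inter_strip {i j : Fin (k + 1)} (hij : i ≠ j) :
    S.lift h i '' strip ∩ S.lift h j '' strip ⊆
      ((fun s : ℝ => S.lift h i s) '' Icc 0 1) ∩ ((fun s : ℝ => S.lift h j s) '' Icc 0 1) := by
  rintro _ ⟨⟨w, hw, rfl⟩, ⟨w', hw', heq⟩⟩
  rcases im_pos_or_eq_ofReal hw with h0 | ⟨s, hs, rfl⟩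
  · exact absurd heq.symm (S.lift_ne_of_im_pos h hij h0 hw'.2.2)
  rcases im_pos_or_eq_ofReal hw' with h0 | ⟨s', hs', rfl⟩
  · exact absurd heq (S.lift_ne_of_im_pos h hij.symm h0 hw.2.2)
  exact ⟨⟨s, hs, rfl⟩, s', hs', heq⟩

end CutCharts

/-! ### The interior of the star domain -/

namespace CutCharts
variable {k : ℕ} {P : Polynomial ℂ} {z : Fin (k + 1) → ℂ} {D : Fin (k + 1) → Set ℂ}
  (S : CutCharts P z D) {τ : ℂ → ℂ} (h : IsTimeBranch P (cutPlane D) τ)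

/-- The part of the star domain over the interior of a periodic domain. -/
lemma exists_strip_of_mem_starDomain {p : TimeSurface P} (hp : p ∈ starDomain h) {j : Fin (k + 1)}
    {u : ℂ} (hu : u ∈ (S.K j).domain) (hpu : p.pt = u) :
    ∃ w ∈ strip, 0 < w.im ∧ p = S.lift h j w := by
  rw [S.starDomain_eq h] at hp
  rcases hp with hp | hp
  · exact absurd hpu (S.pt_ne_of_mem h hp j hu)
  · obtain ⟨i, w, hw, rfl⟩ := mem_iUnion.1 hp
    rcases im_pos_or_eq_ofReal hw with h0 | ⟨s, hs, rfl⟩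
    · rw [S.lift_pt h i hw.2.2, (S.K i).Φ_eq w h0, OnePoint.coe_eq_coe] at hpu
      obtain rfl := S.eq_of_mem (S.φ_mem i h0) (hpu ▸ hu)
      exact ⟨w, hw, h0, rfl⟩
    · exact absurd hpu (S.pt_ne_of_mem h (Or.inr (S.mem_boundaryCurve h i hs)) j hu)

lemma mem_strip_of_lift_mem {j : Fin (k + 1)} {w : ℂ} (hw : 0 < w.im)
    (hmem : S.lift h j w ∈ starDomain h) : w ∈ strip := by
  obtain ⟨w', hw', -, heq⟩ := S.exists_strip_of_mem_starDomain h hmem (S.φ_mem j hw)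
    (by rw [S.lift_pt h j hw.le, (S.K j).Φ_eq w hw])
  rwa [S.lift_injOn h j (show 0 ≤ w.im from hw.le) (strip_subset hw') heq]

/-- Near an interior point small horizontal moves in both directions stay in the star domain, hence
in the strip. -/
lemma lift_mem_interior_re {j : Fin (k + 1)} {w : ℂ} (hw : 0 < w.im)
    (hmem : S.lift h j w ∈ interior (starDomain h)) : 0 < w.re ∧ w.re < 1 := by
  have hev : ∀ d : ℝ, ∀ᶠ t : ℝ in 𝓝[>] 0, S.lift h j (w + t * (d : ℂ)) ∈ starDomain h := fun d => by
    have hline : Tendsto (fun t : ℝ => w + t * (d : ℂ)) (𝓝[>] 0) (𝓝[{w : ℂ | 0 ≤ w.im}] w) := by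
      refine tendsto_nhdsWithin_iff.2 ⟨?_, Eventually.of_forall fun t => by simpa using hw.le⟩
      have : Continuous fun t : ℝ => w + t * (d : ℂ) := by fun_prop
      have := this.tendsto 0
      simp only [Complex.ofReal_zero, zero_mul, add_zero] at this
      exact this.mono_left nhdsWithin_le_nhds
    have := (S.continuousOn_lift h j w hw.le).tendsto.comp hline
    filter_upwards [this.eventually (isOpen_interior.mem_nhds hmem)] with t ht
    exact interior_subset ht
  constructor
  · obtain ⟨t, ht, ht0⟩ := ((hev (-1)).and self_mem_nhdsWithin).exists
    have := (S.mem_strip_of_lift_mem h (by simpa using hw) ht).1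
    have ht0 : 0 < t := ht0
    simp at this
    linarith
  · obtain ⟨t, ht, ht0⟩ := ((hev 1).and self_mem_nhdsWithin).exists
    have := (S.mem_strip_of_lift_mem h (by simpa using hw) ht).2.1
    have ht0 : 0 < t := ht0
    simp at this
    linarith

/-- The points of the star domain over a cut. -/
lemma exists_ray_of_mem_starDomain {p : TimeSurface P} (hp : p ∈ starDomain h) {j : Fin (k + 1)}
    {u : ℂ} (hu : u ∈ D j) (hpu : p.pt = u) :
    ∃ r : ℝ, 0 < r ∧ (p = S.lift h j (r * Complex.I) ∨ p = S.lift h j (1 + r * Complex.I)) := by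
  obtain ⟨w, hw, h0, rfl⟩ := S.exists_strip_of_mem_starDomain h hp (S.cut_subset_domain j hu) hpu
  rw [S.lift_pt h j h0.le, (S.K j).Φ_eq w h0, OnePoint.coe_eq_coe] at hpu
  obtain ⟨-, n, hn⟩ := (S.φ_mem_cut_iff j j h0).1 (hpu ▸ hu)
  refine ⟨w.im, h0, ?_⟩
  have h1 : (0 : ℝ) ≤ n := hn ▸ hw.1
  have h2 : (n : ℝ) ≤ 1 := hn ▸ hw.2.1
  have h1 : 0 ≤ n := by exact_mod_cast h1
  have h2 : n ≤ 1 := by exact_mod_cast h2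
  have h3 : n = 0 ∨ n = 1 := by omega
  rcases h3 with rfl | rfl
  · left; congr 1; exact Complex.ext (by simp [hn]) (by simp)
  · right; congr 1; exact Complex.ext (by simp [hn]) (by simp)

include S

lemma pt_notMem_cut_of_mem_interior {p : TimeSurface P} (hp : p ∈ interior (starDomain h))
    {j : Fin (k + 1)} {u : ℂ} (hu : u ∈ D j) : p.pt ≠ u := fun hpu => by
  obtain ⟨r, hr, rfl | rfl⟩ := S.exists_ray_of_mem_starDomain h (interior_subset hp) hu hpu
  · have := (S.lift_mem_interior_re h (by simpa using hr) hp).1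
    simp at this
  · have := (S.lift_mem_interior_re h (by simpa using hr) hp).2
    simp at this

/-- The cuts reach `∞`, so every sheet at a point over `∞` contains points over `D 0`, which are
never interior. -/
lemma pt_ne_infty_of_mem_interior {p : TimeSurface P} (hp : p ∈ interior (starDomain h)) :
    p.pt ≠ OnePoint.infty := fun hinf => by
  obtain ⟨V, f, hf, hpV, hVsub, -, -, hVt⟩ := p.exists_connected_sheet S.C
    (isOpen_interior.mem_nhds hp)
  have hinfV : OnePoint.infty ∈ V := hinf ▸ hpV.1
  have hray := (S.tendsto_fin_ray 0 Complex.I (by simp)).eventually (hf.eventually_mem hinfV)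
  obtain ⟨r, hr, hr0⟩ := (hray.and self_mem_nhdsWithin).exists
  have hr0 : 0 < r := hr0
  have hq : (⟨_, _, hVt _ hr⟩ : TimeSurface P) ∈ interior (starDomain h) := hVsub ⟨hr, rfl⟩
  refine S.pt_notMem_cut_of_mem_interior h hq (j := 0) (u := (S.K 0).φ (r * Complex.I)) ?_ rfl
  exact (S.φ_mem_cut_iff 0 0 (by simpa using hr0)).2 ⟨rfl, 0, by simp⟩

/-- An interior point lies over the cut plane by the two preceding lemmas; that its time is given by
`τ` is checked on each piece of `starDomain_eq`. -/
theorem interior_starDomain : interior (starDomain h) = graph P τ (cutPlane D) := by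
  refine Subset.antisymm (fun p hp => ?_) ?_
  · obtain ⟨u, hu⟩ := OnePoint.ne_infty_iff_exists.1 (S.pt_ne_infty_of_mem_interior h hp)
    have huU : u ∈ cutPlane D := fun huD => by
      obtain ⟨j, hj⟩ := mem_iUnion.1 huD
      exact S.pt_notMem_cut_of_mem_interior h hp hj hu.symm
    refine mem_graph.2 ⟨u, huU, hu.symm, ?_⟩
    have hpS := interior_subset hp
    rw [S.starDomain_eq h, union_assoc] at hpS
    rcases hpS with hpS | hpS
    · obtain ⟨v, hv, h1, h2⟩ := mem_graph.1 hpS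
      rw [← hu] at h1
      rw [h2, OnePoint.coe_injective h1]
    · obtain ⟨j, w, hw, rfl⟩ := mem_iUnion.1
        (union_subset (S.boundaryCurve_subset h) Subset.rfl hpS)
      rw [S.lift_pt h j hw.2.2] at hu
      rw [S.lift_time h j hw.2.2]
      rcases im_pos_or_eq_ofReal hw with h0 | ⟨s, hs, rfl⟩
      · rw [(S.K j).Φ_eq w h0, OnePoint.coe_eq_coe] at hu
        subst hu
        have hint : ∀ n : ℤ, w.re ≠ n := fun n hn =>
          notMem_cut_of_mem huU j ((S.φ_mem_cut_iff j j h0).2 ⟨rfl, n, hn⟩)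
        exact (S.branch_strip (fun u hu => (h u hu).2) j
          (lt_of_le_of_ne hw.1 fun h1 => hint 0 (by simp [← h1]))
          (lt_of_le_of_ne hw.2.1 fun h1 => hint 1 (by simp [h1])) h0).symm
      · refine (S.branch_boundary h j (lt_of_le_of_ne hs.1 ?_) (lt_of_le_of_ne hs.2 ?_) hu.symm).symm
        · rintro rfl
          rw [Complex.ofReal_zero, S.infty] at hu; exact OnePoint.coe_ne_infty _ hu
        · rintro rfl
          have := S.Φ_int j 1
          rw [Int.cast_one, ← Complex.ofReal_one, ← hu] at this
          exact OnePoint.coe_ne_infty _ this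
  · rw [← range_branchMap h]
    refine interior_maximal subset_closure ?_
    rw [range_branchMap h]
    exact S.isOpen_graph h S.isOpen_cutPlane Subset.rfl

lemma isOpenEmbedding_branchMap : IsOpenEmbedding (branchMap h) := by
  refine .of_continuous_injective_isOpenMap ?_ (fun u v huv => ?_) fun V hV => ?_
  · refine continuous_iff_continuousAt.2 fun u => ?_
    refine tendsto_timeSurface (S.isLocalPrimitive_branch h S.isOpen_cutPlane Subset.rfl)
      ⟨⟨u, u.2, rfl⟩, rfl⟩ ?_ (Eventually.of_forall fun _ => rfl)
    exact (OnePoint.continuous_coe.comp continuous_subtype_val).tendsto u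
  · exact Subtype.ext (OnePoint.coe_injective (congrArg TimeSurface.pt huv))
  · have : branchMap h '' V = graph P τ (Subtype.val '' V) := by
      ext p
      rw [mem_graph]
      constructor
      · rintro ⟨u, hu, rfl⟩; exact ⟨u, ⟨u, hu, rfl⟩, rfl, rfl⟩
      · rintro ⟨_, ⟨u, hu, rfl⟩, h1, h2⟩; exact ⟨u, hu, TimeSurface.ext' h1.symm h2.symm⟩
    rw [this]
    exact S.isOpen_graph h (S.isOpen_cutPlane.isOpenEmbedding_subtypeVal.isOpenMap V hV)
      (by rintro _ ⟨u, -, rfl⟩; exact u.2)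

/-- The time is a holomorphic local coordinate on the graph of the branch. -/
lemma exists_local_coordinate {u : ℂ} (hu : u ∈ cutPlane D) :
    ∃ (e : OpenPartialHomeomorph (TimeSurface P) ℂ) (ψ : ℂ → ℂ),
      branchMap h ⟨u, hu⟩ ∈ e.source ∧ e.source ⊆ graph P τ (cutPlane D) ∧
      EqOn e TimeSurface.time e.source ∧ DifferentiableOn ℂ ψ e.target ∧
      ∀ w ∈ e.target, ∃ hw : ψ w ∈ cutPlane D, e.symm w = branchMap h ⟨ψ w, hw⟩ := by
  classical
  have hUo := S.isOpen_cutPlane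
  have han : AnalyticAt ℂ τ u := DifferentiableOn.analyticAt
    (fun v hv => (h v hv).2.differentiableAt.differentiableWithinAt) (hUo.mem_nhds hu)
  have hst := han.hasStrictDerivAt
  rw [(h u hu).2.deriv] at hst
  have hst' := hst.hasStrictFDerivAt_equiv (one_div_ne_zero (S.eval_ne_of_mem hu))
  -- A local inverse of `τ`, to be transported to the graph.
  set T := (hst'.toOpenPartialHomeomorph τ).restrOpen _ hUo with hT
  have hTcoe : ∀ v, T v = τ v := fun v => rfl
  have hTU : T.source ⊆ cutPlane D := fun v hv => hv.2
  have huT : u ∈ T.source := ⟨hst'.mem_toOpenPartialHomeomorph_source, hu⟩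
  have hsym : ∀ w ∈ T.target, T.symm w ∈ cutPlane D := fun w hw => hTU (T.map_target hw)
  have hτsym : ∀ w ∈ T.target, τ (T.symm w) = w := fun w hw => T.right_inv hw
  let inv : ℂ → TimeSurface P := fun w =>
    if hw : w ∈ T.target then branchMap h ⟨T.symm w, hsym w hw⟩ else branchMap h ⟨u, hu⟩
  have hinv : ∀ (w : ℂ) (hw : w ∈ T.target), inv w = branchMap h ⟨T.symm w, hsym w hw⟩ :=
    fun w hw => dif_pos hw
  let e : OpenPartialHomeomorph (TimeSurface P) ℂ :=
    { toFun := TimeSurface.time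
      invFun := inv
      source := graph P τ T.source
      target := T.target
      map_source' := fun q hq => by
        obtain ⟨v, hv, -, h2⟩ := mem_graph.1 hq
        rw [h2]; exact T.map_source hv
      map_target' := fun w hw => by
        rw [hinv w hw]
        exact mem_graph.2 ⟨_, T.map_target hw, rfl, rfl⟩
      left_inv' := fun q hq => by
        obtain ⟨v, hv, h1, h2⟩ := mem_graph.1 hq
        have hqT : q.time ∈ T.target := by rw [h2]; exact T.map_source hv
        have hs : T.symm q.time = v := by rw [h2]; exact T.left_inv hv
        rw [hinv _ hqT]
        refine TimeSurface.ext' ?_ (hτsym _ hqT)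
        show ((T.symm q.time : ℂ) : OnePoint ℂ) = q.pt
        rw [hs, h1]
      right_inv' := fun w hw => by
        rw [hinv w hw]; exact hτsym w hw
      open_source := S.isOpen_graph h T.open_source hTU
      open_target := T.open_target
      continuousOn_toFun := (TimeSurface.continuous_time S.C).continuousOn
      continuousOn_invFun := fun w hw => by
        rw [ContinuousWithinAt, hinv w hw]
        refine tendsto_timeSurface (S.isLocalPrimitive_branch h hUo Subset.rfl)
          ⟨⟨_, hsym w hw, rfl⟩, rfl⟩ ?_ ?_
        · have hc : Tendsto (fun w => ((T.symm w : ℂ) : OnePoint ℂ)) (𝓝[T.target] w)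
              (𝓝 ((T.symm w : ℂ) : OnePoint ℂ)) :=
            tendsto_coe_coe_iff.2 (T.continuousOn_symm w hw)
          refine hc.congr' ?_
          filter_upwards [self_mem_nhdsWithin] with v hv
          rw [hinv v hv]; rfl
        · filter_upwards [self_mem_nhdsWithin] with v hv
          rw [hinv v hv]; rfl }
  refine ⟨e, T.symm, mem_graph.2 ⟨u, huT, rfl, rfl⟩, graph_mono hTU, fun _ _ => rfl, fun w hw => ?_,
    fun w hw => ⟨hsym w hw, hinv w hw⟩⟩
  have hd := (h _ (hsym w hw)).2
  exact (T.hasDerivAt_symm hw (one_div_ne_zero (S.eval_ne_of_mem (hsym w hw)))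
    hd).differentiableAt.differentiableWithinAt

theorem isBiholomorphicOntoInterior : IsBiholomorphicOntoInterior h := by
  refine ⟨S.isOpen_cutPlane, S.isOpenEmbedding_branchMap h, ?_,
    fun u hu => (h u hu).2.differentiableAt.differentiableWithinAt, fun p hp => ?_⟩
  · rw [range_branchMap, S.interior_starDomain]
  · rw [S.interior_starDomain, ← range_branchMap h] at hp
    obtain ⟨⟨u, hu⟩, rfl⟩ := hp
    rw [S.interior_starDomain]
    exact S.exists_local_coordinate h hu

end CutCharts

/-! ### Existence and uniqueness of the period curve -/

/-- The points over `∞` are isolated. -/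
lemma TimeSurface.eventually_pt_ne_infty {k : ℕ} {P : Polynomial ℂ} (C : InfinityChart k P)
    (p : TimeSurface P) : ∀ᶠ q in 𝓝 p, q ≠ p → q.pt ≠ OnePoint.infty := by
  obtain ⟨V, f, hf, hp⟩ := p.exists_isLocalPrimitive C
  by_cases hinf : p.pt = OnePoint.infty
  · filter_upwards [hf.isOpen_sheet.mem_nhds hp] with q hq hqp hqinf
    exact hqp (TimeSurface.ext' (hqinf.trans hinf.symm) (by rw [hq.2, hp.2, hqinf, hinf]))
  · filter_upwards [((TimeSurface.continuous_pt C).tendsto p).eventually_ne hinf] with q hq _ using hq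

namespace CutCharts
variable {k : ℕ} {P : Polynomial ℂ} {z : Fin (k + 1) → ℂ} {D : Fin (k + 1) → Set ℂ}
  (S : CutCharts P z D) {τ : ℂ → ℂ} (h : IsTimeBranch P (cutPlane D) τ)

/-- Consecutive sides meet by the relation in `branch_near_infty`. Since `j + 1` is cyclic in `Fin
(k + 1)`, the case `j = k` closes the curve. -/
lemma lift_one (j : Fin (k + 1)) : S.lift h (j + 1) (1 : ℝ) = S.lift h j (0 : ℝ) := by
  have h1 := S.Φ_int (j + 1) 1
  have h0 := S.Φ_int j 0
  refine TimeSurface.ext' ?_ ?_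
  · rw [S.lift_real_pt, S.lift_real_pt]
    simp only [Int.cast_one, Int.cast_zero] at h1 h0
    rw [Complex.ofReal_one, Complex.ofReal_zero, h1, h0]
  · rw [S.lift_real_time, S.lift_real_time, (S.branch_near_infty fun u hu => (h u hu).2).1 j]
    simp

/-- The index of the side that is described at the parameter `x`. -/
noncomputable def sideIndex (k : ℕ) (x : ℝ) : Fin (k + 1) := Fin.rev ⟨min ⌊x⌋₊ k, by omega⟩

/-- The lifted boundary curve, described side by side. -/
noncomputable def curve (x : ℝ) : TimeSurface P :=
  S.lift h (sideIndex k x) ((x - (k - (sideIndex k x : ℕ)) : ℝ) : ℂ)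

lemma sideIndex_of_lt (j : Fin (k + 1)) {s : ℝ} (h0 : 0 ≤ s) (h1 : s < 1) :
    sideIndex k ((k : ℝ) - (j : ℕ) + s) = j := by
  have hj := j.is_le
  have hfl : ⌊(k : ℝ) - (j : ℕ) + s⌋₊ = k - j := by
    rw [Nat.floor_eq_iff (by have : (j : ℝ) ≤ k := by exact_mod_cast hj
                             linarith), Nat.cast_sub hj]
    constructor <;> linarith
  apply Fin.ext
  rw [sideIndex, Fin.val_rev]
  simp only [hfl]
  omega

/-- At `s = 1` the floor already selects the next side, and `lift_one` reconciles the two; for `j =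
0` the truncation of the index at `k` keeps the last side. -/
lemma curve_add (j : Fin (k + 1)) {s : ℝ} (hs : s ∈ Icc (0 : ℝ) 1) :
    S.curve h ((k : ℝ) - (j : ℕ) + s) = S.lift h j s := by
  rcases hs.2.lt_or_eq with h1 | rfl
  · rw [curve, sideIndex_of_lt j hs.1 h1, add_sub_cancel_left]
  · rcases Fin.eq_zero_or_eq_succ j with rfl | ⟨i, rfl⟩
    · have : sideIndex k ((k : ℝ) - ((0 : Fin (k + 1)) : ℕ) + 1) = 0 := by
        have hfl : ⌊(k : ℝ) - ((0 : Fin (k + 1)) : ℕ) + 1⌋₊ = k + 1 := by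
          have : (k : ℝ) - ((0 : Fin (k + 1)) : ℕ) + 1 = ((k + 1 : ℕ) : ℝ) := by push_cast; simp
          rw [this, Nat.floor_natCast]
        apply Fin.ext
        rw [sideIndex, Fin.val_rev]
        simp only [hfl]
        simp
      rw [curve, this, add_sub_cancel_left]
    · have hx : (k : ℝ) - (i.succ : ℕ) + 1 = (k : ℝ) - (i.castSucc : ℕ) + 0 := by
        simp
        ring
      rw [hx, curve, sideIndex_of_lt i.castSucc le_rfl one_pos, add_sub_cancel_left,
        ← S.lift_one h, Fin.coeSucc_eq_succ]

lemma exists_param {x : ℝ} (hx : x ∈ Icc (0 : ℝ) ((k : ℝ) + 1)) :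
    ∃ j : Fin (k + 1), ∃ s ∈ Icc (0 : ℝ) 1, x = (k : ℝ) - (j : ℕ) + s := by
  have hv : ((sideIndex k x : ℕ) : ℝ) = k - (min ⌊x⌋₊ k : ℕ) := by
    rw [sideIndex, Fin.val_rev, ← Nat.cast_sub (min_le_right _ _)]
    simp
  refine ⟨sideIndex k x, x - (k - (sideIndex k x : ℕ)), ?_, by ring⟩
  rw [hv, sub_sub_cancel]
  have h1 := Nat.floor_le hx.1
  have h2 := Nat.lt_floor_add_one x
  rcases le_total ⌊x⌋₊ k with hm | hm
  · rw [min_eq_left hm]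
    constructor <;> linarith
  · rw [min_eq_right hm]
    have : (k : ℝ) ≤ ⌊x⌋₊ := by exact_mod_cast hm
    constructor <;> linarith [hx.2]

lemma continuousOn_curve : ContinuousOn (S.curve h) (Icc 0 ((k : ℝ) + 1)) := by
  have heq : Icc (0 : ℝ) ((k : ℝ) + 1) ⊆
      ⋃ j : Fin (k + 1), Icc ((k : ℝ) - (j : ℕ)) ((k : ℝ) - (j : ℕ) + 1) := fun x hx => by
    obtain ⟨j, s, hs, rfl⟩ := exists_param hx
    exact mem_iUnion.2 ⟨j, by constructor <;> linarith [hs.1, hs.2]⟩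
  refine ContinuousOn.mono ((locallyFinite_of_finite _).continuousOn_iUnion
    (fun _ => isClosed_Icc) fun j => ?_) heq
  have hc : Continuous fun x : ℝ => S.lift h j ((x - ((k : ℝ) - (j : ℕ)) : ℝ) : ℂ) :=
    (S.continuousOn_lift_real h j).comp (continuous_id.sub continuous_const)
  refine hc.continuousOn.congr fun x hx => ?_
  have := S.curve_add h j (s := x - ((k : ℝ) - (j : ℕ)))
    ⟨by linarith [hx.1], by linarith [hx.2]⟩
  rwa [add_sub_cancel] at this

lemma pt_eq_infty_or_exists (j : Fin (k + 1)) {s : ℝ} (hs : s ∈ Icc (0 : ℝ) 1) :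
    (S.lift h j s).pt = OnePoint.infty ∨
      ∃ u : cutPlane D, (u : ℂ) ∈ frontier (periodicDomain P (z j)) ∧
        S.lift h j s = branchMap h u := by
  refine or_iff_not_imp_left.2 fun hne => ?_
  have h0 := S.Φ_int j 0
  have h1 := S.Φ_int j 1
  rw [S.lift_real_pt] at hne
  simp only [Int.cast_one, Int.cast_zero] at h1 h0
  obtain ⟨u, hu⟩ := OnePoint.ne_infty_iff_exists.1 hne
  have hs0 : 0 < s := lt_of_le_of_ne hs.1 fun hs => hne (by rw [← hs, Complex.ofReal_zero, h0])
  have hs1 : s < 1 := lt_of_le_of_ne hs.2 fun hs => hne (by rw [hs, Complex.ofReal_one, h1])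
  refine ⟨⟨u, S.mem_cutPlane_of_forall (S.boundary_notMem j hu.symm)⟩, ?_, TimeSurface.ext' ?_ ?_⟩
  · rw [S.frontier_eq]
    exact ⟨s, hu.symm⟩
  · exact (S.lift_real_pt h j s).trans hu.symm
  · rw [S.lift_real_time, ← S.branch_boundary h j hs0 hs1 hu.symm]; rfl

theorem isPeriodCurve_curve : IsPeriodCurve z h (S.curve h) := by
  have hzero : ∀ j : Fin (k + 1), S.curve h ((k : ℝ) - (j : ℕ)) = S.lift h j (0 : ℝ) := fun j => by
    rw [← S.curve_add h j (by simp), add_zero]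
  have h0 := fun j => S.Φ_int j 0
  have h1 := fun j => S.Φ_int j 1
  simp only [Int.cast_one, Int.cast_zero] at h1 h0
  refine ⟨S.continuousOn_curve h, ?_, fun j => ⟨?_, ?_, fun s hs => ⟨?_, ?_⟩⟩⟩
  · have e1 := S.curve_add h 0 (s := 1) (by simp)
    have e2 := hzero (Fin.last k)
    simp only [Fin.val_zero, Nat.cast_zero, sub_zero, Fin.val_last, sub_self] at e1 e2
    rw [e1, e2, ← S.lift_one h, Fin.last_add_one]
  · rw [hzero, S.lift_real_pt, Complex.ofReal_zero, h0]
  · rw [S.curve_add h j (by simp), S.lift_real_pt, Complex.ofReal_one, h1]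
  · rw [S.curve_add h j hs, hzero, S.lift_real_time, S.lift_real_time]
    push_cast
    ring
  · rw [S.curve_add h j hs]
    exact S.pt_eq_infty_or_exists h j hs

/-- A lift of the boundary of a periodic domain is determined by its shape. -/
lemma eq_lift_of_side (j : Fin (k + 1)) {q : ℝ → TimeSurface P} (hq : ContinuousOn q (Icc 0 1)) {A : ℂ}
    (ht : ∀ s ∈ Icc (0 : ℝ) 1, (q s).time = A + s * period P (z j))
    (hp : ∀ s ∈ Icc (0 : ℝ) 1, (q s).pt = OnePoint.infty ∨
      ∃ u : cutPlane D, (u : ℂ) ∈ frontier (periodicDomain P (z j)) ∧ q s = branchMap h u) :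
    ∀ s ∈ Icc (0 : ℝ) 1, q s = S.lift h j s := by
  have := TimeSurface.t2Space S.C
  have hν := S.period_ne j
  -- The time forces `q s` to be the boundary point of parameter `s + δ`. This lies in `(0, 1)` for
  -- `s` close to `0` and for `s` close to `1`, so `δ = 0`.
  set δ : ℂ := (A - S.base τ j) / period P (z j) with hδ
  have hA : A = S.base τ j + period P (z j) * δ := by rw [hδ]; field_simp; ring
  have hfin : ∀ s₀ ∈ Icc (0 : ℝ) 1, ∀ᶠ s in 𝓝[Icc 0 1 \ {s₀}] s₀, ∃ x : ℝ, 0 < x ∧ x < 1 ∧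
      q s = S.lift h j x ∧ (x : ℂ) = s + δ := fun s₀ hs₀ => by
    have hc := ((hq s₀ hs₀).tendsto.mono_left (nhdsWithin_mono s₀
      (sdiff_subset (t := {s₀})))).eventually
      ((q s₀).eventually_pt_ne_infty S.C)
    filter_upwards [hc, self_mem_nhdsWithin] with s hs hsI
    have hne : (q s).pt ≠ OnePoint.infty := hs fun heq => hsI.2 <| by
      have e := congrArg TimeSurface.time heq
      rw [ht s hsI.1, ht s₀ hs₀] at e
      exact Complex.ofReal_injective (mul_right_cancel₀ hν (add_left_cancel e))
    obtain ⟨u, hu, hqu⟩ := (hp s hsI.1).resolve_left hne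
    rw [S.frontier_eq] at hu
    obtain ⟨y, hy⟩ := hu
    obtain ⟨x, hx0, hx1, hx⟩ := S.graph_boundary h j ((S.K j).mem_closure_of_boundary hy)
      (S.boundary_notMem j hy j) (p := branchMap h u) rfl rfl
    refine ⟨x, hx0, hx1, hqu.trans hx, ?_⟩
    have e := congrArg TimeSurface.time (hqu.trans hx)
    rw [ht s hsI.1, S.lift_real_time, hA] at e
    refine mul_left_cancel₀ hν ?_
    linear_combination -e
  have hmono : ∀ s₀ ∈ Icc (0 : ℝ) 1, Tendsto (fun s : ℝ => s) (𝓝[Icc 0 1 \ {s₀}] s₀) (𝓝 s₀) :=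
    fun s₀ _ => tendsto_id.mono_left nhdsWithin_le_nhds
  have hδ0 : δ = 0 := by
    have hz : (0 : ℝ) ∈ Icc (0 : ℝ) 1 := by simp
    have ho : (1 : ℝ) ∈ Icc (0 : ℝ) 1 := by simp
    have := nhdsWithin_Icc_sdiff_neBot hz
    have := nhdsWithin_Icc_sdiff_neBot ho
    have him : δ.im = 0 := by
      obtain ⟨s, x, -, -, -, hx⟩ := (hfin 0 hz).exists
      simpa using (congrArg Complex.im hx).symm
    have h1 : -δ.re ≤ 0 := ge_of_tendsto (hmono 0 hz) <| by
      filter_upwards [hfin 0 hz] with s ⟨x, hx0, _, _, hx⟩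
      have := congrArg Complex.re hx
      simp at this
      linarith
    have h2 : 1 ≤ 1 - δ.re := le_of_tendsto (hmono 1 ho) <| by
      filter_upwards [hfin 1 ho] with s ⟨x, _, hx1, _, hx⟩
      have := congrArg Complex.re hx
      simp at this
      linarith
    exact Complex.ext (le_antisymm (show δ.re ≤ 0 by linarith) (show 0 ≤ δ.re by linarith)) him
  intro s₀ hs₀
  have := nhdsWithin_Icc_sdiff_neBot hs₀
  refine tendsto_nhds_unique ((hq s₀ hs₀).tendsto.mono_left
    (nhdsWithin_mono s₀ (sdiff_subset (t := {s₀}))))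
    ((((S.continuousOn_lift_real h j).tendsto s₀).mono_left nhdsWithin_le_nhds).congr' ?_)
  filter_upwards [hfin s₀ hs₀] with s ⟨x, _, _, hx, hxs⟩
  rw [hδ0, add_zero] at hxs
  rw [hx, hxs]

variable {c : ℝ → TimeSurface P} (hc : IsPeriodCurve z h c)
include hc

theorem periodCurve_eq (j : Fin (k + 1)) {s : ℝ} (hs : s ∈ Icc (0 : ℝ) 1) :
    c ((k : ℝ) - (j : ℕ) + s) = S.lift h j s := by
  have hj : (j : ℝ) ≤ k := by exact_mod_cast j.is_le
  refine S.eq_lift_of_side h j (q := fun s => c ((k : ℝ) - (j : ℕ) + s)) ?_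
    (fun s hs => ((hc.2.2 j).2.2 s hs).1) (fun s hs => ((hc.2.2 j).2.2 s hs).2) s hs
  refine hc.1.comp (continuous_const.add continuous_id).continuousOn fun s hs => ?_
  have : (0 : ℝ) ≤ (j : ℕ) := Nat.cast_nonneg _
  have hs0 := hs.1
  have hs1 := hs.2
  exact ⟨show (0 : ℝ) ≤ k - (j : ℕ) + s by linarith, show (k : ℝ) - (j : ℕ) + s ≤ k + 1 by linarith⟩

lemma periodCurve_time (j : Fin (k + 1)) : (c ((k : ℝ) - (j : ℕ))).time = S.base τ j := by
  have := S.periodCurve_eq h hc j (s := 0) (by simp)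
  rw [add_zero] at this
  rw [this, S.lift_real_time]
  simp

lemma periodgon_eq : periodgon k c = fillIn (S.boundaryCurve h) := by
  rw [periodgon]
  congr 1
  ext p
  constructor
  · rintro ⟨x, hx, rfl⟩
    obtain ⟨j, s, hs, rfl⟩ := exists_param hx
    rw [S.periodCurve_eq h hc j hs]
    exact S.mem_boundaryCurve h j hs
  · intro hp
    obtain ⟨j, s, hs, rfl⟩ := mem_iUnion.1 hp
    refine ⟨(k : ℝ) - (j : ℕ) + s, ?_, S.periodCurve_eq h hc j hs⟩
    have hj : (j : ℝ) ≤ k := by exact_mod_cast j.is_le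
    have : (0 : ℝ) ≤ (j : ℕ) := Nat.cast_nonneg _
    constructor <;> linarith [hs.1, hs.2]

end CutCharts

/-! ### Half-strips, rays and the gluing maps -/

lemma halfStrip_eq_image (a ν : ℂ) :
    halfStrip a ν = (fun w => a + ν * w) '' CutCharts.strip := by
  ext t
  constructor
  · rintro ⟨s, hs, r, hr, rfl⟩
    exact ⟨s + r * Complex.I, ⟨by simpa using hs.1, by simpa using hs.2, by simpa using hr⟩, by ring⟩
  · rintro ⟨w, ⟨h0, h1, hw⟩, rfl⟩
    refine ⟨w.re, ⟨h0, h1⟩, w.im, hw, ?_⟩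
    beta_reduce
    nth_rewrite 1 [← Complex.re_add_im w]
    ring

lemma perpRay_eq_image (a ν w₀ : ℂ) :
    perpRay (a + ν * w₀) ν = (fun r : ℝ => a + ν * (w₀ + r * Complex.I)) '' Ioi 0 := by
  ext t
  constructor
  · rintro ⟨r, hr, rfl⟩
    exact ⟨r, hr, by ring⟩
  · rintro ⟨r, hr, rfl⟩
    exact ⟨r, hr, by ring⟩

lemma segment_eq_image_add (a ν : ℂ) :
    segment ℝ a (a + ν) = (fun s : ℝ => a + ν * s) '' Icc 0 1 := by
  rw [segment_eq_image']
  refine image_congr fun s _ => ?_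
  rw [add_sub_cancel_left, Complex.real_smul, mul_comm]

namespace CutCharts
variable {k : ℕ} {P : Polynomial ℂ} {z : Fin (k + 1) → ℂ} {D : Fin (k + 1) → Set ℂ}
  (S : CutCharts P z D) {τ : ℂ → ℂ} (h : IsTimeBranch P (cutPlane D) τ)

/-- The right inverse of time on the half strip of the side of index `j`. -/
noncomputable def glue (j : Fin (k + 1)) (t : ℂ) : TimeSurface P := S.lift h j (S.coord τ j t)

lemma glue_add (j : Fin (k + 1)) (w : ℂ) :
    S.glue h j (S.base τ j + period P (z j) * w) = S.lift h j w := by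
  rw [glue, S.coord_base_add]

lemma glue_image {α : Type*} (j : Fin (k + 1)) (f : α → ℂ) (A : Set α) :
    S.glue h j '' ((fun x => S.base τ j + period P (z j) * f x) '' A) =
      (fun x => S.lift h j (f x)) '' A := by
  rw [image_image]
  exact image_congr fun x _ => S.glue_add h j (f x)

lemma glue_halfStrip (j : Fin (k + 1)) :
    S.glue h j '' halfStrip (S.base τ j) (period P (z j)) = S.lift h j '' strip := by
  rw [halfStrip_eq_image]
  exact S.glue_image h j (fun w => w) strip

lemma glue_side (j : Fin (k + 1)) :
    S.glue h j '' segment ℝ (S.base τ j) (S.base τ j + period P (z j)) =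
      (fun s : ℝ => S.lift h j s) '' Icc 0 1 := by
  rw [segment_eq_image_add]
  exact S.glue_image h j (fun s : ℝ => (s : ℂ)) (Icc 0 1)

lemma glue_perpRay (j : Fin (k + 1)) (w₀ : ℂ) :
    S.glue h j '' perpRay (S.base τ j + period P (z j) * w₀) (period P (z j)) =
      (fun r : ℝ => S.lift h j (w₀ + r * Complex.I)) '' Ioi 0 := by
  rw [perpRay_eq_image]
  exact S.glue_image h j (fun r : ℝ => w₀ + r * Complex.I) (Ioi 0)

lemma lift_mem_starDomain (j : Fin (k + 1)) {w : ℂ} (hw : w ∈ strip) :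
    S.lift h j w ∈ starDomain h := by
  rw [S.starDomain_eq]
  exact Or.inr (mem_iUnion.2 ⟨j, w, hw, rfl⟩)

lemma lift_pt_of_pos (j : Fin (k + 1)) {w : ℂ} (hw : 0 < w.im) :
    (S.lift h j w).pt = (S.K j).φ w := by
  rw [S.lift_pt h j hw.le, (S.K j).Φ_eq w hw]

lemma starDomain_inter_cut (j : Fin (k + 1)) :
    {p | p ∈ starDomain h ∧ p.pt ∈ ((↑) : ℂ → OnePoint ℂ) '' D j} =
      (fun r : ℝ => S.lift h j (0 + r * Complex.I)) '' Ioi 0 ∪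
        (fun r : ℝ => S.lift h j (1 + r * Complex.I)) '' Ioi 0 := by
  ext p
  constructor
  · rintro ⟨hp, u, hu, hpu⟩
    obtain ⟨r, hr, rfl | rfl⟩ := S.exists_ray_of_mem_starDomain h hp hu hpu.symm
    · exact Or.inl ⟨r, hr, by simp⟩
    · exact Or.inr ⟨r, hr, rfl⟩
  · rintro (⟨r, hr, rfl⟩ | ⟨r, hr, rfl⟩)
    · have hr : 0 < r := hr
      refine ⟨S.lift_mem_starDomain h j ⟨by simp, by simp, by simpa using hr.le⟩, ?_⟩
      rw [S.lift_pt_of_pos h j (by simpa using hr)]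
      exact mem_image_of_mem _ ((S.φ_mem_cut_iff j j (by simpa using hr)).2 ⟨rfl, 0, by simp⟩)
    · have hr : 0 < r := hr
      refine ⟨S.lift_mem_starDomain h j ⟨by simp, by simp, by simpa using hr.le⟩, ?_⟩
      rw [S.lift_pt_of_pos h j (by simpa using hr)]
      exact mem_image_of_mem _ ((S.φ_mem_cut_iff j j (by simpa using hr)).2 ⟨rfl, 1, by simp⟩)

/-- The cases `n = 0` and `n = 1` are used: by periodicity both vertical edges of the strip
parametrize the same cut. -/
lemma cut_diff_center (j : Fin (k + 1)) (n : ℤ) :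
    D j \ {z j} = (fun r : ℝ => (S.K j).φ (n + r * Complex.I)) '' Ioi 0 := by
  have hφ : ∀ r ∈ Ioi (0 : ℝ), (S.K j).φ (n + r * Complex.I) = (S.K j).φ (r * Complex.I) :=
    fun r hr => by rw [add_comm, (S.K j).φ_add_int n (by simpa using hr)]
  rw [image_congr hφ, S.cut_eq, insert_sdiff_self_of_notMem]
  rintro ⟨r, hr, hz⟩
  exact S.φ_ne j (by simpa using hr) j hz

/-- Injectivity holds because points of the chart with equal image differ by an integer, so their
heights on a vertical line agree. -/
lemma bijOn_perpRay (j : Fin (k + 1)) (n : ℤ) :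
    BijOn (fun t => (S.glue h j t).pt)
      (perpRay (S.base τ j + period P (z j) * n) (period P (z j)))
      (((↑) : ℂ → OnePoint ℂ) '' (D j \ {z j})) := by
  have hpt : ∀ r ∈ Ioi (0 : ℝ),
      (S.glue h j (S.base τ j + period P (z j) * (n + r * Complex.I))).pt =
        (S.K j).φ (n + r * Complex.I) := fun r hr => by
    rw [S.glue_add, S.lift_pt_of_pos h j (by simpa using hr)]
  rw [perpRay_eq_image, S.cut_diff_center j n]
  refine ⟨?_, ?_, ?_⟩
  · rintro _ ⟨r, hr, rfl⟩
    exact ⟨_, ⟨r, hr, rfl⟩, (hpt r hr).symm⟩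
  · rintro _ ⟨r, hr, rfl⟩ _ ⟨r', hr', rfl⟩ heq
    have heq := (hpt r hr).symm.trans (heq.trans (hpt r' hr'))
    obtain ⟨m, hm⟩ := (S.K j).inj _ _ (by simpa using hr) (by simpa using hr')
      (OnePoint.coe_injective heq)
    have : r' = r := by simpa using congrArg Complex.im hm
    rw [this]
  · rintro _ ⟨_, ⟨r, hr, rfl⟩, rfl⟩
    exact ⟨_, ⟨r, hr, rfl⟩, hpt r hr⟩

lemma glue_add_period (j : Fin (k + 1)) {t : ℂ}
    (ht : t ∈ perpRay (S.base τ j) (period P (z j))) :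
    (S.glue h j (t + period P (z j))).pt = (S.glue h j t).pt := by
  obtain ⟨r, hr, rfl⟩ := ht
  have hr : 0 < r := hr
  have e1 : S.base τ j + r * (Complex.I * period P (z j)) =
      S.base τ j + period P (z j) * (r * Complex.I) := by ring
  have e2 : S.base τ j + r * (Complex.I * period P (z j)) + period P (z j) =
      S.base τ j + period P (z j) * (r * Complex.I + 1) := by ring
  rw [e2, e1, S.glue_add, S.glue_add, S.lift_pt h j (by simpa using hr.le),
    S.lift_pt h j (by simpa using hr.le), (S.K j).periodic _ (by simpa using hr.le)]

variable {c : ℝ → TimeSurface P} (hc : IsPeriodCurve z h c)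
include hc

/-- Uniqueness of the period curve turns each corner `a j` into `base τ j` and the periodgon into
the filled-in boundary curve, so everything follows from the description of the lifted strips. -/
theorem isGluedFromHalfStrips : IsGluedFromHalfStrips z h c (S.glue h) := by
  simp only [IsGluedFromHalfStrips, S.periodCurve_time h hc, S.periodgon_eq h hc,
    S.glue_halfStrip, S.glue_side]
  refine ⟨fun j => ⟨?_, S.isClosed_lift_image h j isClosed_strip strip_subset, ?_, fun s hs => ?_,
    S.strip_inter_fillIn h j⟩, fun i j hij => S.strip_inter_strip h hij, S.starDomain_eq_fillIn h⟩
  · refine (S.continuousOn_lift h j).comp (S.continuous_coord j).continuousOn ?_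
    rw [halfStrip_eq_image]
    rintro _ ⟨w, hw, rfl⟩
    rw [S.coord_base_add]
    exact strip_subset hw
  · rw [halfStrip_eq_image]
    rintro _ ⟨w, hw, rfl⟩
    beta_reduce
    rw [S.glue_add, S.lift_time h j (strip_subset hw)]
  · rw [mul_comm, S.glue_add, S.periodCurve_eq h hc j hs]

theorem cutsMapToRays : CutsMapToRays z D h c (S.glue h) := fun j => by
  have h0 : S.base τ j = S.base τ j + period P (z j) * ((0 : ℤ) : ℂ) := by simp
  have h1 : S.base τ j + period P (z j) = S.base τ j + period P (z j) * ((1 : ℤ) : ℂ) := by simp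
  simp only [S.periodCurve_time h hc]
  refine ⟨?_, ?_, ?_, fun t ht => S.glue_add_period h j ht⟩
  · have e0 := S.glue_perpRay h j ((0 : ℤ) : ℂ)
    have e1 := S.glue_perpRay h j ((1 : ℤ) : ℂ)
    rw [← h0] at e0
    rw [← h1] at e1
    rw [S.starDomain_inter_cut, e0, e1, Int.cast_zero, Int.cast_one]
  · have := S.bijOn_perpRay h j 0
    rwa [← h0] at this
  · have := S.bijOn_perpRay h j 1
    rwa [← h1] at this

end CutCharts

theorem mainTheorem6 (k : ℕ) (hk : 1 ≤ k) (P : Polynomial ℂ) (hdeg : P.natDegree = k + 1)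
    (hsimple : ∀ a : ℂ, P.IsRoot a → P.derivative.eval a ≠ 0)
    (z : Fin (k + 1) → ℂ) (D : Fin (k + 1) → Set ℂ) (hD : IsCutSystem P z D) :
    (∃ τ : ℂ → ℂ, IsTimeBranch P (cutPlane D) τ) ∧
    ∀ (τ : ℂ → ℂ) (hτ : IsTimeBranch P (cutPlane D) τ),
      IsBiholomorphicOntoInterior hτ ∧
      (∃ c : ℝ → TimeSurface P, IsPeriodCurve z hτ c) ∧
      ∀ c : ℝ → TimeSurface P, IsPeriodCurve z hτ c →
        ∃ g : Fin (k + 1) → ℂ → TimeSurface P,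
          IsGluedFromHalfStrips z hτ c g ∧ CutsMapToRays z D hτ c g := by
  obtain ⟨S⟩ := exists_cutCharts hk hdeg hsimple hD
  exact ⟨S.exists_isTimeBranch, fun τ hτ => ⟨S.isBiholomorphicOntoInterior hτ,
    ⟨_, S.isPeriodCurve_curve hτ⟩, fun c hc =>
      ⟨S.glue hτ, S.isGluedFromHalfStrips hτ hc, S.cutsMapToRays hτ hc⟩⟩⟩
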